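/- **Definitions.** A ($k$-)pointed quandle $\mathcal X=(X,x_1,\dots,x_k)$ is a quandle $X$ with an ordered tuple of elements $x_1,\dots,x_k\in X$ (its basepoints); a homomorphism of $k$-pointed quandles is a quandle homomorphism that sends the $i$-th basepoint to the $i$-th basepoint for every $i$. An ordered $n$-linkoid diagram is a generic immersion in the plane of $n$ oriented intervals, which are ordered, and finitely many oriented circles, with over/under information at the (finitely many, transverse) double points; the endpoints of the intervals (legs and heads) are not double points. Two diagrams represent the same $n$-linkoid if they are related by a finite sequence of planar isotopies, orientation preserving changes of parametrization, Reidemeister moves of types 1, 2, 3 carried out in a disc away from all endpoints, and spherical moves (moving a strand across the point at infinity of the sphere). The fundamental quandle $Q(L)$ of a diagram $L$ is generated by the arcs of $L$, with the relation $a'=a\triangleleft b$ at every positive crossing and $a'=a\triangleleft^{-1}b$ at every negative crossing, where the arc $a$ enters the crossing below, $a'$ leaves it below, and $b$ is the arc on top. The fundamental pointed quandle is the $2n$-pointed quandle $P(L)=(Q(L),l_1,h_1,\dots,l_n,h_n)$, where $l_i$ and $h_i$ are the generators of the arcs adjacent to the leg and the head of the $i$-th open component. **Theorem.** 1. Let $n\ge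 0$, let $\mathcal X$ be a $2n$-pointed quandle, and let $L$, $L'$ be ordered $n$-linkoid diagrams that represent the same linkoid. Then the sets of pointed homomorphisms $P(L)\to\mathcal X$ and $P(L')\to\mathcal X$ have the same cardinality. That is, the pointed quandle counting invariant $\Phi^{\mathbb Z}_{\mathcal X}(L)=|\mathrm{Hom}(P(L),\mathcal X)|$ is a linkoid invariant. 2. Let $X=\{1,\dots,k\}$ be a finite quandle. For every $1$-linkoid diagram $L$ and all $i,j\in X$ there are only finitely many pointed homomorphisms $P(L)\to(X,i,j)$, and the $k\times k$ quandle counting matrix $$\Phi_X^{M_k}(L)=\bigl(\,|\mathrm{Hom}(P(L),(X,i,j))|\,\bigr)_{i,j\in X}$$ is an invariant of $1$-linkoids: if $L$ and $L'$ represent the same $1$-linkoid, then $\Phi_X^{M_k}(L)=\Phi_X^{M_k}(L')$. -/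

import Mathlib

open Set
open scoped Quandles Manifold ContDiff

/-! ### Quandles given by generators and relations -/

/-- Formal words in generators `S` and the two quandle operations. -/
inductive QuandleWord (S : Type) : Type where
  | gen (a : S) : QuandleWord S
  | act (v w : QuandleWord S) : QuandleWord S
  | invAct (v w : QuandleWord S) : QuandleWord S

namespace QuandleWord

/-- The smallest congruence on words that contains `R` and the quandle axioms. -/
inductive Rel {S : Type} (R : QuandleWord S → QuandleWord S → Prop) :
    QuandleWord S → QuandleWord S → Prop where
  | of {v w} (h : R v w) : Rel R v w
  | refl (v) : Rel R v v
  | symm {v w} (h : Rel R v w) : Rel R w v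
  | trans {u v w} (h : Rel R u v) (h' : Rel R v w) : Rel R u w
  | congr_act {v v' w w'} (h : Rel R v v') (h' : Rel R w w') : Rel R (act v w) (act v' w')
  | congr_invAct {v v' w w'} (h : Rel R v v') (h' : Rel R w w') :
      Rel R (invAct v w) (invAct v' w')
  | self_distrib (u v w) : Rel R (act u (act v w)) (act (act u v) (act u w))
  | left_inv (v w) : Rel R (invAct v (act v w)) w
  | right_inv (v w) : Rel R (act v (invAct v w)) w
  | fix (v) : Rel R (act v v) v

/-- The congruence as a setoid. -/
def relSetoid {S : Type} (R : QuandleWord S → QuandleWord S → Prop) : Setoid (QuandleWord S) where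
  r := Rel R
  iseqv := ⟨Rel.refl, Rel.symm, Rel.trans⟩

end QuandleWord

/-- The quandle `Q⟨S | R⟩` presented by generators `S` and relations `R`. -/
def PresentedQuandle {S : Type} (R : QuandleWord S → QuandleWord S → Prop) : Type :=
  Quotient (QuandleWord.relSetoid R)

namespace PresentedQuandle

/-- The class of a word. -/
def mk {S : Type} (R : QuandleWord S → QuandleWord S → Prop) (w : QuandleWord S) :
    PresentedQuandle R :=
  Quotient.mk (QuandleWord.relSetoid R) w

instance instQuandle {S : Type} (R : QuandleWord S → QuandleWord S → Prop) :
    Quandle (PresentedQuandle R) where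
  act := Quotient.map₂ QuandleWord.act fun _ _ h _ _ h' => QuandleWord.Rel.congr_act h h'
  invAct := Quotient.map₂ QuandleWord.invAct fun _ _ h _ _ h' => QuandleWord.Rel.congr_invAct h h'
  self_distrib := by
    rintro ⟨u⟩ ⟨v⟩ ⟨w⟩
    exact Quotient.sound (QuandleWord.Rel.self_distrib u v w)
  left_inv := by
    rintro ⟨v⟩ ⟨w⟩
    exact Quotient.sound (QuandleWord.Rel.left_inv v w)
  right_inv := by
    rintro ⟨v⟩ ⟨w⟩
    exact Quotient.sound (QuandleWord.Rel.right_inv v w)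
  fix := by
    rintro ⟨v⟩
    exact Quotient.sound (QuandleWord.Rel.fix v)

end PresentedQuandle

/-! ### Pointed quandles -/

/-- A `k`-pointed quandle `(X, x₁, …, x_k)`. -/
structure PointedQuandle.{u} (k : ℕ) where
  carrier : Type u
  [quandle : Quandle carrier]
  base : Fin k → carrier

attribute [instance] PointedQuandle.quandle

/-- Homomorphisms of `k`-pointed quandles: quandle homomorphisms that send the `i`-th basepoint
to the `i`-th basepoint. -/
structure PointedQuandle.Hom.{u, v} {k : ℕ} (P : PointedQuandle.{u} k)
    (X : PointedQuandle.{v} k) where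
  toHom : P.carrier →◃ X.carrier
  map_base : ∀ i, toHom (P.base i) = X.base i

/-! ### Linkoid diagrams in the plane `ℂ` -/

namespace Linkoid

/-- Labels of the components: `n` ordered open ones and `m` closed ones. -/
abbrev Comp (n m : ℕ) : Type := Fin n ⊕ Fin m

/-- A parameter: a component together with a time. -/
abbrev Param (n m : ℕ) : Type := Comp n m × ℝ

/-- Open components are parametrised by `[0, 1]`, closed ones by `ℝ` with period `1`. -/
def timeDomain {n m : ℕ} : Comp n m → Set ℝ
  | Sum.inl _ => Icc 0 1
  | Sum.inr _ => univ

/-- Parameters that represent a point of the disjoint union of `n` intervals and `m` circles. -/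
def Valid {n m : ℕ} (p : Param n m) : Prop := p.2 ∈ timeDomain p.1

/-- Two parameters represent the same point of the disjoint union of intervals and circles. -/
def SamePoint {n m : ℕ} (p q : Param n m) : Prop :=
  p.1 = q.1 ∧ (p.2 = q.2 ∨ (p.1.isRight ∧ ∃ k : ℤ, q.2 = p.2 + k))

/-- `p` and `q` are two different points of the domain with the same image in the plane. -/
def IsDouble {n m : ℕ} (curve : Comp n m → ℝ → ℂ) (p q : Param n m) : Prop :=
  Valid p ∧ Valid q ∧ ¬ SamePoint p q ∧ curve p.1 p.2 = curve q.1 q.2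

/-- The determinant of the pair of plane vectors `(z, w)`. -/
def planeDet (z w : ℂ) : ℝ := z.re * w.im - z.im * w.re

/-- An oriented `n`-linkoid diagram with `m` closed components, the open components being ordered:
a generic immersion of `n` intervals and `m` circles in the plane with over/under information
at the double points. Open components run from their leg (time `0`) to their head (time `1`);
the values of `curve` on open components at times outside `[0, 1]` have no meaning. -/
structure Diagram (n m : ℕ) where
  curve : Comp n m → ℝ → ℂ
  smooth : ∀ c, ContDiff ℝ ∞ (curve c)
  periodic : ∀ j : Fin m, Function.Periodic (curve (Sum.inr j)) 1
  immersed : ∀ p : Param n m, Valid p → deriv (curve p.1) p.2 ≠ 0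
  finite_double : {p : Param n m | p.2 ∈ Icc 0 1 ∧ ∃ q, IsDouble curve p q}.Finite
  no_triple : ∀ p q r, IsDouble curve p q → IsDouble curve p r → SamePoint q r
  transverse : ∀ p q, IsDouble curve p q →
    planeDet (deriv (curve p.1) p.2) (deriv (curve q.1) q.2) ≠ 0
  endpoint_simple : ∀ p q, IsDouble curve p q → p.1.isLeft → p.2 ≠ 0 ∧ p.2 ≠ 1
  /-- The parameters at which the curve passes under another strand. -/
  under : Set (Param n m)
  under_double : ∀ p ∈ under, ∃ q, IsDouble curve p q
  under_iff : ∀ p q, IsDouble curve p q → (p ∈ under ↔ q ∉ under)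

namespace Diagram

variable {n m : ℕ}

/-! ### The fundamental pointed quandle -/

/-- Points of the domain that are not undercrossings. -/
def ArcPoint (D : Diagram n m) : Type := {p : Param n m // Valid p ∧ p ∉ D.under}

/-- Two points can be joined on a component without passing an undercrossing. -/
def arcRel (D : Diagram n m) (p q : D.ArcPoint) : Prop :=
  SamePoint p.1 q.1 ∨
    (p.1.1 = q.1.1 ∧ ∀ t ∈ uIcc p.1.2 q.1.2, (p.1.1, t) ∉ D.under)

/-- The arcs of a diagram: the pieces into which the components are cut at undercrossings. -/
def Arc (D : Diagram n m) : Type := Quot D.arcRel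

/-- The arc through a point, as a generator. -/
def arcGen (D : Diagram n m) (p : Param n m) (hp : Valid p ∧ p ∉ D.under) : QuandleWord D.Arc :=
  QuandleWord.gen (Quot.mk D.arcRel ⟨p, hp⟩)

/-- The crossing relations. At the undercrossing `(c, t)`, whose over-passing strand is at the
parameter `o`, let `a` be the arc that arrives at the undercrossing (it contains `(c, s)` for a time
`s < t` with no undercrossing in `[s, t)`), let `a'` be the arc that leaves it, and `b` the arc
passing over. The relation is `a' = b ◃ a` at a positive and `a' = b ◃⁻¹ a` at a negative
crossing; here `b ◃ a` is the result of acting by `b` on `a`. -/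
def crossingRel (D : Diagram n m) (w w' : QuandleWord D.Arc) : Prop :=
  ∃ (c : Comp n m) (s t s' : ℝ) (o : Param n m)
    (hs : Valid (c, s) ∧ (c, s) ∉ D.under) (hs' : Valid (c, s') ∧ (c, s') ∉ D.under)
    (ho : Valid o ∧ o ∉ D.under),
    s < t ∧ t < s' ∧ (c, t) ∈ D.under ∧ IsDouble D.curve (c, t) o ∧
    (∀ r ∈ Ico s t, (c, r) ∉ D.under) ∧ (∀ r ∈ Ioc t s', (c, r) ∉ D.under) ∧
    w = D.arcGen (c, s') hs' ∧
    ((0 < planeDet (deriv (D.curve o.1) o.2) (deriv (D.curve c) t) ∧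
        w' = QuandleWord.act (D.arcGen o ho) (D.arcGen (c, s) hs)) ∨
      (planeDet (deriv (D.curve o.1) o.2) (deriv (D.curve c) t) < 0 ∧
        w' = QuandleWord.invAct (D.arcGen o ho) (D.arcGen (c, s) hs)))

/-- The fundamental quandle `Q(L)`. -/
abbrev FundamentalQuandle (D : Diagram n m) : Type := PresentedQuandle D.crossingRel

theorem leg_mem (D : Diagram n m) (i : Fin n) :
    Valid ((Sum.inl i, 0) : Param n m) ∧ ((Sum.inl i, 0) : Param n m) ∉ D.under := by
  refine ⟨by simp [Valid, timeDomain], fun h => ?_⟩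
  obtain ⟨q, hq⟩ := D.under_double _ h
  exact (D.endpoint_simple _ _ hq rfl).1 rfl

theorem head_mem (D : Diagram n m) (i : Fin n) :
    Valid ((Sum.inl i, 1) : Param n m) ∧ ((Sum.inl i, 1) : Param n m) ∉ D.under := by
  refine ⟨by simp [Valid, timeDomain], fun h => ?_⟩
  obtain ⟨q, hq⟩ := D.under_double _ h
  exact (D.endpoint_simple _ _ hq rfl).2 rfl

/-- The generator `l_i` of the arc adjacent to the leg of the `i`-th open component. -/
def leg (D : Diagram n m) (i : Fin n) : D.FundamentalQuandle :=
  PresentedQuandle.mk D.crossingRel (D.arcGen (Sum.inl i, 0) (D.leg_mem i))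

/-- The generator `h_i` of the arc adjacent to the head of the `i`-th open component. -/
def head (D : Diagram n m) (i : Fin n) : D.FundamentalQuandle :=
  PresentedQuandle.mk D.crossingRel (D.arcGen (Sum.inl i, 1) (D.head_mem i))

/-- The fundamental pointed quandle `P(L) = (Q(L), l₁, h₁, …, l_n, h_n)`. -/
def fundamentalPointedQuandle (D : Diagram n m) : PointedQuandle.{0} (2 * n) where
  carrier := D.FundamentalQuandle
  base k := if k.val % 2 = 0 then D.leg ⟨k.val / 2, by omega⟩ else D.head ⟨k.val / 2, by omega⟩

/-! ### Equivalence of diagrams -/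

/-- Planar isotopy: `D'` is the image of `D` under an orientation preserving diffeomorphism of the
plane (every such diffeomorphism is isotopic to the identity). -/
def PlanarIsotopy (D D' : Diagram n m) : Prop :=
  ∃ Φ : ℂ ≃ₘ[ℝ] ℂ, (∀ z, 0 < (fderiv ℝ Φ z).det) ∧
    (∀ p : Param n m, Valid p → D'.curve p.1 p.2 = Φ (D.curve p.1 p.2)) ∧ D'.under = D.under

/-- Spherical move: the point `a` in the complement of the diagram becomes the point at infinity.
Together with planar isotopies this generates the isotopies of diagrams in the sphere. -/
def SphericalMove (D D' : Diagram n m) : Prop :=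
  ∃ a : ℂ, (∀ p : Param n m, Valid p → D.curve p.1 p.2 ≠ a) ∧
    (∀ p : Param n m, Valid p → D'.curve p.1 p.2 = (D.curve p.1 p.2 - a)⁻¹) ∧ D'.under = D.under

/-- Change of the parametrisation and of the labels of the closed components, keeping all
orientations and the order of the open components. -/
def Reparametrization (D D' : Diagram n m) : Prop :=
  ∃ (σ : Equiv.Perm (Fin m)) (ρ : Comp n m → ℝ → ℝ),
    (∀ c, ContDiff ℝ ∞ (ρ c)) ∧ (∀ p : Param n m, Valid p → 0 < deriv (ρ p.1) p.2) ∧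
    (∀ i : Fin n, ρ (Sum.inl i) 0 = 0 ∧ ρ (Sum.inl i) 1 = 1) ∧
    (∀ (j : Fin m) (t : ℝ), ρ (Sum.inr j) (t + 1) = ρ (Sum.inr j) t + 1) ∧
    ∀ p : Param n m, Valid p →
      D'.curve p.1 p.2 = D.curve (Sum.map id σ p.1) (ρ p.1 p.2) ∧
      (p ∈ D'.under ↔ (Sum.map id σ p.1, ρ p.1 p.2) ∈ D.under)

end Diagram

/-- `k` pairwise disjoint strands (closed time intervals on components) that avoid all endpoints
of open components. -/
structure Strands (n m k : ℕ) where
  comp : Fin k → Comp n m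
  start : Fin k → ℝ
  finish : Fin k → ℝ
  start_lt_finish : ∀ i, start i < finish i
  inside_open : ∀ i, (comp i).isLeft → 0 < start i ∧ finish i < 1
  inside_closed : ∀ i, (comp i).isRight → finish i < start i + 1
  disjoint : ∀ i j, i ≠ j → ∀ s ∈ Icc (start i) (finish i), ∀ t ∈ Icc (start j) (finish j),
    ¬ SamePoint (comp i, s) (comp j, t)

namespace Strands

variable {n m k : ℕ}

/-- The time interval of the `i`-th strand. -/
def interval (T : Strands n m k) (i : Fin k) : Set ℝ := Icc (T.start i) (T.finish i)

/-- The parameters that represent a point on one of the strands. -/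
def points (T : Strands n m k) : Set (Param n m) :=
  {p | ∃ i, ∃ t ∈ T.interval i, SamePoint p (T.comp i, t)}

/-- The part of `D` in the closed unit disc consists exactly of the given strands, and these are in
the open disc except at their ends. -/
def FillDisc (T : Strands n m k) (D : Diagram n m) : Prop :=
  (∀ p : Param n m, Valid p → (‖D.curve p.1 p.2‖ ≤ 1 ↔ p ∈ T.points)) ∧
    ∀ i, ∀ t ∈ Ioo (T.start i) (T.finish i), ‖D.curve (T.comp i) t‖ < 1

/-- Both diagrams meet the unit disc in the given strands, and outside the unit disc they
coincide. -/
def LocalChange (T : Strands n m k) (D D' : Diagram n m) : Prop :=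
  T.FillDisc D ∧ T.FillDisc D' ∧ ∀ p : Param n m, Valid p → p ∉ T.points →
    D'.curve p.1 p.2 = D.curve p.1 p.2 ∧ (p ∈ D'.under ↔ p ∈ D.under)

/-- The curve that `D` runs through on the `i`-th strand. -/
def path (T : Strands n m k) (D : Diagram n m) (i : Fin k) : ℝ → ℂ := D.curve (T.comp i)

/-- `D` passes under another strand at time `t` of the `i`-th strand. -/
def Under (T : Strands n m k) (D : Diagram n m) (i : Fin k) (t : ℝ) : Prop :=
  (T.comp i, t) ∈ D.under

end Strands

namespace Diagram

variable {n m : ℕ}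

/-- First Reidemeister move, inside the unit disc: `D` has one strand with exactly one self-crossing
there, and `D'` has the strand without a crossing. All signs and both over/under choices
are allowed. -/
def ReidemeisterOne (D D' : Diagram n m) : Prop :=
  ∃ T : Strands n m 1, T.LocalChange D D' ∧
    InjOn (T.path D' 0) (T.interval 0) ∧
    ∃ s ∈ T.interval 0, ∃ t ∈ T.interval 0, s < t ∧ T.path D 0 s = T.path D 0 t ∧
      ∀ s' ∈ T.interval 0, ∀ t' ∈ T.interval 0, s' < t' →
        T.path D 0 s' = T.path D 0 t' → s' = s ∧ t' = t

/-- Second Reidemeister move, inside the unit disc: strand `0` is the real diameter (traversed in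
one of the two directions). In `D'` strand `1` is a simple arc above the diameter; in `D` it is a
simple arc that starts above, dips below the diameter and comes back up, being under at both
crossings or over at both crossings. -/
def ReidemeisterTwo (D D' : Diagram n m) : Prop :=
  ∃ T : Strands n m 2, T.LocalChange D D' ∧
    (∀ t ∈ T.interval 0, (T.path D 0 t).im = 0 ∧ T.path D' 0 t = T.path D 0 t) ∧
    InjOn (T.path D 1) (T.interval 1) ∧ InjOn (T.path D' 1) (T.interval 1) ∧
    (∀ t ∈ T.interval 1, 0 < (T.path D' 1 t).im) ∧
    ∃ t₁ t₂ : ℝ, T.start 1 < t₁ ∧ t₁ < t₂ ∧ t₂ < T.finish 1 ∧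
      (∀ t ∈ Ico (T.start 1) t₁, 0 < (T.path D 1 t).im) ∧
      (∀ t ∈ Ioo t₁ t₂, (T.path D 1 t).im < 0) ∧
      (∀ t ∈ Ioc t₂ (T.finish 1), 0 < (T.path D 1 t).im) ∧
      (T.Under D 1 t₁ ↔ T.Under D 1 t₂)

/-- Third Reidemeister move, inside the unit disc: strand `0` is the real diameter and strand `1` the
imaginary diameter, each traversed in one of its two directions, and they are the same in `D`
and `D'`. Strand `2` is a simple arc from the fourth to the second quadrant, which passes through
the first quadrant in `D` and through the third quadrant in `D'`. The strands have different
heights, the same in `D` and `D'`, which determine who passes under whom. -/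
def ReidemeisterThree (D D' : Diagram n m) : Prop :=
  ∃ T : Strands n m 3, T.LocalChange D D' ∧
    (∀ t ∈ T.interval 0, (T.path D 0 t).im = 0 ∧ T.path D' 0 t = T.path D 0 t) ∧
    (∀ t ∈ T.interval 1, (T.path D 1 t).re = 0 ∧ T.path D' 1 t = T.path D 1 t) ∧
    InjOn (T.path D 2) (T.interval 2) ∧ InjOn (T.path D' 2) (T.interval 2) ∧
    ∃ (height : Fin 3 → ℤ) (t₀ t₁ t₂ t₁' t₂' : ℝ), Function.Injective height ∧
      -- crossing of the strands `0` and `1`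
      t₀ ∈ T.interval 0 ∧ T.path D 0 t₀ = 0 ∧
      (T.Under D 0 t₀ ↔ height 0 < height 1) ∧ (T.Under D' 0 t₀ ↔ height 0 < height 1) ∧
      -- strand `2` in `D`: it meets strand `0` at time `t₁` and strand `1` at time `t₂`
      T.start 2 < t₁ ∧ t₁ < t₂ ∧ t₂ < T.finish 2 ∧
      (∀ t ∈ Ico (T.start 2) t₁, 0 < (T.path D 2 t).re ∧ (T.path D 2 t).im < 0) ∧
      (∀ t ∈ Ioo t₁ t₂, 0 < (T.path D 2 t).re ∧ 0 < (T.path D 2 t).im) ∧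
      (∀ t ∈ Ioc t₂ (T.finish 2), (T.path D 2 t).re < 0 ∧ 0 < (T.path D 2 t).im) ∧
      (T.Under D 2 t₁ ↔ height 2 < height 0) ∧ (T.Under D 2 t₂ ↔ height 2 < height 1) ∧
      -- strand `2` in `D'`: it meets strand `1` at time `t₁'` and strand `0` at time `t₂'`
      T.start 2 < t₁' ∧ t₁' < t₂' ∧ t₂' < T.finish 2 ∧
      (∀ t ∈ Ico (T.start 2) t₁', 0 < (T.path D' 2 t).re ∧ (T.path D' 2 t).im < 0) ∧
      (∀ t ∈ Ioo t₁' t₂', (T.path D' 2 t).re < 0 ∧ (T.path D' 2 t).im < 0) ∧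
      (∀ t ∈ Ioc t₂' (T.finish 2), (T.path D' 2 t).re < 0 ∧ 0 < (T.path D' 2 t).im) ∧
      (T.Under D' 2 t₁' ↔ height 2 < height 1) ∧ (T.Under D' 2 t₂' ↔ height 2 < height 0)

/-- One elementary change of a diagram. -/
def Move (D D' : Diagram n m) : Prop :=
  PlanarIsotopy D D' ∨ SphericalMove D D' ∨ Reparametrization D D' ∨
    ReidemeisterOne D D' ∨ ReidemeisterTwo D D' ∨ ReidemeisterThree D D'

/-- Two diagrams represent the same linkoid. -/
def SameLinkoid (D D' : Diagram n m) : Prop := Relation.EqvGen Move D D'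

/-! ### The counting invariants -/

/-- The set of colorings of a linkoid diagram by a `2n`-pointed quandle, that is, of pointed
homomorphisms `P(L) → X`. -/
abbrev PointedColoring.{u} (D : Diagram n m) (X : PointedQuandle.{u} (2 * n)) : Type u :=
  PointedQuandle.Hom D.fundamentalPointedQuandle X

/-- The pointed quandle counting invariant, a cardinal number. -/
noncomputable def pointedCount.{u} (D : Diagram n m) (X : PointedQuandle.{u} (2 * n)) :
    Cardinal.{u} :=
  Cardinal.mk (D.PointedColoring X)

/-- The `2`-pointed quandle `(X, i, j)`. -/
def twoPointed.{u} (X : Type u) [Quandle X] (i j : X) : PointedQuandle.{u} (2 * 1) where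
  carrier := X
  base := ![i, j]

/-- The quandle counting matrix of a `1`-linkoid diagram with respect to a finite quandle `X`; rows
and columns are indexed by the elements of `X`. -/
noncomputable def countingMatrix.{u} (D : Diagram 1 m) (X : Type u) [Quandle X] : Matrix X X ℕ :=
  Matrix.of fun i j => Nat.card (D.PointedColoring (twoPointed X i j))

end Diagram

end Linkoid

universe u

/-! A homomorphism out of a presented quandle is a choice of values for the generators that
satisfies the relations. Pointed homomorphisms `P(L) → X` are therefore colorings of the diagram
with prescribed colors at the legs and heads. A coloring is encoded as a function of all parameters
rather than of arcs: it is locally constant to the left of every time and to the right of every time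
that is not an undercrossing, and at an undercrossing it jumps by the action of the over-passing
color with the sign of the crossing (`Diagram.IsColoring`, `Diagram.homEquiv`). These conditions are
local, so colorings can be restricted, glued and reparametrised, and it suffices to match the
colorings of two diagrams that differ by one move.

Planar isotopies, spherical moves and changes of parametrisation preserve the crossings, their signs
and their order on the components; colorings are pulled back along the change of parameters
(`Diagram.Relabeling`).

For a Reidemeister move, the crossings in the disc determine the colors on the strands uniquely and
without obstruction from the colors at their starts (`Strands.Solves`). If both sides of the move
produce the same colors at the finishes, exchanging the interior of the disc is a bijection of
colorings (`Strands.LocalChange.sameColorings`); the base colors are untouched because the disc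
contains no endpoints. What remains is one quandle axiom per move: idempotence (`signAct_self`),
invertibility (`signAct_cancel`) and self-distributivity (`signAct_distrib`). All directions and
height orders of the third move are treated at once in `Strands.triangleColor_finish`: the move
reverses the order of the two crossings on each strand, and the signs of the crossings are tied to
these orders by `Strands.crossingSign_iff`.

Finiteness of the matrix entries holds because a coloring is determined by its colors just after
finitely many cut points (`Diagram.IsColoring.eq_of_rightValue`). -/

/-! ### Homomorphisms out of presented quandles -/

namespace QuandleWord

/-- The value of a word in a quandle, given the values of the generators. -/
def eval {S : Type} {X : Type u} [Quandle X] (φ : S → X) : QuandleWord S → X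
  | gen a => φ a
  | act v w => eval φ v ◃ eval φ w
  | invAct v w => eval φ v ◃⁻¹ eval φ w

/-- The quandle axioms hold in `X`, so along the generation of the congruence only the relations in
`R` impose a condition on `φ`. -/
theorem Rel.eval_eq {S : Type} {X : Type u} [Quandle X] {R : QuandleWord S → QuandleWord S → Prop}
    {φ : S → X} (hφ : ∀ v w, R v w → eval φ v = eval φ w) {v w : QuandleWord S}
    (h : Rel R v w) : eval φ v = eval φ w := by
  induction h with
  | of h => exact hφ _ _ h
  | refl v => rfl
  | symm _ ih => exact ih.symm
  | trans _ _ ih ih' => exact ih.trans ih'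
  | congr_act _ _ ih ih' => simp only [eval, ih, ih']
  | congr_invAct _ _ ih ih' => simp only [eval, ih, ih']
  | self_distrib u v w => exact Shelf.self_distrib
  | left_inv v w => exact Rack.left_inv _ _
  | right_inv v w => exact Rack.right_inv _ _
  | fix v => exact Quandle.fix

end QuandleWord

theorem ShelfHom.map_invAct' {Q : Type*} {X : Type*} [Rack Q] [Rack X] (φ : Q →◃ X) (v w : Q) :
    φ (v ◃⁻¹ w) = φ v ◃⁻¹ φ w := by
  rw [← Rack.left_cancel (φ v), ← φ.map_act, Rack.right_inv, Rack.right_inv]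

namespace PresentedQuandle

variable {S : Type} {X : Type u} [Quandle X] {R : QuandleWord S → QuandleWord S → Prop}

/-- The homomorphism on a presented quandle given by values of the generators that satisfy the
relations. -/
def lift (φ : S → X) (hφ : ∀ v w, R v w → v.eval φ = w.eval φ) : PresentedQuandle R →◃ X where
  toFun := Quotient.lift (QuandleWord.eval φ) fun _ _ h => QuandleWord.Rel.eval_eq hφ h
  map_act' := by
    rintro ⟨v⟩ ⟨w⟩
    rfl

theorem map_mk (φ : PresentedQuandle R →◃ X) (w : QuandleWord S) :
    φ (mk R w) = w.eval fun a => φ (mk R (.gen a)) := by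
  induction w with
  | gen a => rfl
  | act v w ihv ihw =>
    rw [QuandleWord.eval, ← ihv, ← ihw, ← φ.map_act]
    rfl
  | invAct v w ihv ihw =>
    rw [QuandleWord.eval, ← ihv, ← ihw, ← φ.map_invAct']
    rfl

theorem hom_ext {φ ψ : PresentedQuandle R →◃ X}
    (h : ∀ a, φ (mk R (.gen a)) = ψ (mk R (.gen a))) : φ = ψ := by
  refine DFunLike.ext _ _ ?_
  rintro ⟨w⟩
  exact (map_mk φ w).trans ((congrArg (fun χ => w.eval χ) (funext h)).trans (map_mk ψ w).symm)

theorem mk_eq_mk {v w : QuandleWord S} (h : R v w) : mk R v = mk R w :=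
  Quotient.sound (QuandleWord.Rel.of h)

end PresentedQuandle

/-! ### The action with a sign -/

/-- The action of `b` on `a` if `d` is positive, and the inverse action otherwise. -/
noncomputable def signAct {X : Type u} [Rack X] (d : ℝ) (b a : X) : X :=
  if 0 < d then b ◃ a else b ◃⁻¹ a

section signAct

variable {X : Type u} [Rack X]

theorem signAct_of_pos {d : ℝ} (h : 0 < d) (b a : X) : signAct d b a = b ◃ a := if_pos h

theorem signAct_of_neg {d : ℝ} (h : d < 0) (b a : X) : signAct d b a = b ◃⁻¹ a :=
  if_neg h.not_gt

theorem signAct_congr {d e : ℝ} (h : 0 < d ↔ 0 < e) (b a : X) :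
    signAct d b a = signAct e b a := by
  simp only [signAct, h]

/-- The algebra of the second move: passing twice under the same color with opposite signs has no
effect. -/
theorem signAct_cancel {d e : ℝ} (h : d * e < 0) (b a : X) :
    signAct d b (signAct e b a) = a := by
  rcases mul_neg_iff.1 h with ⟨hd, he⟩ | ⟨hd, he⟩
  · rw [signAct_of_pos hd, signAct_of_neg he, Rack.right_inv]
  · rw [signAct_of_neg hd, signAct_of_pos he, Rack.left_inv]

/-- The algebra of the third move: the action of `x` and its inverse are automorphisms, hence
respect both operations. This covers all four combinations of signs. -/
theorem signAct_distrib (d e : ℝ) (x y z : X) :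
    signAct d x (signAct e y z) = signAct e (signAct d x y) (signAct d x z) := by
  have hom (x y z : X) : x ◃⁻¹ y ◃ z = (x ◃⁻¹ y) ◃ x ◃⁻¹ z := by
    rw [← Rack.left_cancel x, Shelf.self_distrib, Rack.right_inv, Rack.right_inv, Rack.right_inv]
  have hom' (x y z : X) : x ◃ y ◃⁻¹ z = (x ◃ y) ◃⁻¹ x ◃ z := by
    rw [← Rack.left_cancel (x ◃ y), ← Shelf.self_distrib, Rack.right_inv, Rack.right_inv]
  unfold signAct
  split_ifs
  · exact Shelf.self_distrib
  · exact hom' x y z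
  · exact hom x y z
  · exact Rack.self_distrib_inv

/-- The algebra of the first move, and the only place among the sign rules where a quandle rather
than a rack is needed. -/
theorem signAct_self {X : Type u} [Quandle X] (d : ℝ) (a : X) : signAct d a a = a := by
  unfold signAct
  split_ifs
  · exact Quandle.fix
  · exact Quandle.fix_inv

theorem signAct_injective (d : ℝ) (b : X) : Function.Injective (signAct d b) := by
  intro a a' h
  unfold signAct at h
  split_ifs at h
  · exact (Rack.left_cancel _).1 h
  · exact (Rack.left_cancel_inv _).1 h

end signAct

/-! ### Colorings of a diagram -/

namespace Linkoid

open Filter Topology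

variable {n m : ℕ}

/-! ### Parameters of the same point, and discreteness of the undercrossings -/

theorem SamePoint.refl (p : Param n m) : SamePoint p p := ⟨rfl, Or.inl rfl⟩

theorem SamePoint.symm {p q : Param n m} (h : SamePoint p q) : SamePoint q p := by
  obtain ⟨h, h' | ⟨hr, k, hk⟩⟩ := h
  · exact ⟨h.symm, Or.inl h'.symm⟩
  · refine ⟨h.symm, Or.inr ⟨h ▸ hr, -k, ?_⟩⟩
    push_cast
    linarith

theorem SamePoint.trans {p q r : Param n m} (h : SamePoint p q) (h' : SamePoint q r) :
    SamePoint p r := by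
  obtain ⟨h, h1⟩ := h
  obtain ⟨h', h2⟩ := h'
  refine ⟨h.trans h', ?_⟩
  rcases h1 with h1 | ⟨hr, k, hk⟩ <;> rcases h2 with h2 | ⟨hr', l, hl⟩
  · exact Or.inl (h1.trans h2)
  · exact Or.inr ⟨h ▸ hr', l, by rw [hl, h1]⟩
  · exact Or.inr ⟨hr, k, by rw [← h2, hk]⟩
  · exact Or.inr ⟨hr, k + l, by rw [hl, hk]; push_cast; ring⟩

theorem SamePoint.add_int (j : Fin m) (t : ℝ) (k : ℤ) :
    SamePoint ((Sum.inr j, t) : Param n m) (Sum.inr j, t + k) := ⟨rfl, Or.inr ⟨rfl, k, rfl⟩⟩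

theorem SamePoint.eq_or {p q : Param n m} (h : SamePoint p q) :
    q = p ∨ ∃ (j : Fin m) (k : ℤ), p.1 = Sum.inr j ∧ q = (Sum.inr j, p.2 + k) := by
  obtain ⟨c, s⟩ := p
  obtain ⟨c', t⟩ := q
  obtain ⟨rfl, h | ⟨hr, k, hk⟩⟩ := h
  · exact Or.inl (Prod.ext rfl h.symm)
  · obtain ⟨j, rfl⟩ := Sum.isRight_iff.1 hr
    exact Or.inr ⟨j, k, rfl, Prod.ext rfl hk⟩

theorem valid_inr (j : Fin m) (t : ℝ) : Valid ((Sum.inr j, t) : Param n m) := mem_univ _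

theorem Valid.congr {p q : Param n m} (h : SamePoint p q) (hp : Valid p) : Valid q := by
  obtain rfl | ⟨j, k, -, rfl⟩ := h.eq_or
  · exact hp
  · exact valid_inr _ _

theorem planeDet_swap (z w : ℂ) : planeDet w z = -planeDet z w := by
  unfold planeDet
  ring

theorem IsDouble.symm {curve : Comp n m → ℝ → ℂ} {p q : Param n m} (h : IsDouble curve p q) :
    IsDouble curve q p :=
  ⟨h.2.1, h.1, fun h' => h.2.2.1 h'.symm, h.2.2.2.symm⟩

namespace Diagram

theorem curve_congr (D : Diagram n m) {p q : Param n m} (h : SamePoint p q) :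
    D.curve p.1 p.2 = D.curve q.1 q.2 := by
  obtain rfl | ⟨j, k, hj, rfl⟩ := h.eq_or
  · rfl
  · rw [hj]
    simpa using ((D.periodic j).int_mul k p.2).symm

theorem deriv_congr (D : Diagram n m) {p q : Param n m} (h : SamePoint p q) :
    deriv (D.curve p.1) p.2 = deriv (D.curve q.1) q.2 := by
  obtain rfl | ⟨j, k, hj, rfl⟩ := h.eq_or
  · rfl
  · rw [hj, ← deriv_comp_add_const]
    congr 1
    ext t
    simpa using ((D.periodic j).int_mul k t).symm

theorem isDouble_congr_right (D : Diagram n m) {p q q' : Param n m} (h : SamePoint q q')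
    (hp : IsDouble D.curve p q) : IsDouble D.curve p q' :=
  ⟨hp.1, hp.2.1.congr h, fun h' => hp.2.2.1 (h'.trans h.symm),
    hp.2.2.2.trans (D.curve_congr h)⟩

theorem isDouble_congr_left (D : Diagram n m) {p p' q : Param n m} (h : SamePoint p p')
    (hp : IsDouble D.curve p q) : IsDouble D.curve p' q :=
  (D.isDouble_congr_right h hp.symm).symm

/-- Periodicity of `under` is not part of the structure; it follows because `p` and `q` have a
common crossing partner, and `under_iff` lets exactly one of a crossing pair be under. -/
theorem under_congr (D : Diagram n m) {p q : Param n m} (h : SamePoint p q) :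
    p ∈ D.under ↔ q ∈ D.under := by
  have key {p q : Param n m} (h : SamePoint p q) (hp : p ∈ D.under) : q ∈ D.under := by
    obtain ⟨r, hr⟩ := D.under_double p hp
    exact (D.under_iff q r (D.isDouble_congr_left h hr)).2 ((D.under_iff p r hr).1 hp)
  exact ⟨key h, key h.symm⟩

theorem valid_of_mem_under (D : Diagram n m) {p : Param n m} (h : p ∈ D.under) : Valid p := by
  obtain ⟨q, hq⟩ := D.under_double p h
  exact hq.1

theorem IsDouble.mem_Ioo (D : Diagram n m) {i : Fin n} {t : ℝ} {q : Param n m}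
    (h : IsDouble D.curve (Sum.inl i, t) q) : t ∈ Ioo (0 : ℝ) 1 := by
  have h1 := D.endpoint_simple _ _ h rfl
  have h2 : t ∈ Icc (0 : ℝ) 1 := h.1
  exact ⟨lt_of_le_of_ne h2.1 (Ne.symm h1.1), lt_of_le_of_ne h2.2 h1.2⟩

theorem IsDouble.timeDomain_mem_nhds (D : Diagram n m) {p q : Param n m}
    (h : IsDouble D.curve p q) : timeDomain p.1 ∈ 𝓝 p.2 := by
  obtain ⟨i | j, t⟩ := p
  · exact Icc_mem_nhds (IsDouble.mem_Ioo D h).1 (IsDouble.mem_Ioo D h).2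
  · exact univ_mem

theorem finite_under (D : Diagram n m) (c : Comp n m) :
    {t : ℝ | t ∈ Icc 0 1 ∧ (c, t) ∈ D.under}.Finite := by
  refine Finite.of_finite_image (f := fun t => (c, t)) (D.finite_double.subset ?_)
    (fun a _ b _ h => congrArg Prod.snd h)
  rintro _ ⟨t, ht, rfl⟩
  exact ⟨ht.1, D.under_double _ ht.2⟩

/-- On a closed component the fractional part moves the window into `[0, 1]`, and it is injective on
a half-open window of length one. -/
theorem finite_under_Ico (D : Diagram n m) (c : Comp n m) (a : ℝ) :
    {t : ℝ | t ∈ Ico a (a + 1) ∧ (c, t) ∈ D.under}.Finite := by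
  rcases c with i | j
  · exact (D.finite_under (Sum.inl i)).subset fun t ht => ⟨D.valid_of_mem_under ht.2, ht.2⟩
  · refine Finite.of_finite_image (f := Int.fract)
      ((D.finite_under (Sum.inr j)).subset ?_) ?_
    · rintro _ ⟨t, ht, rfl⟩
      refine ⟨⟨Int.fract_nonneg t, (Int.fract_lt_one t).le⟩, ?_⟩
      refine (D.under_congr ?_).1 ht.2
      refine ⟨rfl, Or.inr ⟨rfl, -⌊t⌋, ?_⟩⟩
      rw [Int.cast_neg, ← sub_eq_add_neg, Int.self_sub_floor]
    · intro s hs t ht h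
      obtain ⟨z, hz⟩ := Int.fract_eq_fract.1 h
      have h1 : (z : ℝ) < 1 := by linarith [hs.1.2, ht.1.1]
      have h2 : (-1 : ℝ) < z := by linarith [hs.1.1, ht.1.2]
      have h3 : z < 1 := by exact_mod_cast h1
      have h4 : -1 < z := by exact_mod_cast h2
      have h5 : z = 0 := by omega
      rw [h5, Int.cast_zero] at hz
      linarith

theorem eventually_not_mem_under (D : Diagram n m) (c : Comp n m) (t : ℝ) :
    ∀ᶠ s in 𝓝[≠] t, (c, s) ∉ D.under := by
  -- The window of length one is centred at `t`, so it is a neighbourhood of `t`; a finite set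
  -- without `t` has an open complement around `t`.
  have h1 := ((D.finite_under_Ico c (t - 1 / 2)).subset sdiff_subset :
    ({s | s ∈ Ico (t - 1 / 2) (t - 1 / 2 + 1) ∧ (c, s) ∈ D.under} \ {t}).Finite)
  have h2 := h1.isClosed.compl_mem_nhds (fun h => (Set.mem_sdiff t).1 h |>.2 rfl)
  have h3 : Ico (t - 1 / 2) (t - 1 / 2 + 1) ∈ 𝓝 t := Ico_mem_nhds (by linarith) (by linarith)
  refine eventually_nhdsWithin_iff.2 ?_
  filter_upwards [h2, h3] with s hs hs' hne hu
  exact hs ⟨⟨hs', hu⟩, hne⟩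

theorem exists_left_free (D : Diagram n m) (c : Comp n m) (t : ℝ) {b : ℝ} (hb : b < t) :
    ∃ s ∈ Ioo b t, ∀ r ∈ Ico s t, (c, r) ∉ D.under := by
  have h := (D.eventually_not_mem_under c t).filter_mono
    (nhdsWithin_mono t fun x (hx : x < t) => hx.ne)
  obtain ⟨l, hl, h⟩ := (mem_nhdsLT_iff_exists_Ioo_subset' hb).1 h
  obtain ⟨s, hs⟩ := exists_between (max_lt hb (mem_Iio.1 hl))
  refine ⟨s, ⟨(le_max_left _ _).trans_lt hs.1, hs.2⟩, fun r hr => h ⟨?_, hr.2⟩⟩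
  exact ((le_max_right _ _).trans_lt hs.1).trans_le hr.1

theorem exists_right_free (D : Diagram n m) (c : Comp n m) (t : ℝ) {b : ℝ} (hb : t < b) :
    ∃ s ∈ Ioo t b, ∀ r ∈ Ioc t s, (c, r) ∉ D.under := by
  have h := (D.eventually_not_mem_under c t).filter_mono
    (nhdsWithin_mono t fun x (hx : t < x) => hx.ne')
  obtain ⟨l, hl, h⟩ := (mem_nhdsGT_iff_exists_Ioo_subset' hb).1 h
  obtain ⟨s, hs⟩ := exists_between (lt_min hb (mem_Ioi.1 hl))
  refine ⟨s, ⟨hs.1, hs.2.trans_le (min_le_left _ _)⟩, fun r hr => h ⟨hr.1, ?_⟩⟩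
  exact hr.2.trans_lt (hs.2.trans_le (min_le_right _ _))

/-- The orientation of the crossing of the strands at `o` and `p`. -/
noncomputable def crossDet (D : Diagram n m) (o p : Param n m) : ℝ :=
  planeDet (deriv (D.curve o.1) o.2) (deriv (D.curve p.1) p.2)

theorem crossDet_congr (D : Diagram n m) {o o' p p' : Param n m} (ho : SamePoint o o')
    (hp : SamePoint p p') : D.crossDet o p = D.crossDet o' p' := by
  rw [crossDet, crossDet, D.deriv_congr ho, D.deriv_congr hp]

theorem crossDet_swap (D : Diagram n m) (o p : Param n m) : D.crossDet p o = -D.crossDet o p :=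
  planeDet_swap _ _

variable {X : Type u} [Quandle X]

/-- The conditions on a coloring at one point: the color does not change at points that are not
undercrossings, and changes by the color of the over-passing strand at undercrossings, which
themselves carry the color of the arriving arc. -/
structure ColoredAt (D : Diagram n m) (f : Param n m → X) (p : Param n m) : Prop where
  left : ∀ᶠ s in 𝓝[<] p.2, f (p.1, s) = f p
  right : p ∉ D.under → ∀ᶠ s in 𝓝[>] p.2, f (p.1, s) = f p
  cross : ∀ o, p ∈ D.under → IsDouble D.curve p o →
    ∀ᶠ s in 𝓝[>] p.2, f (p.1, s) = signAct (D.crossDet o p) (f o) (f p)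

/-- A coloring of a diagram, as a function of the parameter. -/
structure IsColoring (D : Diagram n m) (f : Param n m → X) : Prop where
  periodic : ∀ p q, SamePoint p q → f p = f q
  coloredAt : ∀ p, D.ColoredAt f p

/-- All ingredients are invariant under translation by a period, so the local condition need only be
checked at one representative of each point of a circle. -/
theorem ColoredAt.congr {D : Diagram n m} {f : Param n m → X}
    (hf : ∀ p q, SamePoint p q → f p = f q) {p q : Param n m} (hpq : SamePoint p q)
    (h : D.ColoredAt f p) : D.ColoredAt f q := by
  obtain rfl | ⟨j, k, hj, rfl⟩ := hpq.eq_or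
  · exact h
  · obtain ⟨c, t⟩ := p
    obtain rfl : c = Sum.inr j := hj
    have hshift (s : ℝ) : f (Sum.inr j, s) = f (Sum.inr j, s - k) := by
      rw [hf _ _ (SamePoint.add_int j (s - k) k), sub_add_cancel]
    have hlt : Tendsto (fun s : ℝ => s - k) (𝓝[<] (t + k)) (𝓝[<] t) := by
      refine tendsto_nhdsWithin_iff.2 ⟨?_, ?_⟩
      · refine Tendsto.mono_left ?_ nhdsWithin_le_nhds
        have : Continuous fun s : ℝ => s - k := by fun_prop
        simpa using this.tendsto (t + k)
      · filter_upwards [self_mem_nhdsWithin] with s hs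
        have := mem_Iio.1 hs
        exact mem_Iio.2 (by linarith)
    have hgt : Tendsto (fun s : ℝ => s - k) (𝓝[>] (t + k)) (𝓝[>] t) := by
      refine tendsto_nhdsWithin_iff.2 ⟨?_, ?_⟩
      · refine Tendsto.mono_left ?_ nhdsWithin_le_nhds
        have : Continuous fun s : ℝ => s - k := by fun_prop
        simpa using this.tendsto (t + k)
      · filter_upwards [self_mem_nhdsWithin] with s hs
        have := mem_Ioi.1 hs
        exact mem_Ioi.2 (by linarith)
    refine ⟨?_, fun hu => ?_, fun o hu ho => ?_⟩
    · filter_upwards [hlt.eventually h.left] with s hs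
      exact (hshift s).trans (hs.trans (hf _ _ hpq))
    · filter_upwards [hgt.eventually (h.right fun hu' => hu ((D.under_congr hpq).1 hu'))] with s hs
      exact (hshift s).trans (hs.trans (hf _ _ hpq))
    · filter_upwards [hgt.eventually (h.cross o ((D.under_congr hpq).2 hu)
        (D.isDouble_congr_left hpq.symm ho))] with s hs
      exact (hshift s).trans (hs.trans (by rw [hf _ _ hpq, D.crossDet_congr (.refl o) hpq]))

end Diagram

/-- With the discrete topology on `Y`, one-sided local constancy is continuity on the interval,
which is connected. -/
theorem eq_of_locally_constant {Y : Type u} {f : ℝ → Y} {a b : ℝ}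
    (hl : ∀ t ∈ Ioc a b, ∀ᶠ s in 𝓝[<] t, f s = f t)
    (hr : ∀ t ∈ Ico a b, ∀ᶠ s in 𝓝[>] t, f s = f t) {s t : ℝ} (hs : s ∈ Icc a b)
    (ht : t ∈ Icc a b) : f s = f t := by
  let _ : TopologicalSpace Y := ⊥
  have : DiscreteTopology Y := ⟨rfl⟩
  refine isPreconnected_Icc.constant (f := f) (fun r hrm => ?_) hs ht
  rw [ContinuousWithinAt, nhds_discrete, tendsto_pure]
  have h1 : ∀ᶠ x in 𝓝 r, x < r → x ∈ Icc a b → f x = f r := by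
    rcases hrm.1.eq_or_lt with h | h
    · exact Eventually.of_forall fun x hx hx' => absurd (h ▸ hx'.1) hx.not_ge
    · filter_upwards [eventually_nhdsWithin_iff.1 (hl r ⟨h, hrm.2⟩)] with x hx hx' _ using hx hx'
  have h2 : ∀ᶠ x in 𝓝 r, r < x → x ∈ Icc a b → f x = f r := by
    rcases hrm.2.eq_or_lt with h | h
    · exact Eventually.of_forall fun x hx hx' => absurd (h ▸ hx'.2) hx.not_ge
    · filter_upwards [eventually_nhdsWithin_iff.1 (hr r ⟨hrm.1, h⟩)] with x hx hx' _ using hx hx'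
  refine eventually_nhdsWithin_iff.2 ?_
  filter_upwards [h1, h2] with x hx1 hx2 hx
  rcases lt_trichotomy x r with h | rfl | h
  · exact hx1 h hx
  · rfl
  · exact hx2 h hx

namespace Diagram

variable {X : Type u} [Quandle X] {D : Diagram n m} {f : Param n m → X}

/-- The later time may be an undercrossing, since an undercrossing carries the color of the arriving
arc. -/
theorem IsColoring.eq_of_free (hf : D.IsColoring f) {c : Comp n m} {s t : ℝ} (hst : s ≤ t)
    (h : ∀ r ∈ Ico s t, (c, r) ∉ D.under) : f (c, s) = f (c, t) :=
  eq_of_locally_constant (f := fun r => f (c, r)) (a := s) (b := t)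
    (fun r _ => (hf.coloredAt (c, r)).left) (fun r hr => (hf.coloredAt (c, r)).right (h r hr))
    (left_mem_Icc.2 hst) (right_mem_Icc.2 hst)

theorem IsColoring.eq_of_free_right (hf : D.IsColoring f) {c : Comp n m} {t s : ℝ} (hts : t < s)
    (h : ∀ r ∈ Ioc t s, (c, r) ∉ D.under) {a : X} (ha : ∀ᶠ r in 𝓝[>] t, f (c, r) = a) :
    f (c, s) = a := by
  obtain ⟨r, hr, hrs⟩ := (ha.and (Ioo_mem_nhdsGT hts)).exists
  rw [← hr]
  exact (hf.eq_of_free hrs.2.le fun x hx => h x ⟨hrs.1.trans_le hx.1, hx.2.le⟩).symm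

end Diagram

end Linkoid

/-! ### Pointed homomorphisms are colorings -/

theorem PointedQuandle.Hom.eq_of_toHom_eq.{v, w} {k : ℕ} {P : PointedQuandle.{v} k}
    {X : PointedQuandle.{w} k} {φ ψ : PointedQuandle.Hom P X} (h : φ.toHom = ψ.toHom) : φ = ψ := by
  cases φ
  cases ψ
  congr

namespace Linkoid

namespace Diagram

open Filter Topology

variable {n m : ℕ} (D : Diagram n m)

/-- No undercrossing of the component `c` at the times between `s` and `t`, the earlier one of these
included. -/
def Free (c : Comp n m) (s t : ℝ) : Prop := ∀ r ∈ Ico (min s t) (max s t), (c, r) ∉ D.under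

/-- A coloring needs a value at every parameter, also at those on no arc. An undercrossing is
assigned the arc that arrives there, and a time outside `[0, 1]` on an open component is assigned
the nearer end, there being no undercrossings beyond the ends. -/
theorem exists_arcPoint (p : Param n m) :
    ∃ s : ℝ, (Valid (p.1, s) ∧ (p.1, s) ∉ D.under) ∧ D.Free p.1 s p.2 := by
  obtain ⟨i | j, t⟩ := p
  · have key (r : ℝ) (h : r ≤ 0 ∨ 1 ≤ r) : ((Sum.inl i, r) : Param n m) ∉ D.under := by
      intro hu
      obtain ⟨q, hq⟩ := D.under_double _ hu
      have := IsDouble.mem_Ioo D hq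
      rcases h with h | h
      · exact h.not_gt this.1
      · exact h.not_gt this.2
    rcases le_or_gt t 0 with h0 | h0
    · refine ⟨0, D.leg_mem i, fun r hr => key r (Or.inl ?_)⟩
      rw [max_eq_left h0] at hr
      exact hr.2.le
    · rcases le_or_gt t 1 with h1 | h1
      · obtain ⟨s, hs, h⟩ := D.exists_left_free (Sum.inl i) t h0
        refine ⟨s, ⟨⟨hs.1.le, hs.2.le.trans h1⟩, h s ⟨le_rfl, hs.2⟩⟩, fun r hr => h r ?_⟩
        rwa [min_eq_left hs.2.le, max_eq_right hs.2.le] at hr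
      · refine ⟨1, D.head_mem i, fun r hr => key r (Or.inr ?_)⟩
        rw [min_eq_left h1.le] at hr
        exact hr.1
  · obtain ⟨s, hs, h⟩ := D.exists_left_free (Sum.inr j) t (sub_one_lt t)
    refine ⟨s, ⟨valid_inr j s, h s ⟨le_rfl, hs.2⟩⟩, fun r hr => h r ?_⟩
    rwa [min_eq_left hs.2.le, max_eq_right hs.2.le] at hr

/-- The arc through a point, or arriving there if the point is an undercrossing. -/
noncomputable def arcOf (p : Param n m) : D.Arc :=
  Quot.mk D.arcRel ⟨(p.1, (D.exists_arcPoint p).choose), (D.exists_arcPoint p).choose_spec.1⟩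

variable {D}

/-- Independence of the chosen representative: an interior time between `s` and the chosen time lies
between `t` and one of the two, where `Free` excludes undercrossings. -/
theorem arcOf_eq {c : Comp n m} {s t : ℝ} (hs : Valid (c, s) ∧ (c, s) ∉ D.under)
    (h : D.Free c s t) : D.arcOf (c, t) = Quot.mk D.arcRel ⟨(c, s), hs⟩ := by
  refine Quot.sound (Or.inr ⟨rfl, fun r hr => ?_⟩)
  have hv := (D.exists_arcPoint (c, t)).choose_spec.1.2
  have h' := (D.exists_arcPoint (c, t)).choose_spec.2
  set s' := (D.exists_arcPoint (c, t)).choose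
  change r ∈ uIcc s' s at hr
  change (c, r) ∉ D.under
  rcases eq_or_ne r s with rfl | hrs
  · exact hs.2
  rcases eq_or_ne r s' with hrs' | hrs'
  · rw [hrs']
    exact hv
  rcases mem_uIcc.1 hr with hr | hr
  · have h1 := lt_of_le_of_ne hr.1 hrs'.symm
    have h2 := lt_of_le_of_ne hr.2 hrs
    rcases le_or_gt t r with h3 | h3
    · exact h r ⟨min_le_of_right_le h3, lt_max_of_lt_left h2⟩
    · exact h' r ⟨min_le_of_left_le h1.le, lt_max_of_lt_right h3⟩
  · have h1 := lt_of_le_of_ne hr.1 hrs.symm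
    have h2 := lt_of_le_of_ne hr.2 hrs'
    rcases le_or_gt t r with h3 | h3
    · exact h' r ⟨min_le_of_right_le h3, lt_max_of_lt_left h2⟩
    · exact h r ⟨min_le_of_left_le h1.le, lt_max_of_lt_right h3⟩

theorem arcOf_arcPoint (p : Param n m) (hp : Valid p ∧ p ∉ D.under) :
    D.arcOf p = Quot.mk D.arcRel ⟨p, hp⟩ :=
  arcOf_eq (c := p.1) (t := p.2) hp fun r hr => by simp at hr

theorem arcOf_eq_of_free {c : Comp n m} {s t : ℝ} (hst : s ≤ t)
    (h : ∀ r ∈ Ico s t, (c, r) ∉ D.under) : D.arcOf (c, s) = D.arcOf (c, t) := by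
  obtain ⟨s', hs', hf⟩ := D.exists_arcPoint (c, t)
  rw [arcOf_eq hs' hf, arcOf_eq hs']
  intro r hr
  rcases le_or_gt s' s with h1 | h1
  · rw [min_eq_left h1, max_eq_right h1] at hr
    exact hf r ⟨min_le_of_left_le hr.1, lt_max_of_lt_right (hr.2.trans_le hst)⟩
  · rw [min_eq_right h1.le, max_eq_left h1.le] at hr
    rcases lt_or_ge r t with h2 | h2
    · exact h r ⟨hr.1, h2⟩
    · exact hf r ⟨min_le_of_right_le h2, lt_max_of_lt_left hr.2⟩

theorem arcOf_congr {p q : Param n m} (hpq : SamePoint p q) : D.arcOf p = D.arcOf q := by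
  obtain rfl | ⟨j, k, hj, rfl⟩ := hpq.eq_or
  · rfl
  obtain ⟨c, t⟩ := p
  obtain rfl : c = Sum.inr j := hj
  obtain ⟨s, hs, hf⟩ := D.exists_arcPoint (Sum.inr j, t)
  have hsk := SamePoint.add_int (n := n) j s k
  have hs' : Valid ((Sum.inr j, s + k) : Param n m) ∧ (Sum.inr j, s + (k : ℝ)) ∉ D.under :=
    ⟨valid_inr _ _, fun h => hs.2 ((D.under_congr hsk).2 h)⟩
  rw [arcOf_eq hs hf, arcOf_eq hs']
  · exact Quot.sound (Or.inl hsk)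
  · intro r hr hu
    change r ∈ Ico (min (s + k) (t + k)) (max (s + k) (t + k)) at hr
    rw [min_add_add_right, max_add_add_right] at hr
    refine hf (r - k) ⟨by linarith [hr.1], by linarith [hr.2]⟩ ((D.under_congr ?_).2 hu)
    simpa using SamePoint.add_int (n := n) j (r - k) k

-- The presentation speaks of a chosen point on the arriving arc; `arcOf` absorbs this choice, and
-- transversality excludes a vanishing determinant, on which `signAct` would take a default value.
variable (D) in
theorem fundamental_relation {c : Comp n m} {t s : ℝ} {o : Param n m}
    (hu : (c, t) ∈ D.under) (ho : IsDouble D.curve (c, t) o) (hts : t < s) (hv : Valid (c, s))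
    (hs : ∀ r ∈ Ioc t s, (c, r) ∉ D.under) :
    PresentedQuandle.mk D.crossingRel (.gen (D.arcOf (c, s))) =
      signAct (D.crossDet o (c, t)) (PresentedQuandle.mk D.crossingRel (.gen (D.arcOf o)))
        (PresentedQuandle.mk D.crossingRel (.gen (D.arcOf (c, t)))) := by
  obtain ⟨r, hr, hf⟩ := D.exists_arcPoint (c, t)
  -- `Free` includes the earlier of the two times, so a representative later than `t` would make `t`
  -- itself free.
  have hrt : r < t := by
    by_contra! h
    rcases h.eq_or_lt with rfl | h
    · exact hr.2 hu
    · exact hf t ⟨min_le_right _ _, lt_max_of_lt_left h⟩ hu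
  have hs' : Valid (c, s) ∧ (c, s) ∉ D.under := ⟨hv, hs s ⟨hts, le_rfl⟩⟩
  have ho' : Valid o ∧ o ∉ D.under := ⟨ho.2.1, (D.under_iff _ _ ho).1 hu⟩
  have hfree : ∀ x ∈ Ico r t, (c, x) ∉ D.under := fun x hx =>
    hf x ⟨min_le_of_left_le hx.1, lt_max_of_lt_right hx.2⟩
  rw [arcOf_eq hr hf, arcOf_arcPoint _ hs', arcOf_arcPoint _ ho']
  rcases (D.transverse _ _ ho.symm).lt_or_gt with hd | hd
  · rw [crossDet, signAct_of_neg hd]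
    exact PresentedQuandle.mk_eq_mk (w := .invAct (D.arcGen o ho') (D.arcGen (c, r) hr))
      ⟨c, r, t, s, o, hr, hs', ho', hrt, hts, hu, ho, hfree, hs, rfl, Or.inr ⟨hd, rfl⟩⟩
  · rw [crossDet, signAct_of_pos hd]
    exact PresentedQuandle.mk_eq_mk (w := .act (D.arcGen o ho') (D.arcGen (c, r) hr))
      ⟨c, r, t, s, o, hr, hs', ho', hrt, hts, hu, ho, hfree, hs, rfl, Or.inl ⟨hd, rfl⟩⟩

theorem map_signAct {Q : Type*} {X : Type*} [Rack Q] [Rack X] (φ : Q →◃ X) (d : ℝ) (b a : Q) :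
    φ (signAct d b a) = signAct d (φ b) (φ a) := by
  unfold signAct
  split_ifs
  · exact φ.map_act
  · exact φ.map_invAct' b a

variable {X : Type u} [Quandle X]

theorem isColoring_of_hom (φ : D.FundamentalQuandle →◃ X) :
    D.IsColoring fun p => φ (PresentedQuandle.mk D.crossingRel (.gen (D.arcOf p))) where
  periodic p q h := by rw [arcOf_congr h]
  coloredAt := by
    rintro ⟨c, t⟩
    refine ⟨?_, fun hu => ?_, fun o hu ho => ?_⟩
    · obtain ⟨s, hs, h⟩ := D.exists_left_free c t (sub_one_lt t)
      filter_upwards [Ioo_mem_nhdsLT hs.2] with r hr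
      rw [arcOf_eq_of_free hr.2.le fun x hx => h x ⟨hr.1.le.trans hx.1, hx.2⟩]
    · obtain ⟨s, hs, h⟩ := D.exists_right_free c t (lt_add_one t)
      filter_upwards [Ioo_mem_nhdsGT hs.1] with r hr
      rw [arcOf_eq_of_free (c := c) (s := t) hr.1.le fun x hx => ?_]
      rcases hx.1.eq_or_lt with rfl | h1
      · exact hu
      · exact h x ⟨h1, hx.2.le.trans hr.2.le⟩
    · obtain ⟨s, hs, h⟩ := D.exists_right_free c t (lt_add_one t)
      -- The relation requires a valid leaving point; a crossing is never at an end of an open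
      -- component, so all nearby times are valid.
      filter_upwards [Ioo_mem_nhdsGT hs.1,
        mem_nhdsWithin_of_mem_nhds (IsDouble.timeDomain_mem_nhds D ho)] with r hr hv
      rw [D.fundamental_relation hu ho hr.1 hv fun x hx => h x ⟨hx.1, hx.2.trans hr.2.le⟩,
        map_signAct]

theorem IsColoring.arcRel {f : Param n m → X} (hf : D.IsColoring f) (p q : D.ArcPoint)
    (h : D.arcRel p q) : f p.1 = f q.1 := by
  rcases h with h | ⟨h, h'⟩
  · exact hf.periodic _ _ h
  · obtain ⟨⟨c, s⟩, hp⟩ := p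
    obtain ⟨⟨c', t⟩, hq⟩ := q
    obtain rfl : c = c' := h
    rcases le_total s t with hst | hst
    · exact hf.eq_of_free hst fun r hr => h' r (mem_uIcc.2 (Or.inl ⟨hr.1, hr.2.le⟩))
    · exact (hf.eq_of_free hst fun r hr => h' r (mem_uIcc.2 (Or.inr ⟨hr.1, hr.2.le⟩))).symm

theorem IsColoring.crossingRel {f : Param n m → X} (hf : D.IsColoring f)
    (v w : QuandleWord D.Arc) (h : D.crossingRel v w) :
    v.eval (Quot.lift (fun p => f p.1) hf.arcRel) =
      w.eval (Quot.lift (fun p => f p.1) hf.arcRel) := by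
  obtain ⟨c, s, t, s', o, hs, hs', ho, hst, hts, hu, hd, hl, hr, rfl, hw⟩ := h
  have key := hf.eq_of_free_right hts hr ((hf.coloredAt (c, t)).cross o hu hd)
  rw [← hf.eq_of_free hst.le hl] at key
  rcases hw with ⟨hpos, rfl⟩ | ⟨hneg, rfl⟩
  · rw [crossDet, signAct_of_pos hpos] at key
    exact key
  · rw [crossDet, signAct_of_neg hneg] at key
    exact key

/-- Quandle homomorphisms on the fundamental quandle are colorings. -/
noncomputable def homEquiv (D : Diagram n m) (X : Type u) [Quandle X] :
    (D.FundamentalQuandle →◃ X) ≃ {f : Param n m → X // D.IsColoring f} where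
  toFun φ := ⟨_, isColoring_of_hom φ⟩
  invFun f := PresentedQuandle.lift (Quot.lift (fun p => f.1 p.1) f.2.arcRel) f.2.crossingRel
  left_inv φ := by
    refine PresentedQuandle.hom_ext ?_
    rintro ⟨p⟩
    change φ (PresentedQuandle.mk D.crossingRel (.gen (D.arcOf p.1))) = _
    rw [arcOf_arcPoint p.1 p.2]
    rfl
  right_inv f := by
    obtain ⟨f, hf⟩ := f
    ext p
    -- The round trip evaluates `f` at the chosen arc point instead of at `p`; the stretch between
    -- them is free.
    change f (p.1, (D.exists_arcPoint p).choose) = f p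
    have h := (D.exists_arcPoint p).choose_spec.2
    set s := (D.exists_arcPoint p).choose
    rcases le_total s p.2 with hs | hs
    · refine hf.eq_of_free hs fun r hr => h r ?_
      rwa [min_eq_left hs, max_eq_right hs]
    · refine (hf.eq_of_free hs fun r hr => h r ?_).symm
      rwa [min_eq_right hs, max_eq_left hs]

/-- The parameter of the `k`-th end of the open components. -/
def endParam (m : ℕ) (k : Fin (2 * n)) : Param n m :=
  (Sum.inl ⟨k.val / 2, by omega⟩, if k.val % 2 = 0 then 0 else 1)

theorem fundamental_base (k : Fin (2 * n)) : D.fundamentalPointedQuandle.base k =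
    PresentedQuandle.mk D.crossingRel (.gen (D.arcOf (endParam m k))) := by
  unfold fundamentalPointedQuandle endParam
  dsimp only
  split_ifs
  · rw [arcOf_arcPoint _ (D.leg_mem _)]
    rfl
  · rw [arcOf_arcPoint _ (D.head_mem _)]
    rfl

/-- Colorings with the given colors at the ends of the open components. -/
def IsPointedColoring (D : Diagram n m) (X : PointedQuandle.{u} (2 * n))
    (f : Param n m → X.carrier) : Prop :=
  D.IsColoring f ∧ ∀ k, f (endParam m k) = X.base k

theorem nonempty_pointedColoring_equiv (D : Diagram n m) (X : PointedQuandle.{u} (2 * n)) :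
    Nonempty (D.PointedColoring X ≃ {f : Param n m → X.carrier // D.IsPointedColoring X f}) := by
  refine ⟨⟨fun φ => ⟨(D.homEquiv X.carrier φ.toHom).1, (D.homEquiv X.carrier φ.toHom).2,
    fun k => ?_⟩, fun f => ⟨(D.homEquiv X.carrier).symm ⟨f.1, f.2.1⟩, fun k => ?_⟩, ?_, ?_⟩⟩
  · rw [← φ.map_base, fundamental_base]
    rfl
  · rw [← f.2.2, fundamental_base]
    exact congrFun (congrArg Subtype.val ((D.homEquiv X.carrier).apply_symm_apply ⟨f.1, f.2.1⟩)) _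
  · rintro ⟨φ, hφ⟩
    exact PointedQuandle.Hom.eq_of_toHom_eq ((D.homEquiv X.carrier).symm_apply_apply φ)
  · rintro ⟨f, hf⟩
    simp

/-! ### Finiteness -/

theorem IsColoring.exists_right_value {f : Param n m → X} (hf : D.IsColoring f) (p : Param n m) :
    ∃ a : X, (∀ᶠ s in 𝓝[>] p.2, f (p.1, s) = a) ∧ (p ∉ D.under → a = f p) := by
  by_cases hu : p ∈ D.under
  · obtain ⟨o, ho⟩ := D.under_double p hu
    exact ⟨_, (hf.coloredAt p).cross o hu ho, fun h => absurd hu h⟩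
  · exact ⟨_, (hf.coloredAt p).right hu, fun _ => rfl⟩

/-- The color just after a point. -/
noncomputable def IsColoring.rightValue {f : Param n m → X} (hf : D.IsColoring f)
    (p : Param n m) : X :=
  (hf.exists_right_value p).choose

variable (D) in
/-- The undercrossings in the fundamental time interval and the points at time `0`. -/
def cutPoints : Set (Param n m) := {p | p.2 = 0 ∨ (p.2 ∈ Icc 0 1 ∧ p ∈ D.under)}

theorem finite_cutPoints : D.cutPoints.Finite := by
  have h : D.cutPoints ⊆ (range fun c : Comp n m => ((c, 0) : Param n m)) ∪
      {p | p.2 ∈ Icc 0 1 ∧ ∃ q, IsDouble D.curve p q} := by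
    rintro ⟨c, t⟩ (rfl | ⟨ht, hu⟩)
    · exact Or.inl ⟨c, rfl⟩
    · exact Or.inr ⟨ht, D.under_double _ hu⟩
  exact ((finite_range _).union D.finite_double).subset h

/-- There are finitely many cut points and time `0` is one of them, so a last one before `t` exists.
-/
theorem exists_last_cutPoint (c : Comp n m) {t : ℝ} (ht : t ∈ Ioc (0 : ℝ) 1) :
    ∃ s < t, (c, s) ∈ D.cutPoints ∧ ∀ r ∈ Ioo s t, (c, r) ∉ D.under := by
  have hfin : {s : ℝ | s < t ∧ (c, s) ∈ D.cutPoints}.Finite := by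
    refine Finite.of_finite_image (f := fun s => (c, s)) ((finite_cutPoints (D := D)).subset ?_)
      fun a _ b _ h => congrArg Prod.snd h
    rintro _ ⟨s, hs, rfl⟩
    exact hs.2
  obtain ⟨s, hs, hmax⟩ := hfin.exists_maximalFor id _ ⟨0, ht.1, Or.inl rfl⟩
  refine ⟨s, hs.1, hs.2, fun r hr hu => ?_⟩
  -- This places a later undercrossing in `[0, 1]`, hence among the cut points, against maximality.
  have h0 : 0 ≤ s := by
    by_contra! h
    exact h.not_ge (hmax ⟨ht.1, Or.inl rfl⟩ h.le)
  exact hr.1.not_ge (hmax ⟨hr.2, Or.inr ⟨⟨h0.trans hr.1.le, hr.2.le.trans ht.2⟩, hu⟩⟩ hr.1.le)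

theorem IsColoring.eq_rightValue {f : Param n m → X} (hf : D.IsColoring f) {c : Comp n m}
    {s t : ℝ} (hst : s < t) (h : ∀ r ∈ Ioo s t, (c, r) ∉ D.under) :
    f (c, t) = hf.rightValue (c, s) := by
  obtain ⟨r, hr, hrt⟩ :=
    ((hf.exists_right_value (c, s)).choose_spec.1.and (Ioo_mem_nhdsGT hst)).exists
  exact ((hf.eq_of_free hrt.2.le fun x hx => h x ⟨hrt.1.trans_le hx.1, hx.2⟩).symm).trans hr

/-- Every time in `(0, 1]` has the color just after the last cut point before it. Periods reduce
closed components to these times, and on open components the color is constant beyond the ends. -/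
theorem IsColoring.eq_of_rightValue {f f' : Param n m → X} (hf : D.IsColoring f)
    (hf' : D.IsColoring f') (h : ∀ p ∈ D.cutPoints, hf.rightValue p = hf'.rightValue p) :
    f = f' := by
  have h1 (c : Comp n m) (t : ℝ) (ht : t ∈ Ioc (0 : ℝ) 1) : f (c, t) = f' (c, t) := by
    obtain ⟨s, hst, hs, hfree⟩ := exists_last_cutPoint c ht
    rw [hf.eq_rightValue hst hfree, hf'.eq_rightValue hst hfree, h _ hs]
  ext ⟨i | j, t⟩
  · have key (r : ℝ) (h : r ≤ 0 ∨ 1 ≤ r) : ((Sum.inl i, r) : Param n m) ∉ D.under := by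
      intro hu
      obtain ⟨q, hq⟩ := D.under_double _ hu
      have := IsDouble.mem_Ioo D hq
      rcases h with h | h
      · exact h.not_gt this.1
      · exact h.not_gt this.2
    rcases le_or_gt t 0 with h0 | h0
    · have hleg := key 0 (Or.inl le_rfl)
      have h2 (g : Param n m → X) (hg : D.IsColoring g) :
          g (Sum.inl i, t) = hg.rightValue (Sum.inl i, 0) := by
        rw [hg.eq_of_free h0 fun r hr => key r (Or.inl hr.2.le)]
        exact ((hg.exists_right_value (Sum.inl i, 0)).choose_spec.2 hleg).symm
      rw [h2 f hf, h2 f' hf', h _ (Or.inl rfl)]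
    · rcases le_or_gt t 1 with h2 | h2
      · exact h1 _ t ⟨h0, h2⟩
      · rw [← hf.eq_of_free h2.le fun r hr => key r (Or.inr hr.1),
          ← hf'.eq_of_free h2.le fun r hr => key r (Or.inr hr.1)]
        exact h1 _ 1 ⟨one_pos, le_rfl⟩
  · have hp := SamePoint.add_int (n := n) j t (1 - ⌈t⌉)
    rw [hf.periodic _ _ hp, hf'.periodic _ _ hp]
    refine h1 _ _ ⟨?_, ?_⟩
    · push_cast
      linarith [Int.ceil_lt_add_one t]
    · push_cast
      linarith [Int.le_ceil t]

theorem finite_colorings (D : Diagram n m) (X : Type u) [Quandle X] [Finite X] :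
    Finite {f : Param n m → X // D.IsColoring f} := by
  have : Finite D.cutPoints := finite_cutPoints
  refine Finite.of_injective
    (fun f (p : D.cutPoints) => f.2.rightValue p.1) fun f f' h => Subtype.ext ?_
  exact f.2.eq_of_rightValue f'.2 fun p hp => congrFun h ⟨p, hp⟩

theorem finite_pointedColoring (D : Diagram n m) (X : PointedQuandle.{u} (2 * n))
    [Finite X.carrier] : Finite (D.PointedColoring X) := by
  have := D.finite_colorings X.carrier
  have e := (D.nonempty_pointedColoring_equiv X).some
  refine Finite.of_injective
    (fun φ => (⟨(e φ).1, (e φ).2.1⟩ : {f : Param n m → X.carrier // D.IsColoring f}))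
    fun φ φ' h => e.injective (Subtype.ext ?_)
  simpa only [Subtype.mk.injEq] using h

end Diagram

end Linkoid

/-! ### Planar isotopies, spherical moves and changes of parametrisation -/

namespace Linkoid

namespace Diagram

open Filter Topology

variable {n m : ℕ}

/-- Every set of pointed colorings of `D` is in bijection with the one of `D'`. -/
def SameColorings (D D' : Diagram n m) : Prop :=
  ∀ X : PointedQuandle.{u} (2 * n), Nonempty
    ({f : Param n m → X.carrier // D.IsPointedColoring X f} ≃
      {f : Param n m → X.carrier // D'.IsPointedColoring X f})

/-- An increasing relabelling of the parameters of `D'` by those of `D` that preserves all crossings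
and their signs. -/
structure Relabeling (D D' : Diagram n m) where
  comp : Comp n m ≃ Comp n m
  time : Comp n m → ℝ ≃o ℝ
  samePoint_iff : ∀ p q : Param n m,
    SamePoint (comp p.1, time p.1 p.2) (comp q.1, time q.1 q.2) ↔ SamePoint p q
  isDouble_iff : ∀ p q : Param n m,
    IsDouble D'.curve p q ↔ IsDouble D.curve (comp p.1, time p.1 p.2) (comp q.1, time q.1 q.2)
  under_iff : ∀ p : Param n m, p ∈ D'.under ↔ (comp p.1, time p.1 p.2) ∈ D.under
  crossDet_iff : ∀ p q : Param n m, IsDouble D'.curve p q →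
    (0 < D'.crossDet p q ↔ 0 < D.crossDet (comp p.1, time p.1 p.2) (comp q.1, time q.1 q.2))
  comp_end : ∀ i : Fin n, comp (Sum.inl i) = Sum.inl i
  time_zero : ∀ i : Fin n, time (Sum.inl i) 0 = 0
  time_one : ∀ i : Fin n, time (Sum.inl i) 1 = 1

namespace Relabeling

variable {D D' : Diagram n m}

/-- The map of parameters. -/
def toFun (R : Relabeling D D') (p : Param n m) : Param n m := (R.comp p.1, R.time p.1 p.2)

/-- The inverse relabelling. -/
def symm (R : Relabeling D D') : Relabeling D' D where
  comp := R.comp.symm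
  time c := (R.time (R.comp.symm c)).symm
  samePoint_iff p q := by
    rw [← R.samePoint_iff]
    simp
  isDouble_iff p q := by
    rw [R.isDouble_iff]
    simp
  under_iff p := by
    rw [R.under_iff]
    simp
  crossDet_iff p q h := by
    rw [R.crossDet_iff]
    · simp
    · rw [R.isDouble_iff]
      simpa using h
  comp_end i := by rw [Equiv.symm_apply_eq, R.comp_end]
  time_zero i := by
    rw [OrderIso.symm_apply_eq, (Equiv.symm_apply_eq _).2 (R.comp_end i).symm, R.time_zero]
  time_one i := by
    rw [OrderIso.symm_apply_eq, (Equiv.symm_apply_eq _).2 (R.comp_end i).symm, R.time_one]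

theorem symm_toFun_toFun (R : Relabeling D D') (p : Param n m) : R.symm.toFun (R.toFun p) = p := by
  simp [symm, toFun]

theorem toFun_symm_toFun (R : Relabeling D D') (p : Param n m) : R.toFun (R.symm.toFun p) = p := by
  simp [symm, toFun]

theorem toFun_endParam (R : Relabeling D D') (k : Fin (2 * n)) :
    R.toFun (endParam m k) = endParam m k := by
  unfold toFun endParam
  split_ifs
  · rw [R.time_zero, R.comp_end]
  · rw [R.time_one, R.comp_end]

theorem tendsto_nhdsLT (e : ℝ ≃o ℝ) (t : ℝ) : Tendsto e (𝓝[<] t) (𝓝[<] (e t)) :=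
  tendsto_nhdsWithin_iff.2 ⟨(e.continuous.tendsto t).mono_left nhdsWithin_le_nhds, by
    filter_upwards [self_mem_nhdsWithin] with s hs using e.lt_iff_lt.2 hs⟩

theorem tendsto_nhdsGT (e : ℝ ≃o ℝ) (t : ℝ) : Tendsto e (𝓝[>] t) (𝓝[>] (e t)) :=
  tendsto_nhdsWithin_iff.2 ⟨(e.continuous.tendsto t).mono_left nhdsWithin_le_nhds, by
    filter_upwards [self_mem_nhdsWithin] with s hs using e.lt_iff_lt.2 hs⟩

theorem isPointedColoring_comp (R : Relabeling D D') {X : PointedQuandle.{u} (2 * n)}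
    {f : Param n m → X.carrier} (hf : D.IsPointedColoring X f) :
    D'.IsPointedColoring X (f ∘ R.toFun) := by
  refine ⟨⟨fun p q h => hf.1.periodic _ _ ((R.samePoint_iff p q).2 h), fun p => ?_⟩, fun k => ?_⟩
  · have h := hf.1.coloredAt (R.toFun p)
    refine ⟨(tendsto_nhdsLT (R.time p.1) p.2).eventually h.left, fun hu => ?_, fun o hu ho => ?_⟩
    · exact (tendsto_nhdsGT (R.time p.1) p.2).eventually
        (h.right fun h' => hu ((R.under_iff p).2 h'))
    · have h' := h.cross (R.toFun o) ((R.under_iff p).1 hu) ((R.isDouble_iff p o).1 ho)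
      filter_upwards [(tendsto_nhdsGT (R.time p.1) p.2).eventually h'] with s hs
      rw [signAct_congr (R.crossDet_iff o p ho.symm)]
      exact hs
  · rw [Function.comp_apply, R.toFun_endParam, hf.2]

theorem sameColorings (R : Relabeling D D') : SameColorings.{u} D D' := fun _ =>
  ⟨⟨fun f => ⟨f.1 ∘ R.toFun, R.isPointedColoring_comp f.2⟩,
    fun f => ⟨f.1 ∘ R.symm.toFun, R.symm.isPointedColoring_comp f.2⟩,
    fun f => Subtype.ext (funext fun p => congrArg f.1 (R.toFun_symm_toFun p)),
    fun f => Subtype.ext (funext fun p => congrArg f.1 (R.symm_toFun_toFun p))⟩⟩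

end Relabeling

/-- Hence a diffeomorphism with positive Jacobian determinant preserves the signs of crossings. -/
theorem planeDet_map (A : ℂ →L[ℝ] ℂ) (v w : ℂ) :
    planeDet (A v) (A w) = A.det * planeDet v w := by
  have h (z : ℂ) : A z = z.re • A 1 + z.im • A Complex.I := by
    rw [← map_smul, ← map_smul, ← map_add]
    congr 1
    apply Complex.ext <;> simp
  have hdet : A.det = planeDet (A 1) (A Complex.I) := by
    rw [ContinuousLinearMap.det, ← LinearMap.det_toMatrix Complex.basisOneI, Matrix.det_fin_two]
    simp [LinearMap.toMatrix_apply, planeDet]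
    ring
  rw [hdet, h v, h w]
  simp [planeDet]
  ring

/-- A map that is injective on the image of the diagram and preserves orientation there changes
neither the crossings nor their signs, so the identity is a relabelling. Nothing is required of `Ψ`
away from the diagram, which admits the inversion of a spherical move. -/
theorem sameColorings_of_image {D D' : Diagram n m} (Ψ : ℂ → ℂ)
    (hΨ : ∀ p : Param n m, Valid p → ∃ A : ℂ →L[ℝ] ℂ, HasFDerivAt Ψ A (D.curve p.1 p.2) ∧
      ∀ v w, 0 < planeDet (A v) (A w) ↔ 0 < planeDet v w)
    (hinj : ∀ p q : Param n m, Valid p → Valid q →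
      Ψ (D.curve p.1 p.2) = Ψ (D.curve q.1 q.2) → D.curve p.1 p.2 = D.curve q.1 q.2)
    (hcurve : ∀ p : Param n m, Valid p → D'.curve p.1 p.2 = Ψ (D.curve p.1 p.2))
    (hunder : D'.under = D.under) : SameColorings.{u} D D' := by
  have hdouble (p q : Param n m) : IsDouble D'.curve p q ↔ IsDouble D.curve p q := by
    unfold IsDouble
    refine and_congr_right fun hp => and_congr_right fun hq => and_congr_right fun _ => ?_
    rw [hcurve p hp, hcurve q hq]
    exact ⟨hinj p q hp hq, congrArg Ψ⟩
  have hderiv (p : Param n m) (q : Param n m) (hpq : IsDouble D'.curve p q) (A : ℂ →L[ℝ] ℂ)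
      (hA : HasFDerivAt Ψ A (D.curve p.1 p.2)) :
      deriv (D'.curve p.1) p.2 = A (deriv (D.curve p.1) p.2) := by
    have h1 : D'.curve p.1 =ᶠ[𝓝 p.2] Ψ ∘ D.curve p.1 := by
      filter_upwards [IsDouble.timeDomain_mem_nhds D' hpq] with s hs using hcurve (p.1, s) hs
    rw [h1.deriv_eq]
    exact (hA.comp_hasDerivAt p.2
      (((D.smooth p.1).differentiable (by simp)) p.2).hasDerivAt).deriv
  refine Relabeling.sameColorings ⟨Equiv.refl _, fun _ => OrderIso.refl _, fun _ _ => Iff.rfl,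
    hdouble, fun p => by rw [hunder]; rfl, fun p q hpq => ?_, fun _ => rfl, fun _ => rfl,
    fun _ => rfl⟩
  obtain ⟨A, hA, hdet⟩ := hΨ p hpq.1
  -- Both strands pass through the same point, so one linear map transforms both tangent vectors.
  have hA' : HasFDerivAt Ψ A (D.curve q.1 q.2) := by
    rw [← ((hdouble p q).1 hpq).2.2.2]
    exact hA
  rw [crossDet, hderiv p q hpq A hA, hderiv q p hpq.symm A hA', hdet]
  rfl

theorem PlanarIsotopy.sameColorings {D D' : Diagram n m} (h : PlanarIsotopy D D') :
    SameColorings.{u} D D' := by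
  obtain ⟨Φ, hdet, hcurve, hunder⟩ := h
  refine sameColorings_of_image Φ (fun p _ => ⟨fderiv ℝ Φ (D.curve p.1 p.2), ?_, fun v w => ?_⟩)
    (fun p q _ _ h => Φ.injective h) hcurve hunder
  · exact (Φ.contMDiff.contDiff.differentiable (by simp) _).hasFDerivAt
  · rw [planeDet_map, mul_pos_iff_of_pos_left (hdet _)]

/-- The inversion is holomorphic away from `a`: its derivative is multiplication by some `b ≠ 0`,
which scales determinants by `|b|² > 0`. -/
theorem SphericalMove.sameColorings {D D' : Diagram n m} (h : SphericalMove D D') :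
    SameColorings.{u} D D' := by
  obtain ⟨a, ha, hcurve, hunder⟩ := h
  refine sameColorings_of_image (fun z => (z - a)⁻¹) (fun p hp => ?_)
    (fun p q _ _ h => by simpa using h) hcurve hunder
  have hne : D.curve p.1 p.2 - a ≠ 0 := sub_ne_zero.2 (ha p hp)
  have hd := ((hasDerivAt_id (D.curve p.1 p.2)).sub_const a).inv hne
  refine ⟨_, hd.hasFDerivAt.restrictScalars ℝ, fun v w => ?_⟩
  set b := -1 / (id (D.curve p.1 p.2) - a) ^ 2
  have hb : b ≠ 0 := div_ne_zero (neg_ne_zero.2 one_ne_zero) (pow_ne_zero 2 hne)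
  have key : planeDet (v * b) (w * b) = Complex.normSq b * planeDet v w := by
    simp only [planeDet, Complex.mul_re, Complex.mul_im, Complex.normSq_apply]
    ring
  have : planeDet (v * b) (w * b) > 0 ↔ 0 < planeDet v w := by
    rw [key, gt_iff_lt, mul_pos_iff_of_pos_left (Complex.normSq_pos.2 hb)]
  simpa using this

/-- Outside `[0, 1]` nothing is known about `ρ`; it is replaced there by the identity, which fits
because `ρ` maps `[0, 1]` onto itself. -/
theorem exists_orderIso_of_unit {ρ : ℝ → ℝ} (hρ : ContDiff ℝ ∞ ρ)
    (hpos : ∀ t ∈ Icc (0 : ℝ) 1, 0 < deriv ρ t) (h0 : ρ 0 = 0) (h1 : ρ 1 = 1) :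
    ∃ e : ℝ ≃o ℝ, ∀ t, (t ∈ Icc (0 : ℝ) 1 → e t = ρ t) ∧ (e t ∈ Icc (0 : ℝ) 1 ↔ t ∈ Icc 0 1) := by
  have hmono : StrictMonoOn ρ (Icc 0 1) :=
    strictMonoOn_of_deriv_pos (convex_Icc 0 1) hρ.continuous.continuousOn fun t ht =>
      hpos t (interior_subset ht)
  have hmem (t : ℝ) (ht : t ∈ Icc (0 : ℝ) 1) : ρ t ∈ Icc (0 : ℝ) 1 := by
    constructor
    · rw [← h0]
      exact hmono.monotoneOn (left_mem_Icc.2 zero_le_one) ht ht.1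
    · rw [← h1]
      exact hmono.monotoneOn ht (right_mem_Icc.2 zero_le_one) ht.2
  classical
  set r : ℝ → ℝ := fun t => if t ∈ Icc (0 : ℝ) 1 then ρ t else t with hr
  have hr1 (t : ℝ) (ht : t ∈ Icc (0 : ℝ) 1) : r t = ρ t := if_pos ht
  have hr2 (t : ℝ) (ht : t ∉ Icc (0 : ℝ) 1) : r t = t := if_neg ht
  have hstrict : StrictMono r := by
    intro s t hst
    by_cases hs : s ∈ Icc (0 : ℝ) 1 <;> by_cases ht : t ∈ Icc (0 : ℝ) 1
    · rw [hr1 s hs, hr1 t ht]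
      exact hmono hs ht hst
    · rw [hr1 s hs, hr2 t ht]
      have : 1 < t := by
        by_contra! h
        exact ht ⟨hs.1.trans hst.le, h⟩
      exact (hmem s hs).2.trans_lt this
    · rw [hr2 s hs, hr1 t ht]
      have : s < 0 := by
        by_contra! h
        exact hs ⟨h, hst.le.trans ht.2⟩
      exact this.trans_le (hmem t ht).1
    · rwa [hr2 s hs, hr2 t ht]
  have hsurj : Function.Surjective r := by
    intro y
    by_cases hy : y ∈ Icc (0 : ℝ) 1
    · have := intermediate_value_Icc (zero_le_one (α := ℝ)) (f := ρ) hρ.continuous.continuousOn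
      rw [h0, h1] at this
      obtain ⟨t, ht, rfl⟩ := this hy
      exact ⟨t, hr1 t ht⟩
    · exact ⟨y, hr2 y hy⟩
  refine ⟨hstrict.orderIsoOfSurjective r hsurj, fun t => ⟨hr1 t, ?_⟩⟩
  change r t ∈ _ ↔ _
  by_cases ht : t ∈ Icc (0 : ℝ) 1
  · rw [hr1 t ht]
    exact iff_of_true (hmem t ht) ht
  · rw [hr2 t ht]

/-- Since `ρ t - t` is periodic, `ρ` commutes with integer translations and is therefore unbounded
in both directions; continuity gives surjectivity. -/
theorem exists_orderIso_of_periodic {ρ : ℝ → ℝ} (hρ : ContDiff ℝ ∞ ρ)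
    (hpos : ∀ t, 0 < deriv ρ t) (hper : ∀ t, ρ (t + 1) = ρ t + 1) :
    ∃ e : ℝ ≃o ℝ, (∀ t, e t = ρ t) ∧ ∀ (t : ℝ) (k : ℤ), e (t + k) = e t + k := by
  have hint (t : ℝ) (k : ℤ) : ρ (t + k) = ρ t + k := by
    have h : Function.Periodic (fun t => ρ t - t) 1 := fun t => by
      simp only [hper]
      ring
    have := h.int_mul k t
    simp only [mul_one] at this
    linarith
  have hsurj : Function.Surjective ρ := by
    intro y
    refine mem_range_of_exists_le_of_exists_ge hρ.continuous ⟨0 + ⌊y - ρ 0⌋, ?_⟩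
      ⟨0 + ⌈y - ρ 0⌉, ?_⟩
    · rw [hint]
      linarith [Int.floor_le (y - ρ 0)]
    · rw [hint]
      linarith [Int.le_ceil (y - ρ 0)]
  exact ⟨(strictMono_of_deriv_pos hpos).orderIsoOfSurjective ρ hsurj, fun _ => rfl, hint⟩

theorem Reparametrization.sameColorings {D D' : Diagram n m} (h : Reparametrization D D') :
    SameColorings.{u} D D' := by
  obtain ⟨σ, ρ, hsmooth, hpos, hends, hper, hcurve⟩ := h
  choose e he using fun i : Fin n => exists_orderIso_of_unit (hsmooth (Sum.inl i))
    (fun t ht => hpos (Sum.inl i, t) ht) (hends i).1 (hends i).2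
  choose e' he' he'' using fun j : Fin m => exists_orderIso_of_periodic (hsmooth (Sum.inr j))
    (fun t => hpos (Sum.inr j, t) (valid_inr j t)) (hper j)
  set comp : Comp n m ≃ Comp n m := Equiv.sumCongr (Equiv.refl _) σ with hcomp
  set time : Comp n m → ℝ ≃o ℝ := Sum.elim e e' with htime
  have hvalid (p : Param n m) : Valid (comp p.1, time p.1 p.2) ↔ Valid p := by
    obtain ⟨i | j, t⟩ := p
    · exact (he i t).2
    · exact iff_of_true (valid_inr _ _) (valid_inr _ _)
  have htime' (p : Param n m) (hp : Valid p) : time p.1 p.2 = ρ p.1 p.2 := by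
    obtain ⟨i | j, t⟩ := p
    · exact (he i t).1 hp
    · exact he' j t
  have hsame (p q : Param n m) :
      SamePoint (comp p.1, time p.1 p.2) (comp q.1, time q.1 q.2) ↔ SamePoint p q := by
    unfold SamePoint
    simp only [comp.apply_eq_iff_eq]
    refine and_congr_right fun hpq => ?_
    rw [← hpq, (time p.1).apply_eq_iff_eq]
    refine or_congr_right ?_
    obtain ⟨i | j, t⟩ := p
    · simp [hcomp]
    · simp only [hcomp, htime, Equiv.sumCongr_apply, Sum.map_inr, Sum.isRight_inr, true_and,
        Sum.elim_inr, ← he'', (e' j).apply_eq_iff_eq]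
  have hcurve' (p : Param n m) (hp : Valid p) :
      D'.curve p.1 p.2 = D.curve (comp p.1) (time p.1 p.2) := by
    rw [htime' p hp]
    exact (hcurve p hp).1
  have hdouble (p q : Param n m) : IsDouble D'.curve p q ↔
      IsDouble D.curve (comp p.1, time p.1 p.2) (comp q.1, time q.1 q.2) := by
    unfold IsDouble
    rw [hvalid, hvalid, hsame]
    refine and_congr_right fun hp => and_congr_right fun hq => and_congr_right fun _ => ?_
    rw [hcurve' p hp, hcurve' q hq]
  have hderiv (p q : Param n m) (hpq : IsDouble D'.curve p q) : deriv (D'.curve p.1) p.2 =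
      deriv (ρ p.1) p.2 • deriv (D.curve (comp p.1)) (time p.1 p.2) := by
    have h1 : D'.curve p.1 =ᶠ[𝓝 p.2] D.curve (comp p.1) ∘ ρ p.1 := by
      filter_upwards [IsDouble.timeDomain_mem_nhds D' hpq] with s hs using (hcurve (p.1, s) hs).1
    rw [h1.deriv_eq, htime' p hpq.1]
    exact (HasDerivAt.scomp p.2
      (((D.smooth (comp p.1)).differentiable (by simp)) _).hasDerivAt
      (((hsmooth p.1).differentiable (by simp)) p.2).hasDerivAt).deriv
  refine Relabeling.sameColorings ⟨comp, time, hsame, hdouble, fun p => ?_, fun p q hpq => ?_,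
    fun _ => rfl, fun i => ?_, fun i => ?_⟩
  · by_cases hp : Valid p
    · rw [htime' p hp]
      exact (hcurve p hp).2
    · exact iff_of_false (fun h => hp (D'.valid_of_mem_under h))
        fun h => hp ((hvalid p).1 (D.valid_of_mem_under h))
  -- Both tangent vectors are rescaled by positive factors, so the sign of the crossing survives.
  · rw [crossDet, hderiv p q hpq, hderiv q p hpq.symm]
    have key (a b : ℝ) (z w : ℂ) : planeDet (a • z) (b • w) = a * b * planeDet z w := by
      simp only [planeDet, Complex.smul_re, Complex.smul_im, smul_eq_mul]
      ring
    rw [key, mul_pos_iff_of_pos_left (mul_pos (hpos p hpq.1) (hpos q hpq.2.1))]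
    rfl
  · exact ((he i 0).1 (left_mem_Icc.2 zero_le_one)).trans (hends i).1
  · exact ((he i 1).1 (right_mem_Icc.2 zero_le_one)).trans (hends i).2

end Diagram

end Linkoid

/-! ### Changes of a diagram inside the unit disc -/

namespace Linkoid

open Filter Topology

namespace Strands

variable {n m k : ℕ} (T : Strands n m k)

theorem start_mem (i : Fin k) : T.start i ∈ T.interval i := left_mem_Icc.2 (T.start_lt_finish i).le

theorem finish_mem (i : Fin k) : T.finish i ∈ T.interval i :=
  right_mem_Icc.2 (T.start_lt_finish i).le

theorem comp_cases (i : Fin k) : (∃ a : Fin n, T.comp i = Sum.inl a ∧ 0 < T.start i ∧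
    T.finish i < 1) ∨ ∃ j : Fin m, T.comp i = Sum.inr j ∧ T.finish i < T.start i + 1 := by
  rcases h : T.comp i with a | j
  · exact Or.inl ⟨a, rfl, T.inside_open i (by rw [h]; rfl)⟩
  · exact Or.inr ⟨j, rfl, T.inside_closed i (by rw [h]; rfl)⟩

theorem timeDomain_mem_nhds {i : Fin k} {t : ℝ} (ht : t ∈ T.interval i) :
    timeDomain (T.comp i) ∈ 𝓝 t := by
  rcases T.comp_cases i with ⟨a, ha, h0, h1⟩ | ⟨j, hj, -⟩
  · rw [ha]
    exact Icc_mem_nhds (h0.trans_le ht.1) (ht.2.trans_lt h1)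
  · rw [hj]
    exact univ_mem

theorem valid {i : Fin k} {t : ℝ} (ht : t ∈ T.interval i) : Valid (T.comp i, t) :=
  mem_of_mem_nhds (T.timeDomain_mem_nhds ht)

theorem mem_points {i : Fin k} {t : ℝ} (ht : t ∈ T.interval i) : (T.comp i, t) ∈ T.points :=
  ⟨i, t, ht, SamePoint.refl _⟩

theorem points_congr {p q : Param n m} (h : SamePoint p q) : p ∈ T.points ↔ q ∈ T.points :=
  ⟨fun ⟨i, t, ht, h'⟩ => ⟨i, t, ht, h.symm.trans h'⟩, fun ⟨i, t, ht, h'⟩ => ⟨i, t, ht, h.trans h'⟩⟩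

/-- Different strands are disjoint, and a strand is shorter than a period, so it contains no two
translates of one time. This makes `glue` well defined. -/
theorem eq_of_samePoint {i j : Fin k} {s t : ℝ} (hs : s ∈ T.interval i) (ht : t ∈ T.interval j)
    (h : SamePoint (T.comp i, s) (T.comp j, t)) : i = j ∧ s = t := by
  obtain rfl : i = j := by
    by_contra hij
    exact T.disjoint i j hij s hs t ht h
  refine ⟨rfl, ?_⟩
  obtain ⟨-, h | ⟨hr, l, hl⟩⟩ := h
  · exact h
  · have hlt := T.inside_closed i hr
    simp only at hl
    have h1 : (l : ℝ) < 1 := by linarith [ht.2, hs.1]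
    have h2 : (-1 : ℝ) < l := by linarith [ht.1, hs.2]
    have h3 : l < 1 := by exact_mod_cast h1
    have h4 : -1 < l := by exact_mod_cast h2
    have h5 : l = 0 := by omega
    rw [h5, Int.cast_zero] at hl
    linarith

/-- On a circle these times are `ℤ` plus a compact interval, a sum of a closed and a compact set. -/
theorem isClosed_strandTimes (c : Comp n m) (i : Fin k) :
    IsClosed {s : ℝ | ∃ t ∈ T.interval i, SamePoint (c, s) (T.comp i, t)} := by
  by_cases hc : c = T.comp i
  · rcases T.comp_cases i with ⟨a, ha, -⟩ | ⟨j, hj, -⟩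
    · convert (isClosed_Icc : IsClosed (T.interval i)) using 1
      ext s
      constructor
      · rintro ⟨t, ht, h⟩
        obtain h | ⟨j, k, hj, -⟩ := h.eq_or
        · exact (show t = s from (Prod.ext_iff.1 h).2) ▸ ht
        · rw [hc, ha] at hj
          cases hj
      · intro hs
        exact ⟨s, hs, hc ▸ SamePoint.refl _⟩
    · have h1 := Int.isClosedEmbedding_coe_real.isClosed_range.add_right_of_isCompact
        (isCompact_Icc : IsCompact (T.interval i))
      convert h1 using 1
      ext s
      constructor
      · rintro ⟨t, ht, -, h | ⟨-, l, hl⟩⟩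
        · exact mem_add.2 ⟨0, ⟨0, by simp⟩, t, ht, by simpa using h.symm⟩
        · refine mem_add.2 ⟨((-l : ℤ) : ℝ), ⟨-l, rfl⟩, t, ht, ?_⟩
          simp only at hl
          push_cast
          linarith
      · intro hs
        obtain ⟨_, ⟨l, rfl⟩, t, ht, rfl⟩ := mem_add.1 hs
        refine ⟨t, ht, hc, Or.inr ⟨by rw [hc, hj]; rfl, -l, ?_⟩⟩
        push_cast
        ring
  · convert isClosed_empty using 1
    ext s
    simp only [mem_ofPred_eq, mem_empty_iff_false, iff_false]
    rintro ⟨t, -, h, -⟩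
    exact hc h

theorem isClosed_times (c : Comp n m) : IsClosed {s : ℝ | (c, s) ∈ T.points} := by
  have h : {s : ℝ | (c, s) ∈ T.points} =
      ⋃ i, {s : ℝ | ∃ t ∈ T.interval i, SamePoint (c, s) (T.comp i, t)} := by
    ext s
    simp [points]
  rw [h]
  exact isClosed_iUnion_of_finite fun i => T.isClosed_strandTimes c i

theorem eventually_not_mem_of_ne {i j : Fin k} (hij : i ≠ j) {t : ℝ} (ht : t ∈ T.interval i) :
    ∀ᶠ s in 𝓝 t, ¬ ∃ r ∈ T.interval j, SamePoint (T.comp i, s) (T.comp j, r) :=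
  (T.isClosed_strandTimes (T.comp i) j).isOpen_compl.mem_nhds
    fun ⟨r, hr, h⟩ => T.disjoint i j hij t ht r hr h

theorem not_samePoint_of_near {i : Fin k} {s r : ℝ} (hr : r ∈ T.interval i)
    (hs : s ∉ T.interval i) (h1 : T.finish i - 1 < s) (h2 : s < T.start i + 1) :
    ¬ SamePoint (T.comp i, s) (T.comp i, r) := by
  rintro ⟨-, h | ⟨-, l, hl⟩⟩
  · exact hs ((show s = r from h) ▸ hr)
  · simp only at hl
    have h3 : (l : ℝ) < 1 := by linarith [hr.2]
    have h4 : (-1 : ℝ) < l := by linarith [hr.1]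
    have h5 : l < 1 := by exact_mod_cast h3
    have h6 : -1 < l := by exact_mod_cast h4
    have h7 : l = 0 := by omega
    rw [h7, Int.cast_zero, add_zero] at hl
    exact hs (hl ▸ hr)

theorem length_lt_one (i : Fin k) : T.finish i < T.start i + 1 := by
  rcases T.comp_cases i with ⟨a, -, h0, h1⟩ | ⟨j, -, h⟩
  · linarith
  · exact h

/-- The other strands keep a distance by closedness; the preceding translate of the strand itself
ends at `finish - 1`, which is before its start. -/
theorem eventually_not_mem_points_left (i : Fin k) :
    ∀ᶠ s in 𝓝[<] T.start i, (T.comp i, s) ∉ T.points := by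
  have h1 : ∀ᶠ s in 𝓝[<] T.start i, ∀ j, j ≠ i →
      ¬ ∃ r ∈ T.interval j, SamePoint (T.comp i, s) (T.comp j, r) :=
    eventually_all.2 fun j => eventually_imp_distrib_left.2 fun hji =>
      (T.eventually_not_mem_of_ne hji.symm (T.start_mem i)).filter_mono nhdsWithin_le_nhds
  have hlen := T.length_lt_one i
  filter_upwards [h1, Ioo_mem_nhdsLT (show T.finish i - 1 < T.start i by linarith)] with s hs hs'
  rintro ⟨j, r, hr, h⟩
  by_cases hji : j = i
  · subst hji
    exact T.not_samePoint_of_near hr (fun h' => hs'.2.not_ge h'.1) hs'.1 (by linarith [hs'.2]) h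
  · exact hs j hji ⟨r, hr, h⟩

theorem eventually_not_mem_points_right (i : Fin k) :
    ∀ᶠ s in 𝓝[>] T.finish i, (T.comp i, s) ∉ T.points := by
  have h1 : ∀ᶠ s in 𝓝[>] T.finish i, ∀ j, j ≠ i →
      ¬ ∃ r ∈ T.interval j, SamePoint (T.comp i, s) (T.comp j, r) :=
    eventually_all.2 fun j => eventually_imp_distrib_left.2 fun hji =>
      (T.eventually_not_mem_of_ne hji.symm (T.finish_mem i)).filter_mono nhdsWithin_le_nhds
  have hlen := T.length_lt_one i
  filter_upwards [h1, Ioo_mem_nhdsGT (show T.finish i < T.start i + 1 by linarith)] with s hs hs'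
  rintro ⟨j, r, hr, h⟩
  by_cases hji : j = i
  · subst hji
    exact T.not_samePoint_of_near hr (fun h' => hs'.1.not_ge h'.2) (by linarith [hs'.1]) hs'.2 h
  · exact hs j hji ⟨r, hr, h⟩

theorem endParam_not_mem_points (l : Fin (2 * n)) : Diagram.endParam m l ∉ T.points := by
  rintro ⟨i, t, ht, h⟩
  obtain h | ⟨j, -, hj, -⟩ := h.eq_or
  · unfold Diagram.endParam at h
    have hc := (Prod.ext_iff.1 h).1
    have ht' := (Prod.ext_iff.1 h).2
    simp only at hc ht'
    have hin := T.inside_open i (by rw [hc]; rfl)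
    split_ifs at ht'
    · linarith [ht.1]
    · linarith [ht.2]
  · unfold Diagram.endParam at hj
    cases hj

/-! #### The ends of the strands lie on the unit circle -/

variable {T} {D D' : Diagram n m}

theorem FillDisc.norm_le (h : T.FillDisc D) {i : Fin k} {t : ℝ} (ht : t ∈ T.interval i) :
    ‖T.path D i t‖ ≤ 1 :=
  (h.1 _ (T.valid ht)).2 (T.mem_points ht)

theorem continuous_path (T : Strands n m k) (D : Diagram n m) (i : Fin k) :
    Continuous (T.path D i) :=
  (D.smooth (T.comp i)).continuous

theorem FillDisc.eventually_norm_gt (h : T.FillDisc D) {i : Fin k} {t : ℝ}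
    (ht : t ∈ T.interval i) {l : Filter ℝ} (hl : l ≤ 𝓝 t)
    (hp : ∀ᶠ s in l, (T.comp i, s) ∉ T.points) : ∀ᶠ s in l, 1 < ‖T.path D i s‖ := by
  filter_upwards [hp, hl (T.timeDomain_mem_nhds ht)] with s hs hv
  by_contra! h'
  exact hs ((h.1 (T.comp i, s) hv).1 h')

/-- Just before its start the curve is off the strands, hence outside the closed disc; at the start
it is inside. Continuity leaves only the circle. -/
theorem FillDisc.norm_start (h : T.FillDisc D) (i : Fin k) : ‖T.path D i (T.start i)‖ = 1 := by
  refine le_antisymm (h.norm_le (T.start_mem i)) ?_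
  have h1 := h.eventually_norm_gt (T.start_mem i) nhdsWithin_le_nhds
    (T.eventually_not_mem_points_left i)
  exact ge_of_tendsto (((continuous_path T D i).norm.tendsto _).mono_left nhdsWithin_le_nhds)
    (h1.mono fun _ => le_of_lt)

theorem FillDisc.norm_finish (h : T.FillDisc D) (i : Fin k) : ‖T.path D i (T.finish i)‖ = 1 := by
  refine le_antisymm (h.norm_le (T.finish_mem i)) ?_
  have h1 := h.eventually_norm_gt (T.finish_mem i) nhdsWithin_le_nhds
    (T.eventually_not_mem_points_right i)
  exact ge_of_tendsto (((continuous_path T D i).norm.tendsto _).mono_left nhdsWithin_le_nhds)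
    (h1.mono fun _ => le_of_lt)

theorem LocalChange.symm (h : T.LocalChange D D') : T.LocalChange D' D :=
  ⟨h.2.1, h.1, fun p hp hp' => ⟨(h.2.2 p hp hp').1.symm, (h.2.2 p hp hp').2.symm⟩⟩

/-- The diagrams agree just outside the disc, and both curves are continuous. -/
theorem LocalChange.path_start (h : T.LocalChange D D') (i : Fin k) :
    T.path D' i (T.start i) = T.path D i (T.start i) := by
  have h1 : T.path D' i =ᶠ[𝓝[<] T.start i] T.path D i := by
    filter_upwards [T.eventually_not_mem_points_left i,
      mem_nhdsWithin_of_mem_nhds (T.timeDomain_mem_nhds (T.start_mem i))] with s hs hv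
    exact (h.2.2 (T.comp i, s) hv hs).1
  refine tendsto_nhds_unique (((continuous_path T D' i).tendsto _).mono_left nhdsWithin_le_nhds)
    (Tendsto.congr' h1.symm (((continuous_path T D i).tendsto _).mono_left nhdsWithin_le_nhds))

theorem LocalChange.path_finish (h : T.LocalChange D D') (i : Fin k) :
    T.path D' i (T.finish i) = T.path D i (T.finish i) := by
  have h1 : T.path D' i =ᶠ[𝓝[>] T.finish i] T.path D i := by
    filter_upwards [T.eventually_not_mem_points_right i,
      mem_nhdsWithin_of_mem_nhds (T.timeDomain_mem_nhds (T.finish_mem i))] with s hs hv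
    exact (h.2.2 (T.comp i, s) hv hs).1
  refine tendsto_nhds_unique (((continuous_path T D' i).tendsto _).mono_left nhdsWithin_le_nhds)
    (Tendsto.congr' h1.symm (((continuous_path T D i).tendsto _).mono_left nhdsWithin_le_nhds))

/-- A point that has the same image as a point of a strand lies on a strand. -/
theorem FillDisc.exists_partner (h : T.FillDisc D) {i : Fin k} {t : ℝ} (ht : t ∈ T.interval i)
    {o : Param n m} (ho : IsDouble D.curve (T.comp i, t) o) :
    ∃ j, ∃ u ∈ T.interval j, SamePoint o (T.comp j, u) ∧
      IsDouble D.curve (T.comp i, t) (T.comp j, u) := by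
  have h1 : ‖D.curve o.1 o.2‖ ≤ 1 := by
    rw [← ho.2.2.2]
    exact h.norm_le ht
  obtain ⟨j, u, hu, hou⟩ := (h.1 o ho.2.1).1 h1
  exact ⟨j, u, hu, hou, D.isDouble_congr_right hou ho⟩

theorem isDouble_iff {i j : Fin k} {s t : ℝ} (hs : s ∈ T.interval i) (ht : t ∈ T.interval j) :
    IsDouble D.curve (T.comp i, s) (T.comp j, t) ↔
      ¬ (i = j ∧ s = t) ∧ T.path D i s = T.path D j t := by
  constructor
  · rintro ⟨-, -, h, h'⟩
    exact ⟨fun ⟨hij, hst⟩ => h (by rw [hij, hst]; exact SamePoint.refl _), h'⟩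
  · rintro ⟨h, h'⟩
    exact ⟨T.valid hs, T.valid ht, fun h'' => h (T.eq_of_samePoint hs ht h''), h'⟩

theorem FillDisc.exists_of_under (h : T.FillDisc D) {i : Fin k} {t : ℝ} (ht : t ∈ T.interval i)
    (hu : T.Under D i t) : ∃ j, ∃ u ∈ T.interval j, ¬ (i = j ∧ t = u) ∧
      T.path D i t = T.path D j u := by
  obtain ⟨o, ho⟩ := D.under_double _ hu
  obtain ⟨j, u, hju, -, hd⟩ := h.exists_partner ht ho
  exact ⟨j, u, hju, (isDouble_iff ht hju).1 hd⟩

/-! #### Colorings of the strands -/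

variable {X : Type u}

open Classical in
/-- The function that is `g` on the strands and `f` elsewhere. -/
noncomputable def glue (T : Strands n m k) (f : Param n m → X) (g : Fin k → ℝ → X)
    (p : Param n m) : X :=
  if h : p ∈ T.points then g h.choose h.choose_spec.choose else f p

theorem glue_of_samePoint {f : Param n m → X} {g : Fin k → ℝ → X} {p : Param n m} {i : Fin k}
    {t : ℝ} (ht : t ∈ T.interval i) (h : SamePoint p (T.comp i, t)) : T.glue f g p = g i t := by
  have hp : p ∈ T.points := ⟨i, t, ht, h⟩
  rw [glue, dif_pos hp]
  obtain ⟨h1, h2⟩ := hp.choose_spec.choose_spec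
  obtain ⟨h3, h4⟩ := T.eq_of_samePoint h1 ht (h2.symm.trans h)
  rw [h4, h3]

theorem glue_of_mem {f : Param n m → X} {g : Fin k → ℝ → X} {i : Fin k} {t : ℝ}
    (ht : t ∈ T.interval i) : T.glue f g (T.comp i, t) = g i t :=
  glue_of_samePoint ht (SamePoint.refl _)

theorem glue_of_not_mem {f : Param n m → X} {g : Fin k → ℝ → X} {p : Param n m}
    (hp : p ∉ T.points) : T.glue f g p = f p := dif_neg hp

variable [Quandle X]

variable (T D) in
/-- The conditions on the colors of the `i`-th strand. -/
structure StrandColored (g : Fin k → ℝ → X) (i : Fin k) : Prop where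
  left : ∀ t ∈ Ioc (T.start i) (T.finish i), ∀ᶠ s in 𝓝[<] t, g i s = g i t
  right : ∀ t ∈ Ico (T.start i) (T.finish i), ¬ T.Under D i t → ∀ᶠ s in 𝓝[>] t, g i s = g i t
  cross : ∀ t ∈ Ico (T.start i) (T.finish i), ∀ j, ∀ u ∈ T.interval j, T.Under D i t →
    IsDouble D.curve (T.comp i, t) (T.comp j, u) →
    ∀ᶠ s in 𝓝[>] t, g i s =
      signAct (D.crossDet (T.comp j, u) (T.comp i, t)) (g j u) (g i t)

variable (T D) in
/-- `S a` is the unique coloring of the strands that has the colors `a` at their starts. -/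
def Solves (S : (Fin k → X) → Fin k → ℝ → X) : Prop :=
  (∀ a i, S a i (T.start i) = a i) ∧ ∀ g : Fin k → ℝ → X, (∀ i, T.StrandColored D g i) ↔
    ∀ i, ∀ t ∈ T.interval i, g i t = S (fun j => g j (T.start j)) i t

theorem Solves.strandColored {S : (Fin k → X) → Fin k → ℝ → X} (h : T.Solves D S)
    (a : Fin k → X) (i : Fin k) : T.StrandColored D (S a) i := by
  refine (h.2 (S a)).2 (fun i t _ => ?_) i
  rw [funext (h.1 a)]

theorem strandColored_of_isColoring {f : Param n m → X} (hf : D.IsColoring f) (i : Fin k) :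
    T.StrandColored D (fun i t => f (T.comp i, t)) i :=
  ⟨fun t _ => (hf.coloredAt (T.comp i, t)).left, fun t _ => (hf.coloredAt (T.comp i, t)).right,
    fun t _ _ _ _ hu hd => (hf.coloredAt (T.comp i, t)).cross _ hu hd⟩

theorem Solves.eq {S : (Fin k → X) → Fin k → ℝ → X} (h : T.Solves D S) {f : Param n m → X}
    (hf : D.IsColoring f) {i : Fin k} {t : ℝ} (ht : t ∈ T.interval i) :
    f (T.comp i, t) = S (fun j => f (T.comp j, T.start j)) i t :=
  (h.2 fun i t => f (T.comp i, t)).1 (strandColored_of_isColoring hf) i t ht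

theorem LocalChange.isDouble (h : T.LocalChange D D') {p q : Param n m} (hp : p ∉ T.points)
    (hpq : IsDouble D'.curve p q) : q ∉ T.points ∧ IsDouble D.curve p q := by
  have hq : q ∉ T.points := fun hq => hp <| by
    rw [← h.2.1.1 p hpq.1, hpq.2.2.2]
    exact (h.2.1.1 q hpq.2.1).2 hq
  refine ⟨hq, hpq.1, hpq.2.1, hpq.2.2.1, ?_⟩
  rw [← (h.2.2 p hpq.1 hp).1, ← (h.2.2 q hpq.2.1 hq).1]
  exact hpq.2.2.2

theorem LocalChange.deriv_eq (h : T.LocalChange D D') {p q : Param n m} (hp : p ∉ T.points)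
    (hpq : IsDouble D'.curve p q) : deriv (D'.curve p.1) p.2 = deriv (D.curve p.1) p.2 := by
  refine EventuallyEq.deriv_eq ?_
  filter_upwards [Diagram.IsDouble.timeDomain_mem_nhds D' hpq,
    (T.isClosed_times p.1).isOpen_compl.mem_nhds hp] with s hv hs
  exact (h.2.2 (p.1, s) hv hs).1

/-- At interior times of a strand the conditions are those on `g`, and off the strands those on `f`.
At a start the condition from the left comes from `f`, and at a finish the one from the right; the
latter is plain constancy only if the finish is not an undercrossing, which is why `hfin` and
`hfin'` are needed. -/
theorem LocalChange.isColoring_glue (h : T.LocalChange D D')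
    (hfin : ∀ i, ¬ T.Under D i (T.finish i)) (hfin' : ∀ i, ¬ T.Under D' i (T.finish i))
    {f : Param n m → X} (hf : D.IsColoring f) {g : Fin k → ℝ → X}
    (hg : ∀ i, T.StrandColored D' g i) (hs : ∀ i, g i (T.start i) = f (T.comp i, T.start i))
    (he : ∀ i, g i (T.finish i) = f (T.comp i, T.finish i)) : D'.IsColoring (T.glue f g) := by
  have hper : ∀ p q, SamePoint p q → T.glue f g p = T.glue f g q := by
    intro p q hpq
    by_cases hp : p ∈ T.points
    · obtain ⟨i, t, ht, h'⟩ := hp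
      rw [glue_of_samePoint ht h', glue_of_samePoint ht (hpq.symm.trans h')]
    · rw [glue_of_not_mem hp, glue_of_not_mem fun hq => hp ((T.points_congr hpq).2 hq),
        hf.periodic _ _ hpq]
  refine ⟨hper, fun p => ?_⟩
  by_cases hp : p ∈ T.points
  · obtain ⟨i, t, ht, h'⟩ := hp
    refine Diagram.ColoredAt.congr hper h'.symm ⟨?_, fun hu => ?_, fun o hu ho => ?_⟩
    · rw [glue_of_mem ht]
      rcases ht.1.eq_or_lt with rfl | hlt
      · filter_upwards [T.eventually_not_mem_points_left i,
          (hf.coloredAt (T.comp i, T.start i)).left] with s hs1 hs2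
        rw [glue_of_not_mem hs1, hs2, hs]
      · filter_upwards [(hg i).left t ⟨hlt, ht.2⟩, Ioo_mem_nhdsLT hlt] with s hs1 hs2
        rw [glue_of_mem ⟨hs2.1.le, hs2.2.le.trans ht.2⟩, hs1]
    · rw [glue_of_mem ht]
      rcases ht.2.eq_or_lt with rfl | hlt
      · filter_upwards [T.eventually_not_mem_points_right i,
          (hf.coloredAt (T.comp i, T.finish i)).right (hfin i)] with s hs1 hs2
        rw [glue_of_not_mem hs1, hs2, he]
      · filter_upwards [(hg i).right t ⟨ht.1, hlt⟩ hu, Ioo_mem_nhdsGT hlt] with s hs1 hs2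
        rw [glue_of_mem ⟨ht.1.trans hs2.1.le, hs2.2.le⟩, hs1]
    · rcases ht.2.eq_or_lt with rfl | hlt
      · exact absurd hu (hfin' i)
      -- The over-passing point lies in the disc too, so its color is also given by `g`.
      · obtain ⟨j, r, hr, hor, hd⟩ := h.2.1.exists_partner ht ho
        filter_upwards [(hg i).cross t ⟨ht.1, hlt⟩ j r hr hu hd, Ioo_mem_nhdsGT hlt] with s hs1 hs2
        rw [glue_of_mem ht, glue_of_samePoint hr hor, D'.crossDet_congr hor (SamePoint.refl _),
          ← hs1, glue_of_mem ⟨ht.1.trans hs2.1.le, hs2.2.le⟩]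
  · have hnear : ∀ᶠ s in 𝓝 p.2, T.glue f g (p.1, s) = f (p.1, s) := by
      filter_upwards [(T.isClosed_times p.1).isOpen_compl.mem_nhds hp] with s hs'
      exact glue_of_not_mem hs'
    have hf' := hf.coloredAt p
    refine ⟨?_, fun hu => ?_, fun o hu ho => ?_⟩
    · filter_upwards [hf'.left, hnear.filter_mono nhdsWithin_le_nhds] with s h1 h2
      rw [h2, h1, glue_of_not_mem hp]
    · have hu' : p ∉ D.under := fun hu' => hu ((h.2.2 p (D.valid_of_mem_under hu') hp).2.2 hu')
      filter_upwards [hf'.right hu', hnear.filter_mono nhdsWithin_le_nhds] with s h1 h2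
      rw [h2, h1, glue_of_not_mem hp]
    · obtain ⟨hop, hd⟩ := h.isDouble hp ho
      have hu' : p ∈ D.under := (h.2.2 p ho.1 hp).2.1 hu
      filter_upwards [hf'.cross o hu' hd, hnear.filter_mono nhdsWithin_le_nhds] with s h1 h2
      rw [h2, h1, glue_of_not_mem hp, glue_of_not_mem hop, Diagram.crossDet, Diagram.crossDet,
        h.deriv_eq hp ho, h.deriv_eq hop ho.symm]

/-- The coloring of `D'` that agrees with a given one of `D` outside the disc. -/
noncomputable def transfer (T : Strands n m k) (S' : (Fin k → X) → Fin k → ℝ → X)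
    (f : Param n m → X) : Param n m → X :=
  T.glue f (S' fun j => f (T.comp j, T.start j))

theorem LocalChange.isPointedColoring_transfer (h : T.LocalChange D D')
    (hfin : ∀ i, ¬ T.Under D i (T.finish i)) (hfin' : ∀ i, ¬ T.Under D' i (T.finish i))
    {X : PointedQuandle.{u} (2 * n)} {S S' : (Fin k → X.carrier) → Fin k → ℝ → X.carrier}
    (hS : T.Solves D S) (hS' : T.Solves D' S')
    (hSS' : ∀ a i, S a i (T.finish i) = S' a i (T.finish i)) {f : Param n m → X.carrier}
    (hf : D.IsPointedColoring X f) : D'.IsPointedColoring X (T.transfer S' f) := by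
  refine ⟨h.isColoring_glue hfin hfin' hf.1 (hS'.strandColored _) (hS'.1 _) fun i => ?_,
    fun l => ?_⟩
  · rw [← hSS', hS.eq hf.1 (T.finish_mem i)]
  · rw [transfer, glue_of_not_mem (T.endParam_not_mem_points l), hf.2]

theorem transfer_transfer {S S' : (Fin k → X) → Fin k → ℝ → X} (hS : T.Solves D S)
    (hS' : T.Solves D' S') {f : Param n m → X} (hf : D.IsColoring f) :
    T.transfer S (T.transfer S' f) = f := by
  have hstart (j : Fin k) : T.transfer S' f (T.comp j, T.start j) = f (T.comp j, T.start j) := by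
    rw [transfer, glue_of_mem (T.start_mem j), hS'.1]
  ext p
  rw [transfer, funext hstart]
  by_cases hp : p ∈ T.points
  · obtain ⟨i, t, ht, h⟩ := hp
    rw [glue_of_samePoint ht h, ← hS.eq hf ht, hf.periodic _ _ h]
  · rw [glue_of_not_mem hp, transfer, glue_of_not_mem hp]

/-- The cut and paste principle. The interior colors follow from those at the starts, which
`transfer` keeps, so transferring back and forth recovers the original; equal finishes make the new
interior fit the old exterior. -/
theorem LocalChange.sameColorings (h : T.LocalChange D D')
    (hfin : ∀ i, ¬ T.Under D i (T.finish i)) (hfin' : ∀ i, ¬ T.Under D' i (T.finish i))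
    (hS : ∀ (X : Type u) [Quandle X], ∃ S S' : (Fin k → X) → Fin k → ℝ → X,
      T.Solves D S ∧ T.Solves D' S' ∧ ∀ a i, S a i (T.finish i) = S' a i (T.finish i)) :
    Diagram.SameColorings.{u} D D' := by
  intro X
  obtain ⟨S, S', h1, h2, h3⟩ := hS X.carrier
  exact ⟨⟨fun f => ⟨T.transfer S' f.1, h.isPointedColoring_transfer hfin hfin' h1 h2 h3 f.2⟩,
    fun f => ⟨T.transfer S f.1, h.symm.isPointedColoring_transfer hfin' hfin h2 h1
      (fun a i => (h3 a i).symm) f.2⟩,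
    fun f => Subtype.ext (transfer_transfer h1 h2 f.2.1),
    fun f => Subtype.ext (transfer_transfer h2 h1 f.2.1)⟩⟩

end Strands

end Linkoid

/-! ### Colors along a strand -/

namespace Linkoid

open Filter Topology

theorem eq_of_eventually_right {Y : Type u} {h : ℝ → Y} {s t : ℝ} (hst : s < t)
    (hl : ∀ r ∈ Ioc s t, ∀ᶠ x in 𝓝[<] r, h x = h r)
    (hr : ∀ r ∈ Ioo s t, ∀ᶠ x in 𝓝[>] r, h x = h r) {v : Y}
    (hv : ∀ᶠ x in 𝓝[>] s, h x = v) : h t = v := by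
  obtain ⟨r, hr1, hr2⟩ := (hv.and (Ioo_mem_nhdsGT hst)).exists
  rw [← hr1]
  exact eq_of_locally_constant (a := r) (b := t) (fun x hx => hl x ⟨hr2.1.trans hx.1, hx.2⟩)
    (fun x hx => hr x ⟨hr2.1.trans_le hx.1, hx.2⟩) (right_mem_Icc.2 hr2.2.le)
    (left_mem_Icc.2 hr2.2.le)

/-- The jump conditions act like a first order equation with a unique solution for each initial
value. Jumps equal to `id` are allowed, so strands with fewer than two undercrossings are included.
-/
theorem forall_eq_step_two_iff {Y : Type u} {h : ℝ → Y} {a b τ₁ τ₂ : ℝ} {J : ℝ → Y → Y}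
    (h1 : a < τ₁) (h12 : τ₁ < τ₂) (h2 : τ₂ < b)
    (hJ : ∀ t ∈ Ico a b, t ≠ τ₁ → t ≠ τ₂ → J t = id) :
    ((∀ t ∈ Ioc a b, ∀ᶠ s in 𝓝[<] t, h s = h t) ∧
      ∀ t ∈ Ico a b, ∀ᶠ s in 𝓝[>] t, h s = J t (h t)) ↔
    ∀ t ∈ Icc a b, h t = if t ≤ τ₁ then h a else if t ≤ τ₂ then J τ₁ (h a) else
      J τ₂ (J τ₁ (h a)) := by
  constructor
  · rintro ⟨hl, hr⟩
    have hr' (t : ℝ) (ht : t ∈ Ico a b) (ht1 : t ≠ τ₁) (ht2 : t ≠ τ₂) :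
        ∀ᶠ s in 𝓝[>] t, h s = h t := by
      have := hr t ht
      rwa [hJ t ht ht1 ht2] at this
    have e1 (t : ℝ) (ht : t ∈ Icc a τ₁) : h t = h a :=
      eq_of_locally_constant (a := a) (b := τ₁)
        (fun x hx => hl x ⟨hx.1, by linarith [hx.2]⟩)
        (fun x hx => hr' x ⟨hx.1, by linarith [hx.2]⟩ hx.2.ne (hx.2.trans h12).ne) ht
        (left_mem_Icc.2 h1.le)
    have e2 (t : ℝ) (ht : t ∈ Ioc τ₁ τ₂) : h t = J τ₁ (h a) := by
      refine eq_of_eventually_right ht.1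
        (fun x hx => hl x ⟨h1.trans hx.1, by linarith [hx.2, ht.2]⟩)
        (fun x hx => hr' x ⟨(h1.trans hx.1).le, by linarith [hx.2, ht.2]⟩ hx.1.ne'
          (hx.2.trans_le ht.2).ne) ?_
      rw [← e1 τ₁ ⟨h1.le, le_rfl⟩]
      exact hr τ₁ ⟨h1.le, h12.trans h2⟩
    have e3 (t : ℝ) (ht : t ∈ Ioc τ₂ b) : h t = J τ₂ (J τ₁ (h a)) := by
      refine eq_of_eventually_right ht.1
        (fun x hx => hl x ⟨by linarith [hx.1], hx.2.trans ht.2⟩)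
        (fun x hx => hr' x ⟨by linarith [hx.1], hx.2.trans_le ht.2⟩ (h12.trans hx.1).ne'
          hx.1.ne') ?_
      rw [← e2 τ₂ ⟨h12, le_rfl⟩]
      exact hr τ₂ ⟨(h1.trans h12).le, h2⟩
    intro t ht
    split_ifs with ht1 ht2
    · exact e1 t ⟨ht.1, ht1⟩
    · exact e2 t ⟨not_le.1 ht1, ht2⟩
    · exact e3 t ⟨not_le.1 ht2, ht.2⟩
  · intro H
    have e1 (t : ℝ) (ht : t ∈ Icc a τ₁) : h t = h a := by
      rw [H t ⟨ht.1, by linarith [ht.2]⟩, if_pos ht.2]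
    have e2 (t : ℝ) (ht : t ∈ Ioc τ₁ τ₂) : h t = J τ₁ (h a) := by
      rw [H t ⟨(h1.trans ht.1).le, by linarith [ht.2]⟩, if_neg ht.1.not_ge, if_pos ht.2]
    have e3 (t : ℝ) (ht : t ∈ Ioc τ₂ b) : h t = J τ₂ (J τ₁ (h a)) := by
      rw [H t ⟨by linarith [ht.1], ht.2⟩, if_neg (h12.trans ht.1).not_ge, if_neg ht.1.not_ge]
    refine ⟨fun t ht => ?_, fun t ht => ?_⟩
    · rcases le_or_gt t τ₁ with ht1 | ht1
      · filter_upwards [Ioo_mem_nhdsLT ht.1] with s hs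
        rw [e1 t ⟨ht.1.le, ht1⟩, e1 s ⟨hs.1.le, hs.2.le.trans ht1⟩]
      rcases le_or_gt t τ₂ with ht2 | ht2
      · filter_upwards [Ioo_mem_nhdsLT ht1] with s hs
        rw [e2 t ⟨ht1, ht2⟩, e2 s ⟨hs.1, hs.2.le.trans ht2⟩]
      · filter_upwards [Ioo_mem_nhdsLT ht2] with s hs
        rw [e3 t ⟨ht2, ht.2⟩, e3 s ⟨hs.1, hs.2.le.trans ht.2⟩]
    · rcases lt_trichotomy t τ₁ with ht1 | rfl | ht1
      · filter_upwards [Ioo_mem_nhdsGT ht1] with s hs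
        rw [hJ t ht ht1.ne (ht1.trans h12).ne, e1 t ⟨ht.1, ht1.le⟩,
          e1 s ⟨ht.1.trans hs.1.le, hs.2.le⟩, id]
      · filter_upwards [Ioo_mem_nhdsGT h12] with s hs
        rw [e2 s ⟨hs.1, hs.2.le⟩, e1 t ⟨ht.1, le_rfl⟩]
      rcases lt_trichotomy t τ₂ with ht2 | rfl | ht2
      · filter_upwards [Ioo_mem_nhdsGT ht2] with s hs
        rw [hJ t ht ht1.ne' ht2.ne, e2 t ⟨ht1, ht2.le⟩, e2 s ⟨ht1.trans hs.1, hs.2.le⟩, id]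
      · filter_upwards [Ioo_mem_nhdsGT h2] with s hs
        rw [e3 s ⟨hs.1, hs.2.le⟩, e2 t ⟨h12, le_rfl⟩]
      · filter_upwards [Ioo_mem_nhdsGT ht.2] with s hs
        rw [hJ t ht ht1.ne' ht2.ne', e3 t ⟨ht2, ht.2.le⟩, e3 s ⟨ht2.trans hs.1, hs.2.le⟩, id]

namespace Strands

variable {n m k : ℕ} {T : Strands n m k} {D : Diagram n m} {X : Type u} [Quandle X]

/-- Without triple points the over-passing strand is unique, so the condition over all partners is a
single jump. -/
theorem strandColored_iff_jump {g : Fin k → ℝ → X} {i : Fin k} {J : ℝ → X → X}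
    (h0 : ∀ t ∈ T.interval i, ¬ T.Under D i t → J t = id)
    (h1 : ∀ t ∈ T.interval i, T.Under D i t → ∃ j, ∃ u ∈ T.interval j,
      IsDouble D.curve (T.comp i, t) (T.comp j, u) ∧
      J t = signAct (D.crossDet (T.comp j, u) (T.comp i, t)) (g j u)) :
    T.StrandColored D g i ↔
      (∀ t ∈ Ioc (T.start i) (T.finish i), ∀ᶠ s in 𝓝[<] t, g i s = g i t) ∧
      ∀ t ∈ Ico (T.start i) (T.finish i), ∀ᶠ s in 𝓝[>] t, g i s = J t (g i t) := by
  constructor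
  · intro h
    refine ⟨h.left, fun t ht => ?_⟩
    by_cases hu : T.Under D i t
    · obtain ⟨j, r, hr, hd, hJ⟩ := h1 t (Ico_subset_Icc_self ht) hu
      rw [hJ]
      exact h.cross t ht j r hr hu hd
    · rw [h0 t (Ico_subset_Icc_self ht) hu]
      exact h.right t ht hu
  · rintro ⟨hl, hr⟩
    refine ⟨hl, fun t ht hu => ?_, fun t ht j r hjr hu hd => ?_⟩
    · have := hr t ht
      rwa [h0 t (Ico_subset_Icc_self ht) hu] at this
    · obtain ⟨j', r', hr', hd', hJ⟩ := h1 t (Ico_subset_Icc_self ht) hu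
      obtain ⟨rfl, rfl⟩ := T.eq_of_samePoint hjr hr' (D.no_triple _ _ _ hd hd')
      rw [← hJ]
      exact hr t ht

theorem strandColored_iff_const (g : Fin k → ℝ → X) {i : Fin k}
    (h : ∀ t ∈ T.interval i, ¬ T.Under D i t) :
    T.StrandColored D g i ↔ ∀ t ∈ T.interval i, g i t = g i (T.start i) := by
  -- Two dummy times with trivial jumps.
  obtain ⟨τ₁, h1, hb⟩ := exists_between (T.start_lt_finish i)
  obtain ⟨τ₂, h12, h2⟩ := exists_between hb
  rw [strandColored_iff_jump (J := fun _ => id) (fun _ _ _ => rfl)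
    (fun t ht hu => absurd hu (h t ht)),
    forall_eq_step_two_iff (J := fun _ => id) h1 h12 h2 fun _ _ _ _ => rfl]
  simp only [id, ite_self]
  rfl

theorem strandColored_iff_two (g : Fin k → ℝ → X) {i j₁ j₂ : Fin k} {τ₁ τ₂ u₁ u₂ : ℝ}
    (h1 : T.start i < τ₁) (h12 : τ₁ < τ₂) (h2 : τ₂ < T.finish i)
    (hu : ∀ t ∈ T.interval i, T.Under D i t ↔ t = τ₁ ∨ t = τ₂)
    (hu₁ : u₁ ∈ T.interval j₁) (hu₂ : u₂ ∈ T.interval j₂)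
    (hd₁ : IsDouble D.curve (T.comp i, τ₁) (T.comp j₁, u₁))
    (hd₂ : IsDouble D.curve (T.comp i, τ₂) (T.comp j₂, u₂)) :
    T.StrandColored D g i ↔ ∀ t ∈ T.interval i, g i t =
      if t ≤ τ₁ then g i (T.start i) else
      if t ≤ τ₂ then
        signAct (D.crossDet (T.comp j₁, u₁) (T.comp i, τ₁)) (g j₁ u₁) (g i (T.start i)) else
      signAct (D.crossDet (T.comp j₂, u₂) (T.comp i, τ₂)) (g j₂ u₂)
        (signAct (D.crossDet (T.comp j₁, u₁) (T.comp i, τ₁)) (g j₁ u₁) (g i (T.start i))) := by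
  classical
  let J : ℝ → X → X := fun t =>
    if t = τ₁ then signAct (D.crossDet (T.comp j₁, u₁) (T.comp i, τ₁)) (g j₁ u₁) else
    if t = τ₂ then signAct (D.crossDet (T.comp j₂, u₂) (T.comp i, τ₂)) (g j₂ u₂) else id
  have hJ₁ : J τ₁ = signAct (D.crossDet (T.comp j₁, u₁) (T.comp i, τ₁)) (g j₁ u₁) := if_pos rfl
  have hJ₂ : J τ₂ = signAct (D.crossDet (T.comp j₂, u₂) (T.comp i, τ₂)) (g j₂ u₂) :=
    (if_neg h12.ne').trans (if_pos rfl)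
  have hJ (t : ℝ) (ht1 : t ≠ τ₁) (ht2 : t ≠ τ₂) : J t = id :=
    (if_neg ht1).trans (if_neg ht2)
  rw [strandColored_iff_jump (J := J), forall_eq_step_two_iff h1 h12 h2 fun t _ => hJ t, hJ₁, hJ₂]
  · rfl
  · intro t ht hn
    rw [hu t ht, not_or] at hn
    exact hJ t hn.1 hn.2
  · intro t ht hn
    rcases (hu t ht).1 hn with rfl | rfl
    · exact ⟨j₁, u₁, hu₁, hd₁, hJ₁⟩
    · exact ⟨j₂, u₂, hu₂, hd₂, hJ₂⟩

theorem strandColored_iff_one (g : Fin k → ℝ → X) {i j : Fin k} {τ u : ℝ}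
    (h1 : T.start i < τ) (h2 : τ < T.finish i)
    (hu : ∀ t ∈ T.interval i, T.Under D i t ↔ t = τ) (hju : u ∈ T.interval j)
    (hd : IsDouble D.curve (T.comp i, τ) (T.comp j, u)) :
    T.StrandColored D g i ↔ ∀ t ∈ T.interval i, g i t =
      if t ≤ τ then g i (T.start i) else
        signAct (D.crossDet (T.comp j, u) (T.comp i, τ)) (g j u) (g i (T.start i)) := by
  classical
  -- A dummy second time with trivial jump.
  obtain ⟨τ₂, h12, h2'⟩ := exists_between h2
  let J : ℝ → X → X := fun t =>
    if t = τ then signAct (D.crossDet (T.comp j, u) (T.comp i, τ)) (g j u) else id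
  have hJ₁ : J τ = signAct (D.crossDet (T.comp j, u) (T.comp i, τ)) (g j u) := if_pos rfl
  have hJ (t : ℝ) (ht : t ≠ τ) : J t = id := if_neg ht
  rw [strandColored_iff_jump (J := J),
    forall_eq_step_two_iff h1 h12 h2' fun t _ ht _ => hJ t ht, hJ₁, hJ τ₂ h12.ne']
  · simp only [id, ite_self]
    rfl
  · intro t ht hn
    rw [hu t ht] at hn
    exact hJ t hn
  · intro t ht hn
    obtain rfl := (hu t ht).1 hn
    exact ⟨j, u, hju, hd, hJ₁⟩

theorem solves_const (h : ∀ i, ∀ t ∈ T.interval i, ¬ T.Under D i t) :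
    T.Solves (X := X) D fun a i _ => a i :=
  ⟨fun _ _ => rfl, fun g => forall_congr' fun i => strandColored_iff_const g (h i)⟩

end Strands

end Linkoid

/-! ### The first and second Reidemeister moves -/

namespace Linkoid

open Filter Topology

theorem nonneg_on_Icc {f : ℝ → ℝ} (hf : Continuous f) {a b : ℝ} (hab : a < b)
    (h : ∀ s ∈ Ioo a b, 0 < f s) {t : ℝ} (ht : t ∈ Icc a b) : 0 ≤ f t := by
  rw [← closure_Ioo hab.ne] at ht
  exact closure_minimal (t := f ⁻¹' Ici 0) (fun s hs => (h s hs).le)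
    (isClosed_Ici.preimage hf) ht

theorem nonpos_on_Icc {f : ℝ → ℝ} (hf : Continuous f) {a b : ℝ} (hab : a < b)
    (h : ∀ s ∈ Ioo a b, f s < 0) {t : ℝ} (ht : t ∈ Icc a b) : f t ≤ 0 :=
  neg_nonneg.1 (nonneg_on_Icc hf.neg hab (fun s hs => neg_pos.2 (h s hs)) ht)

/-- The moves are specified by positions only; this reads off the direction in which an axis is
crossed, and transversality later makes the inequality strict. -/
theorem deriv_nonneg_of_right {f : ℝ → ℝ} {f' a b : ℝ} (hf : HasDerivAt f f' a) (hab : a < b)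
    (ha : f a = 0) (h : ∀ s ∈ Ioo a b, 0 < f s) : 0 ≤ f' := by
  have h1 := (hasDerivWithinAt_iff_tendsto_slope' (s := Ioi a) (by simp)).1
    hf.hasDerivWithinAt
  refine ge_of_tendsto h1 ?_
  filter_upwards [Ioo_mem_nhdsGT hab] with s hs
  rw [slope_def_field, ha, sub_zero]
  exact div_nonneg (h s hs).le (sub_nonneg.2 hs.1.le)

theorem deriv_nonpos_of_right {f : ℝ → ℝ} {f' a b : ℝ} (hf : HasDerivAt f f' a) (hab : a < b)
    (ha : f a = 0) (h : ∀ s ∈ Ioo a b, f s < 0) : f' ≤ 0 :=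
  neg_nonneg.1 (deriv_nonneg_of_right hf.neg hab (by simp [ha]) fun s hs => neg_pos.2 (h s hs))

/-- By Darboux's theorem a derivative without zeros has constant sign `σ`. The ends have absolute
value one, so strict monotonicity forces the run from `-1` to `1` after multiplication by `σ`. -/
theorem exists_direction {r : ℝ → ℝ} {a b : ℝ} (hab : a < b) (hr : Differentiable ℝ r)
    (hd : ∀ t ∈ Ioo a b, deriv r t ≠ 0) (ha : |r a| = 1) (hb : |r b| = 1) :
    ∃ σ : ℝ, (σ = 1 ∨ σ = -1) ∧ (∀ t ∈ Ioo a b, 0 < σ * deriv r t) ∧ σ * r a = -1 ∧ σ * r b = 1 ∧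
      StrictMonoOn (fun t => σ * r t) (Icc a b) := by
  have key : ∃ σ : ℝ, (σ = 1 ∨ σ = -1) ∧ ∀ t ∈ Ioo a b, 0 < σ * deriv r t := by
    rcases hasDerivWithinAt_forall_lt_or_forall_gt_of_forall_ne (convex_Ioo a b)
      (fun t _ => (hr t).hasDerivAt.hasDerivWithinAt) hd with h | h
    · exact ⟨-1, Or.inr rfl, fun t ht => by linarith [h t ht]⟩
    · exact ⟨1, Or.inl rfl, fun t ht => by linarith [h t ht]⟩
  obtain ⟨σ, hσ, hpos⟩ := key
  have hmono : StrictMonoOn (fun t => σ * r t) (Icc a b) := by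
    refine strictMonoOn_of_deriv_pos (convex_Icc a b)
      (continuous_const.mul hr.continuous).continuousOn fun t ht => ?_
    rw [interior_Icc] at ht
    rw [deriv_const_mul_field']
    exact hpos t ht
  have hlt : σ * r a < σ * r b := hmono (left_mem_Icc.2 hab.le) (right_mem_Icc.2 hab.le) hab
  refine ⟨σ, hσ, hpos, ?_, ?_, hmono⟩ <;>
  · rcases (abs_eq zero_le_one).1 ha with h1 | h1 <;> rcases (abs_eq zero_le_one).1 hb with h2 | h2 <;>
    rcases hσ with rfl | rfl <;> rw [h1, h2] at hlt <;> norm_num at hlt <;> simp [h1, h2]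

namespace Strands

variable {n m k : ℕ} {T : Strands n m k} {D D' : Diagram n m}

theorem hasDerivAt_path (T : Strands n m k) (D : Diagram n m) (i : Fin k) (t : ℝ) :
    HasDerivAt (T.path D i) (deriv (D.curve (T.comp i)) t) t :=
  (((D.smooth (T.comp i)).differentiable (by simp)) t).hasDerivAt

theorem FillDisc.norm_lt (h : T.FillDisc D) {i : Fin k} {t : ℝ}
    (ht : t ∈ Ioo (T.start i) (T.finish i)) : ‖T.path D i t‖ < 1 := h.2 i t ht

/-- A strand on a diameter of the disc runs through it monotonically. The diameter is the zero set
of the coordinate `M`, and `L` is the coordinate along the diameter. -/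
theorem FillDisc.exists_diameter (h : T.FillDisc D) (L M : ℂ →L[ℝ] ℝ)
    (hLM : ∀ z, L z ^ 2 + M z ^ 2 = ‖z‖ ^ 2) {i : Fin k}
    (hM : ∀ t ∈ T.interval i, M (T.path D i t) = 0) :
    ∃ σ : ℝ, (σ = 1 ∨ σ = -1) ∧
      (∀ t ∈ Ioo (T.start i) (T.finish i), 0 < σ * L (deriv (D.curve (T.comp i)) t) ∧
        M (deriv (D.curve (T.comp i)) t) = 0) ∧
      StrictMonoOn (fun t => σ * L (T.path D i t)) (T.interval i) ∧
      InjOn (T.path D i) (T.interval i) ∧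
      ∀ z : ℂ, M z = 0 → ‖z‖ < 1 → ∃ t ∈ Ioo (T.start i) (T.finish i), T.path D i t = z := by
  have hL (t : ℝ) : HasDerivAt (fun t => L (T.path D i t)) (L (deriv (D.curve (T.comp i)) t)) t :=
    L.hasFDerivAt.comp_hasDerivAt t (hasDerivAt_path T D i t)
  have hM' (t : ℝ) : HasDerivAt (fun t => M (T.path D i t)) (M (deriv (D.curve (T.comp i)) t)) t :=
    M.hasFDerivAt.comp_hasDerivAt t (hasDerivAt_path T D i t)
  have habs (z : ℂ) (hz : M z = 0) : |L z| = ‖z‖ := by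
    have := hLM z
    rw [hz, zero_pow two_ne_zero, add_zero] at this
    rw [← abs_norm z]
    exact sq_eq_sq_iff_abs_eq_abs _ _ |>.1 this
  have hMd (t : ℝ) (ht : t ∈ Ioo (T.start i) (T.finish i)) :
      M (deriv (D.curve (T.comp i)) t) = 0 := by
    rw [← (hM' t).deriv]
    have : (fun t => M (T.path D i t)) =ᶠ[𝓝 t] fun _ => 0 := by
      filter_upwards [Ioo_mem_nhds ht.1 ht.2] with s hs using hM s (Ioo_subset_Icc_self hs)
    rw [this.deriv_eq, deriv_const]
  obtain ⟨σ, hσ, h1, h2, h3, h4⟩ := exists_direction (T.start_lt_finish i)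
    (fun t => (hL t).differentiableAt) (fun t ht => by
      rw [(hL t).deriv]
      intro h0
      -- The velocity has no component across the diameter, so immersion makes the component along
      -- it nonzero.
      have hne := D.immersed (T.comp i, t) (T.valid (Ioo_subset_Icc_self ht))
      have := hLM (deriv (D.curve (T.comp i)) t)
      rw [h0, hMd t ht] at this
      exact hne (norm_eq_zero.1 (pow_eq_zero_iff two_ne_zero |>.1 (by linarith))))
    (by rw [habs _ (hM _ (T.start_mem i)), h.norm_start i])
    (by rw [habs _ (hM _ (T.finish_mem i)), h.norm_finish i])
  have hσ0 : σ * σ = 1 := by rcases hσ with rfl | rfl <;> norm_num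
  refine ⟨σ, hσ, fun t ht => ⟨?_, hMd t ht⟩, h4, fun s hs t ht hst => ?_, fun z hz hz1 => ?_⟩
  · rw [← (hL t).deriv]
    exact h1 t ht
  · exact h4.injOn hs ht (by simp only [hst])
  · have hcont : Continuous fun t => σ * L (T.path D i t) :=
      continuous_const.mul (L.continuous.comp (continuous_path T D i))
    have hval : σ * L z ∈ Ioo (-1 : ℝ) 1 := by
      have : |σ * L z| < 1 := by
        rw [abs_mul, habs z hz]
        rcases hσ with rfl | rfl <;> simpa using hz1
      exact abs_lt.1 this
    have := intermediate_value_Ioo (T.start_lt_finish i).le hcont.continuousOn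
    rw [h2, h3] at this
    obtain ⟨t, ht, htz⟩ := this hval
    refine ⟨t, ht, ?_⟩
    have hLz : L (T.path D i t) = L z := by
      have h5 : σ * (σ * L (T.path D i t)) = σ * (σ * L z) := congrArg (σ * ·) htz
      rwa [← mul_assoc, ← mul_assoc, hσ0, one_mul, one_mul] at h5
    have h0 := hLM (T.path D i t - z)
    rw [map_sub, map_sub, hLz, hM t (Ioo_subset_Icc_self ht), hz] at h0
    exact sub_eq_zero.1 (norm_eq_zero.1 (pow_eq_zero_iff two_ne_zero |>.1 (by linarith)))

theorem reCLM_sq_add_imCLM_sq (z : ℂ) : Complex.reCLM z ^ 2 + Complex.imCLM z ^ 2 = ‖z‖ ^ 2 := by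
  rw [Complex.sq_norm, Complex.normSq_apply, Complex.reCLM_apply, Complex.imCLM_apply]
  ring

theorem imCLM_sq_add_reCLM_sq (z : ℂ) : Complex.imCLM z ^ 2 + Complex.reCLM z ^ 2 = ‖z‖ ^ 2 := by
  rw [add_comm, reCLM_sq_add_imCLM_sq]

variable {X : Type u} [Quandle X]

/-- Whichever passage comes first, the over-passing color equals the starting color, so the jump is
trivial by idempotence. -/
theorem solves_self_crossing {T : Strands n m 1} {τ v : ℝ}
    (hτ : τ ∈ Ioo (T.start 0) (T.finish 0)) (hv : v ∈ T.interval 0)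
    (hu : ∀ t ∈ T.interval 0, T.Under D 0 t ↔ t = τ)
    (hd : IsDouble D.curve (T.comp 0, τ) (T.comp 0, v)) :
    T.Solves (X := X) D fun a i _ => a i := by
  refine ⟨fun _ _ => rfl, fun g => ?_⟩
  rw [Fin.forall_fin_one, Fin.forall_fin_one, strandColored_iff_one g hτ.1 hτ.2 hu hv hd]
  set d := D.crossDet (T.comp 0, v) (T.comp 0, τ)
  constructor
  · intro h t ht
    have hgv : g 0 v = g 0 (T.start 0) := by
      have hv' := h v hv
      split_ifs at hv' with hvτ
      · exact hv'
      -- If the strand passes over after it has passed under, its color `b` there satisfies `signAct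
      -- d b a = b = signAct d b b`, hence `a = b`.
      · refine signAct_injective d (g 0 v) ?_
        rw [signAct_self]
        exact hv'
    rw [h t ht, hgv, signAct_self, ite_self]
  · intro h t ht
    rw [h t ht, h v hv, signAct_self, ite_self]

/-- The upper strand `h` keeps its color, so the lower strand `l` meets the same color twice with
opposite signs and leaves with the color it entered with. -/
theorem solves_two_crossings {T : Strands n m 2} {l h : Fin 2} (hlh : l ≠ h) {τ₁ τ₂ u₁ u₂ : ℝ}
    (hh : ∀ t ∈ T.interval h, ¬ T.Under D h t)
    (h1 : T.start l < τ₁) (h12 : τ₁ < τ₂) (h2 : τ₂ < T.finish l)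
    (hu : ∀ t ∈ T.interval l, T.Under D l t ↔ t = τ₁ ∨ t = τ₂)
    (hu₁ : u₁ ∈ T.interval h) (hu₂ : u₂ ∈ T.interval h)
    (hd₁ : IsDouble D.curve (T.comp l, τ₁) (T.comp h, u₁))
    (hd₂ : IsDouble D.curve (T.comp l, τ₂) (T.comp h, u₂))
    (hdet : D.crossDet (T.comp h, u₂) (T.comp l, τ₂) *
      D.crossDet (T.comp h, u₁) (T.comp l, τ₁) < 0) :
    ∃ S : (Fin 2 → X) → Fin 2 → ℝ → X, T.Solves D S ∧ ∀ a i, S a i (T.finish i) = a i := by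
  classical
  have hall (P : Fin 2 → Prop) : (∀ i, P i) ↔ P h ∧ P l := by
    rw [Fin.forall_fin_two]
    fin_cases l <;> fin_cases h
    · exact absurd rfl hlh
    · exact and_comm
    · rfl
    · exact absurd rfl hlh
  set d₁ := D.crossDet (T.comp h, u₁) (T.comp l, τ₁)
  set d₂ := D.crossDet (T.comp h, u₂) (T.comp l, τ₂)
  refine ⟨fun a i t => if i = h then a i else if t ≤ τ₁ then a i else if t ≤ τ₂ then
    signAct d₁ (a h) (a i) else a i, ⟨fun a i => ?_, fun g => ?_⟩, fun a i => ?_⟩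
  · revert i
    rw [hall]
    simp only [if_true, if_neg hlh, h1.le, and_self]
  · rw [hall, hall, strandColored_iff_const g hh,
      strandColored_iff_two g h1 h12 h2 hu hu₁ hu₂ hd₁ hd₂]
    simp only [if_true, if_neg hlh]
    refine and_congr_right fun hg => ?_
    rw [hg u₁ hu₁, hg u₂ hu₂, signAct_cancel hdet]
  · revert i
    rw [hall]
    simp only [if_true, if_neg hlh, h2.not_ge, (h12.trans h2).not_ge, if_false, and_self]

end Strands

/-! ### Invariance under the first two Reidemeister moves -/

namespace Diagram

variable {n m : ℕ} {D D' : Diagram n m}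

theorem ReidemeisterOne.sameColorings (h : ReidemeisterOne D D') : SameColorings.{u} D D' := by
  obtain ⟨T, hL, hinj, s, hs, t, ht, hst, hpath, huniq⟩ := h
  have hD' (r : ℝ) (hr : r ∈ T.interval 0) : ¬ T.Under D' 0 r := by
    intro hu
    obtain ⟨j, v, hv, hne, heq⟩ := hL.2.1.exists_of_under hr hu
    obtain rfl : j = 0 := Subsingleton.elim _ _
    exact hne ⟨rfl, hinj hr hv heq⟩
  -- A crossing formed by the two ends would also be present in `D'`, whose strand has the same ends
  -- and is simple.
  have hends : ¬ (s = T.start 0 ∧ t = T.finish 0) := by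
    rintro ⟨rfl, rfl⟩
    refine hst.ne (hinj hs ht ?_)
    rw [hL.path_start, hL.path_finish, hpath]
  -- Otherwise one passage would be on the unit circle and the other in the open disc.
  have hs0 : T.start 0 < s := by
    refine lt_of_le_of_ne hs.1 fun h => hends ⟨h.symm, ?_⟩
    by_contra hne
    have h1 := hL.1.norm_lt (i := 0) ⟨hs.1.trans_lt hst, lt_of_le_of_ne ht.2 hne⟩
    rw [← hpath, ← h, hL.1.norm_start] at h1
    exact lt_irrefl _ h1
  have ht1 : t < T.finish 0 := by
    refine lt_of_le_of_ne ht.2 fun h => ?_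
    have h1 := hL.1.norm_lt (i := 0) ⟨hs0, hst.trans_le ht.2⟩
    rw [hpath, h, hL.1.norm_finish] at h1
    exact lt_irrefl _ h1
  have hd : IsDouble D.curve (T.comp 0, s) (T.comp 0, t) :=
    (Strands.isDouble_iff hs ht).2 ⟨fun h => hst.ne h.2, hpath⟩
  have hcross (r : ℝ) (hr : r ∈ T.interval 0) (hu : T.Under D 0 r) : r = s ∨ r = t := by
    obtain ⟨j, v, hv, hne, heq⟩ := hL.1.exists_of_under hr hu
    obtain rfl : j = 0 := Subsingleton.elim _ _
    rcases lt_trichotomy r v with h | h | h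
    · exact Or.inl (huniq r hr v hv h heq).1
    · exact absurd ⟨rfl, h⟩ hne
    · exact Or.inr (huniq v hv r hr h heq.symm).2
  have key : ∃ τ ∈ Ioo (T.start 0) (T.finish 0), ∃ v ∈ T.interval 0,
      (∀ r ∈ T.interval 0, T.Under D 0 r ↔ r = τ) ∧
      IsDouble D.curve (T.comp 0, τ) (T.comp 0, v) := by
    by_cases hu : T.Under D 0 s
    · refine ⟨s, ⟨hs0, hst.trans ht1⟩, t, ht, fun r hr => ⟨fun hr' => ?_, fun h => h ▸ hu⟩, hd⟩
      refine (hcross r hr hr').resolve_right ?_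
      rintro rfl
      exact (D.under_iff _ _ hd).1 hu hr'
    · refine ⟨t, ⟨hs0.trans hst, ht1⟩, s, hs, fun r hr => ⟨fun hr' => ?_, fun h => ?_⟩, hd.symm⟩
      · refine (hcross r hr hr').resolve_left ?_
        rintro rfl
        exact hu hr'
      · rw [h]
        exact (D.under_iff _ _ hd.symm).2 hu
  obtain ⟨τ, hτ, v, hv, hu, hd'⟩ := key
  refine hL.sameColorings ?_ ?_ fun X _ => ⟨fun a i _ => a i, fun a i _ => a i,
    Strands.solves_self_crossing hτ hv hu hd', Strands.solves_const ?_, fun _ _ => rfl⟩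
  · rw [Fin.forall_fin_one, hu _ (T.finish_mem 0)]
    exact hτ.2.ne'
  · exact Fin.forall_fin_one.2 (hD' _ (T.finish_mem 0))
  · exact Fin.forall_fin_one.2 hD'

theorem crossDet_of_im_eq_zero {o p : Param n m} (h : (deriv (D.curve o.1) o.2).im = 0) :
    D.crossDet o p = (deriv (D.curve o.1) o.2).re * (deriv (D.curve p.1) p.2).im := by
  rw [crossDet, planeDet, h, zero_mul, sub_zero]

theorem ReidemeisterTwo.sameColorings (h : ReidemeisterTwo D D') : SameColorings.{u} D D' := by
  obtain ⟨T, hL, hreal, hinj, hinj', hup, t₁, t₂, h1, h12, h2, hsgn1, hsgn2, hsgn3, hunder⟩ := h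
  obtain ⟨σ, hσ, hderiv, -, hinj0, hsurj⟩ := hL.1.exists_diameter Complex.reCLM Complex.imCLM
    Strands.reCLM_sq_add_imCLM_sq (i := 0) fun t ht => (hreal t ht).1
  have him : Continuous fun t => (T.path D 1 t).im :=
    Complex.continuous_im.comp (Strands.continuous_path T D 1)
  have him' (t : ℝ) : HasDerivAt (fun t => (T.path D 1 t).im)
      (deriv (D.curve (T.comp 1)) t).im t :=
    Complex.imCLM.hasFDerivAt.comp_hasDerivAt t (Strands.hasDerivAt_path T D 1 t)
  have ht₁ : t₁ ∈ Ioo (T.start 1) (T.finish 1) := ⟨h1, h12.trans h2⟩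
  have ht₂ : t₂ ∈ Ioo (T.start 1) (T.finish 1) := ⟨h1.trans h12, h2⟩
  have ht₁' := Ioo_subset_Icc_self ht₁
  have ht₂' := Ioo_subset_Icc_self ht₂
  have hz₁ : (T.path D 1 t₁).im = 0 := le_antisymm
    (nonpos_on_Icc him h12 hsgn2 (left_mem_Icc.2 h12.le))
    (nonneg_on_Icc him h1 (fun s hs => hsgn1 s ⟨hs.1.le, hs.2⟩) (right_mem_Icc.2 h1.le))
  have hz₂ : (T.path D 1 t₂).im = 0 := le_antisymm
    (nonpos_on_Icc him h12 hsgn2 (right_mem_Icc.2 h12.le))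
    (nonneg_on_Icc him h2 (fun s hs => hsgn3 s ⟨hs.1, hs.2.le⟩) (left_mem_Icc.2 h2.le))
  have hzero (t : ℝ) (ht : t ∈ T.interval 1) (h0 : (T.path D 1 t).im = 0) : t = t₁ ∨ t = t₂ := by
    rcases lt_trichotomy t t₁ with h | h | h
    · exact absurd h0 (hsgn1 t ⟨ht.1, h⟩).ne'
    · exact Or.inl h
    rcases lt_trichotomy t t₂ with h' | h' | h'
    · exact absurd h0 (hsgn2 t ⟨h, h'⟩).ne
    · exact Or.inr h'
    · exact absurd h0 (hsgn3 t ⟨h', ht.2⟩).ne'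
  -- The diameter covers every real point of the open disc, so each zero of the imaginary part is a
  -- crossing.
  obtain ⟨u₁, hu₁, he₁⟩ := hsurj _ hz₁ (hL.1.norm_lt ht₁)
  obtain ⟨u₂, hu₂, he₂⟩ := hsurj _ hz₂ (hL.1.norm_lt ht₂)
  have hu₁' : u₁ ∈ T.interval 0 := Ioo_subset_Icc_self hu₁
  have hu₂' : u₂ ∈ T.interval 0 := Ioo_subset_Icc_self hu₂
  have hu12 : u₁ ≠ u₂ := by
    rintro rfl
    exact h12.ne (hinj ht₁' ht₂' (he₁.symm.trans he₂))
  have hd₁ : IsDouble D.curve (T.comp 1, t₁) (T.comp 0, u₁) :=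
    (Strands.isDouble_iff ht₁' hu₁').2 ⟨fun h => by simp at h, he₁.symm⟩
  have hd₂ : IsDouble D.curve (T.comp 1, t₂) (T.comp 0, u₂) :=
    (Strands.isDouble_iff ht₂' hu₂').2 ⟨fun h => by simp at h, he₂.symm⟩
  have hcross1 (t : ℝ) (ht : t ∈ T.interval 1) (hu : T.Under D 1 t) : t = t₁ ∨ t = t₂ := by
    obtain ⟨j, v, hv, hne, heq⟩ := hL.1.exists_of_under ht hu
    fin_cases j
    · refine hzero t ht ?_
      rw [heq]
      exact (hreal v hv).1
    · exact absurd ⟨rfl, hinj ht hv heq⟩ hne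
  have hcross0 (t : ℝ) (ht : t ∈ T.interval 0) (hu : T.Under D 0 t) : t = u₁ ∨ t = u₂ := by
    obtain ⟨j, v, hv, hne, heq⟩ := hL.1.exists_of_under ht hu
    fin_cases j
    · exact absurd ⟨rfl, hinj0 ht hv heq⟩ hne
    · have h0 : (T.path D 1 v).im = 0 := by
        rw [← (hreal t ht).1]
        exact congrArg Complex.im heq.symm
      rcases hzero v hv h0 with rfl | rfl
      · exact Or.inl (hinj0 ht hu₁' (heq.trans he₁.symm))
      · exact Or.inr (hinj0 ht hu₂' (heq.trans he₂.symm))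
  have hD' : ∀ i, ∀ t ∈ T.interval i, ¬ T.Under D' i t := by
    intro i t ht hu
    obtain ⟨j, v, hv, hne, heq⟩ := hL.2.1.exists_of_under ht hu
    have h0 (x : ℝ) (hx : x ∈ T.interval 0) : (T.path D' 0 x).im = 0 := by
      rw [(hreal x hx).2]
      exact (hreal x hx).1
    fin_cases i <;> fin_cases j
    · refine hne ⟨rfl, hinj0 ht hv ?_⟩
      rw [← (hreal t ht).2, ← (hreal v hv).2]
      exact heq
    · refine (hup v hv).ne' ?_
      rw [← h0 t ht]
      exact congrArg Complex.im heq.symm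
    · refine (hup t ht).ne' ?_
      rw [← h0 v hv]
      exact congrArg Complex.im heq
    · exact hne ⟨rfl, hinj' ht hv heq⟩
  -- Strand `1` crosses downwards at `t₁` and upwards at `t₂`, while strand `0` keeps its direction
  -- `σ`, so the two signs are opposite.
  have hdet : D.crossDet (T.comp 0, u₁) (T.comp 1, t₁) *
      D.crossDet (T.comp 0, u₂) (T.comp 1, t₂) < 0 := by
    have hn₁ := D.transverse _ _ hd₁.symm
    have hn₂ := D.transverse _ _ hd₂.symm
    change D.crossDet (T.comp 0, u₁) (T.comp 1, t₁) ≠ 0 at hn₁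
    change D.crossDet (T.comp 0, u₂) (T.comp 1, t₂) ≠ 0 at hn₂
    rw [crossDet_of_im_eq_zero (D := D) (o := (T.comp 0, u₁)) (p := (T.comp 1, t₁))
      (hderiv u₁ hu₁).2] at hn₁ ⊢
    rw [crossDet_of_im_eq_zero (D := D) (o := (T.comp 0, u₂)) (p := (T.comp 1, t₂))
      (hderiv u₂ hu₂).2] at hn₂ ⊢
    have hi₁ : (deriv (D.curve (T.comp 1)) t₁).im < 0 :=
      lt_of_le_of_ne (deriv_nonpos_of_right (him' t₁) h12 hz₁ hsgn2) (right_ne_zero_of_mul hn₁)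
    have hi₂ : 0 < (deriv (D.curve (T.comp 1)) t₂).im :=
      lt_of_le_of_ne (deriv_nonneg_of_right (him' t₂) h2 hz₂
        fun s hs => hsgn3 s ⟨hs.1, hs.2.le⟩) (right_ne_zero_of_mul hn₂).symm
    have hr₁ : 0 < σ * (deriv (D.curve (T.comp 0)) u₁).re := (hderiv u₁ hu₁).1
    have hr₂ : 0 < σ * (deriv (D.curve (T.comp 0)) u₂).re := (hderiv u₂ hu₂).1
    have hσ0 : σ * σ = 1 := by rcases hσ with rfl | rfl <;> norm_num
    calc _ = (σ * (deriv (D.curve (T.comp 0)) u₁).re * (σ * (deriv (D.curve (T.comp 0)) u₂).re)) *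
          ((deriv (D.curve (T.comp 1)) t₁).im * (deriv (D.curve (T.comp 1)) t₂).im) := by
          linear_combination (-((deriv (D.curve (T.comp 0)) u₁).re *
            (deriv (D.curve (T.comp 0)) u₂).re * (deriv (D.curve (T.comp 1)) t₁).im *
            (deriv (D.curve (T.comp 1)) t₂).im)) * hσ0
      _ < 0 := mul_neg_of_pos_of_neg (mul_pos hr₁ hr₂) (mul_neg_of_neg_of_pos hi₁ hi₂)
  refine hL.sameColorings ?_ (fun i => hD' i _ (T.finish_mem i)) fun X _ => ?_
  · rw [Fin.forall_fin_two]
    refine ⟨fun hu => ?_, fun hu => ?_⟩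
    · rcases hcross0 _ (T.finish_mem 0) hu with h | h
      · exact hu₁.2.ne' h
      · exact hu₂.2.ne' h
    · rcases hcross1 _ (T.finish_mem 1) hu with h | h
      · exact ht₁.2.ne' h
      · exact ht₂.2.ne' h
  have key : ∃ S : (Fin 2 → X) → Fin 2 → ℝ → X,
      T.Solves D S ∧ ∀ a i, S a i (T.finish i) = a i := by
    by_cases hu : T.Under D 1 t₁
    · have hu' := hunder.1 hu
      refine Strands.solves_two_crossings (l := 1) (h := 0) (by simp) (fun t ht hut => ?_) h1 h12 h2
        (fun t ht => ⟨hcross1 t ht, ?_⟩) hu₁' hu₂' hd₁ hd₂ (by rwa [mul_comm])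
      · rcases hcross0 t ht hut with rfl | rfl
        · exact (D.under_iff _ _ hd₁).1 hu hut
        · exact (D.under_iff _ _ hd₂).1 hu' hut
      · rintro (rfl | rfl)
        exacts [hu, hu']
    · have hu' : ¬ T.Under D 1 t₂ := fun h => hu (hunder.2 h)
      have hv₁ : T.Under D 0 u₁ := (D.under_iff _ _ hd₁.symm).2 hu
      have hv₂ : T.Under D 0 u₂ := (D.under_iff _ _ hd₂.symm).2 hu'
      have hnot : ∀ t ∈ T.interval 1, ¬ T.Under D 1 t := by
        intro t ht hut
        rcases hcross1 t ht hut with rfl | rfl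
        exacts [hu hut, hu' hut]
      have hdet' : D.crossDet (T.comp 1, t₁) (T.comp 0, u₁) *
          D.crossDet (T.comp 1, t₂) (T.comp 0, u₂) < 0 := by
        rwa [D.crossDet_swap (T.comp 0, u₁), D.crossDet_swap (T.comp 0, u₂), neg_mul_neg]
      -- Strand `0` is now the lower one; since its direction and the path of strand `1` are free,
      -- it may meet the two crossings in either order.
      rcases hu12.lt_or_gt with hlt | hlt
      · refine Strands.solves_two_crossings (l := 0) (h := 1) (by simp) hnot hu₁.1 hlt hu₂.2
          (fun t ht => ⟨hcross0 t ht, ?_⟩) ht₁' ht₂' hd₁.symm hd₂.symm (by rwa [mul_comm])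
        rintro (rfl | rfl)
        exacts [hv₁, hv₂]
      · refine Strands.solves_two_crossings (l := 0) (h := 1) (by simp) hnot hu₂.1 hlt hu₁.2
          (fun t ht => ⟨fun h => (hcross0 t ht h).symm, ?_⟩) ht₂' ht₁' hd₂.symm hd₁.symm hdet'
        rintro (rfl | rfl)
        exacts [hv₂, hv₁]
  obtain ⟨S, hS, hfin⟩ := key
  exact ⟨S, fun a i _ => a i, hS, Strands.solves_const hD', hfin⟩

end Diagram

end Linkoid

/-! ### The third Reidemeister move -/

namespace Linkoid

open Filter Topology

/-! ### Combinatorics of three pairwise crossing strands -/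

namespace Strands

variable {n m : ℕ}

/-- The strands `i` and `j` cross exactly once, at the times `s` and `t`, with the sign of `d`, and
the heights determine which one passes under. -/
structure Crossing (T : Strands n m 3) (D : Diagram n m) (height : Fin 3 → ℤ) (i j : Fin 3)
    (s t d : ℝ) : Prop where
  mem_left : s ∈ Ioo (T.start i) (T.finish i)
  mem_right : t ∈ Ioo (T.start j) (T.finish j)
  path_eq : T.path D i s = T.path D j t
  unique : ∀ s' ∈ T.interval i, ∀ t' ∈ T.interval j, T.path D i s' = T.path D j t' →
    s' = s ∧ t' = t
  under_iff : T.Under D i s ↔ height i < height j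
  sign : 0 < D.crossDet (T.comp i, s) (T.comp j, t) * d

/-- Three simple strands that cross pairwise: strand `i` crosses strand `j` at time `τ i j`. -/
structure Triangle (T : Strands n m 3) (D : Diagram n m) (height : Fin 3 → ℤ)
    (τ d : Matrix (Fin 3) (Fin 3) ℝ) : Prop where
  fill : T.FillDisc D
  injOn : ∀ i, InjOn (T.path D i) (T.interval i)
  crossing : ∀ i j, i ≠ j → T.Crossing D height i j (τ i j) (τ j i) (d i j)

variable {T : Strands n m 3} {D D' : Diagram n m} {height : Fin 3 → ℤ}

theorem Crossing.isDouble {i j : Fin 3} {s t d : ℝ} (h : T.Crossing D height i j s t d)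
    (hij : i ≠ j) : IsDouble D.curve (T.comp i, s) (T.comp j, t) :=
  (isDouble_iff (Ioo_subset_Icc_self h.mem_left) (Ioo_subset_Icc_self h.mem_right)).2
    ⟨fun h' => hij h'.1, h.path_eq⟩

theorem Crossing.symm {i j : Fin 3} {s t d : ℝ} (h : T.Crossing D height i j s t d) (hij : i ≠ j)
    (hh : height i ≠ height j) : T.Crossing D height j i t s (-d) where
  mem_left := h.mem_right
  mem_right := h.mem_left
  path_eq := h.path_eq.symm
  unique s' hs t' ht he := (h.unique t' ht s' hs he.symm).symm
  under_iff := by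
    rw [Under, D.under_iff _ _ (h.isDouble hij).symm, ← Under, h.under_iff, not_lt]
    exact ⟨fun h' => lt_of_le_of_ne h' hh.symm, le_of_lt⟩
  sign := by
    rw [D.crossDet_swap, neg_mul_neg]
    exact h.sign

namespace Triangle

variable {τ d : Matrix (Fin 3) (Fin 3) ℝ}

theorem under (h : T.Triangle D height τ d) {i : Fin 3} {t : ℝ} (ht : t ∈ T.interval i)
    (hu : T.Under D i t) : ∃ j, i ≠ j ∧ t = τ i j ∧ height i < height j := by
  obtain ⟨j, v, hv, hne, he⟩ := h.fill.exists_of_under ht hu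
  by_cases hij : i = j
  · subst hij
    exact absurd ⟨rfl, h.injOn i ht hv he⟩ hne
  · have hc := h.crossing i j hij
    obtain ⟨rfl, -⟩ := hc.unique t ht v hv he
    exact ⟨j, hij, rfl, hc.under_iff.1 hu⟩

theorem not_under_finish (h : T.Triangle D height τ d) (i : Fin 3) :
    ¬ T.Under D i (T.finish i) := by
  intro hu
  obtain ⟨j, hij, he, -⟩ := h.under (T.finish_mem i) hu
  exact (h.crossing i j hij).mem_left.2.ne' he

theorem mem_interval (h : T.Triangle D height τ d) {i j : Fin 3} (hij : i ≠ j) :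
    τ i j ∈ T.interval i := Ioo_subset_Icc_self (h.crossing i j hij).mem_left

end Triangle

variable {X : Type u} [Quandle X]

theorem Triangle.signAct_eq {τ d : Matrix (Fin 3) (Fin 3) ℝ} (h : T.Triangle D height τ d)
    {i j : Fin 3} (hij : i ≠ j) (b a : X) :
    signAct (D.crossDet (T.comp i, τ i j) (T.comp j, τ j i)) b a = signAct (d i j) b a :=
  signAct_congr (pos_iff_pos_of_mul_pos (h.crossing i j hij).sign) b a

/-- The color of the middle strand `y`, which passes under the highest strand `x`. -/
noncomputable def middleColor (τ d : Matrix (Fin 3) (Fin 3) ℝ) (x y : Fin 3) (a : Fin 3 → X)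
    (t : ℝ) : X :=
  if t ≤ τ y x then a y else signAct (d x y) (a x) (a y)

/-- The color of a strand that passes at time `s` under a strand of color `b` with sign `d` and
later at time `s'` under a strand of color `b'` with sign `d'`. -/
noncomputable def stepColor (s s' d d' : ℝ) (b b' c : X) (t : ℝ) : X :=
  if t ≤ s then c else if t ≤ s' then signAct d b c else signAct d' b' (signAct d b c)

open Classical in
/-- The colors of three strands, `x` above `y` above `z`, that cross pairwise, given their colors at
the start. -/
noncomputable def triangleColor (τ d : Matrix (Fin 3) (Fin 3) ℝ) (x y z : Fin 3) (a : Fin 3 → X)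
    (i : Fin 3) (t : ℝ) : X :=
  if i = x then a i else if i = y then middleColor τ d x y a t else
  if τ z x < τ z y then
    stepColor (τ z x) (τ z y) (d x z) (d y z) (a x) (middleColor τ d x y a (τ y z)) (a z) t
  else stepColor (τ z y) (τ z x) (d y z) (d x z) (middleColor τ d x y a (τ y z)) (a x) (a z) t

/-- The colors are found from the top down: `x` is constant, `y` jumps once under `x`, and then `z`
jumps under two strands whose colors are already known. -/
theorem Triangle.solves {τ d : Matrix (Fin 3) (Fin 3) ℝ} (h : T.Triangle D height τ d)
    {x y z : Fin 3} (hxy : height y < height x) (hyz : height z < height y)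
    (hall : ∀ i, i = x ∨ i = y ∨ i = z) (hne : τ z x ≠ τ z y) :
    T.Solves (X := X) D (triangleColor τ d x y z) := by
  have nyx : y ≠ x := fun h => hxy.ne (congrArg height h)
  have nzy : z ≠ y := fun h => hyz.ne (congrArg height h)
  have nzx : z ≠ x := fun h => (hyz.trans hxy).ne (congrArg height h)
  have hforall (P : Fin 3 → Prop) : (∀ i, P i) ↔ P x ∧ P y ∧ P z := by
    refine ⟨fun h => ⟨h x, h y, h z⟩, fun ⟨h1, h2, h3⟩ i => ?_⟩
    rcases hall i with rfl | rfl | rfl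
    exacts [h1, h2, h3]
  have cyx := h.crossing y x nyx
  have czx := h.crossing z x nzx
  have czy := h.crossing z y nzy
  have ux : ∀ t ∈ T.interval x, ¬ T.Under D x t := by
    intro t ht hu
    obtain ⟨j, hj, -, hlt⟩ := h.under ht hu
    rcases hall j with rfl | rfl | rfl
    · exact hj rfl
    · exact hlt.asymm hxy
    · exact hlt.asymm (hyz.trans hxy)
  have uy : ∀ t ∈ T.interval y, T.Under D y t ↔ t = τ y x := by
    refine fun t ht => ⟨fun hu => ?_, fun he => he ▸ cyx.under_iff.2 hxy⟩
    obtain ⟨j, hj, he, hlt⟩ := h.under ht hu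
    rcases hall j with rfl | rfl | rfl
    · exact he
    · exact absurd rfl hj
    · exact absurd hlt hyz.not_gt
  have uz : ∀ t ∈ T.interval z, T.Under D z t ↔ t = τ z x ∨ t = τ z y := by
    refine fun t ht => ⟨fun hu => ?_, ?_⟩
    · obtain ⟨j, hj, he, hlt⟩ := h.under ht hu
      rcases hall j with rfl | rfl | rfl
      · exact Or.inl he
      · exact Or.inr he
      · exact absurd rfl hj
    · rintro (rfl | rfl)
      exacts [czx.under_iff.2 (hyz.trans hxy), czy.under_iff.2 hyz]
  have mxy := h.mem_interval nyx.symm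
  have mxz := h.mem_interval nzx.symm
  have myz := h.mem_interval nzy.symm
  refine ⟨fun a => (hforall _).2 ⟨if_pos rfl, ?_, ?_⟩, fun g => ?_⟩
  · rw [triangleColor, if_neg nyx, if_pos rfl, middleColor, if_pos cyx.mem_left.1.le]
  · rw [triangleColor, if_neg nzx, if_neg nzy, stepColor, stepColor, if_pos czx.mem_left.1.le,
      if_pos czy.mem_left.1.le, ite_self]
  have hz : T.StrandColored D g z ↔ ∀ t ∈ T.interval z, g z t = if τ z x < τ z y then
      stepColor (τ z x) (τ z y) (d x z) (d y z) (g x (τ x z)) (g y (τ y z)) (g z (T.start z)) t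
      else
      stepColor (τ z y) (τ z x) (d y z) (d x z) (g y (τ y z)) (g x (τ x z)) (g z (T.start z)) t := by
    split_ifs with hlt
    · rw [strandColored_iff_two g czx.mem_left.1 hlt czy.mem_left.2 uz mxz myz
        (czx.isDouble nzx) (czy.isDouble nzy)]
      simp only [h.signAct_eq nzx.symm, h.signAct_eq nzy.symm]
      rfl
    · rw [strandColored_iff_two g czy.mem_left.1 (lt_of_le_of_ne (not_lt.1 hlt) hne.symm)
        czx.mem_left.2 (fun t ht => (uz t ht).trans or_comm) myz mxz
        (czy.isDouble nzy) (czx.isDouble nzx)]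
      simp only [h.signAct_eq nzx.symm, h.signAct_eq nzy.symm]
      rfl
  have hSx (a : Fin 3 → X) (t : ℝ) : triangleColor τ d x y z a x t = a x := if_pos rfl
  have hSy (a : Fin 3 → X) (t : ℝ) : triangleColor τ d x y z a y t = middleColor τ d x y a t := by
    rw [triangleColor, if_neg nyx, if_pos rfl]
  rw [hforall, hforall, strandColored_iff_const g ux,
    strandColored_iff_one g cyx.mem_left.1 cyx.mem_left.2 uy mxy (cyx.isDouble nyx), hz]
  simp only [hSx, hSy, h.signAct_eq nyx.symm]
  refine and_congr_right fun hx => ?_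
  rw [hx _ mxy, hx _ mxz]
  refine and_congr_right fun hy => ?_
  rw [hy _ myz]
  simp only [triangleColor, if_neg nzx, if_neg nzy]
  rfl

/-- Only the lowest strand needs an argument. The move swaps its two crossings and also exchanges
the colors of `y` before and after passing under `x`. By `signAct_distrib` the action of `x` moves
past that of `y` and acts on the color of `y` as well. By `hsign` this action either equals the jump
of `y` under `x`, which creates the later color of `y`, or is inverse to it and cancels it. -/
theorem triangleColor_finish {τ τ' d : Matrix (Fin 3) (Fin 3) ℝ} (h : T.Triangle D height τ d)
    (h' : T.Triangle D' height τ' d) {x y z : Fin 3} (nyx : y ≠ x) (nzy : z ≠ y) (nzx : z ≠ x)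
    (hall : ∀ i, i = x ∨ i = y ∨ i = z) (hy : τ y x ≠ τ y z)
    (hflip_y : τ' y z < τ' y x ↔ τ y x < τ y z) (hflip_z : τ' z x < τ' z y ↔ ¬ τ z x < τ z y)
    (hsign : 0 < d x y * d x z ↔ (τ y x < τ y z ↔ τ z x < τ z y)) (hd : d x y * d x z ≠ 0)
    (a : Fin 3 → X) (i : Fin 3) :
    triangleColor τ d x y z a i (T.finish i) = triangleColor τ' d x y z a i (T.finish i) := by
  have hfin (j j' : Fin 3) (hj : j ≠ j') : ¬ T.finish j ≤ τ j j' :=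
    (h.crossing j j' hj).mem_left.2.not_ge
  have hfin' (j j' : Fin 3) (hj : j ≠ j') : ¬ T.finish j ≤ τ' j j' :=
    (h'.crossing j j' hj).mem_left.2.not_ge
  rcases hall i with rfl | rfl | rfl
  · simp only [triangleColor, if_true]
  · simp only [triangleColor, if_neg nyx, if_true, middleColor, if_neg (hfin _ _ nyx),
      if_neg (hfin' _ _ nyx)]
  have hle : τ y i ≤ τ y x ↔ ¬ τ y x < τ y i := not_lt.symm
  -- Equality is impossible: `x`, `y` and `z` would meet in a triple point.
  have hle' : τ' y i ≤ τ' y x ↔ τ y x < τ y i := by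
    rw [← hflip_y, le_iff_lt_or_eq, or_iff_left]
    intro he
    have hcr := h'.crossing y i nzy.symm
    have hcr' := h'.crossing y x nyx
    have hp : T.path D' i (τ' i y) = T.path D' x (τ' x y) := by
      rw [← hcr.path_eq, he, hcr'.path_eq]
    have h1 := (h'.crossing i x nzx).unique _ (h'.mem_interval nzy) _
      (h'.mem_interval nyx.symm) hp
    have h2 := (h'.crossing y x nyx).isDouble nyx
    have h3 := (h'.crossing y i nzy.symm).isDouble nzy.symm
    rw [he] at h3
    exact nzx (T.eq_of_samePoint (h'.mem_interval nzy) (h'.mem_interval nyx.symm)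
      (D'.no_triple _ _ _ h3 h2)).1
  simp only [triangleColor, if_neg nzx, if_neg nzy, hflip_z, stepColor, if_neg (hfin _ _ nzx),
    if_neg (hfin _ _ nzy), if_neg (hfin' _ _ nzx), if_neg (hfin' _ _ nzy), middleColor, hle, hle']
  have hcomm (hs : 0 < d x y * d x i) (b c : X) : signAct (d x i) b c = signAct (d x y) b c :=
    signAct_congr (pos_iff_pos_of_mul_pos (by rwa [mul_comm])) b c
  have hcancel (hs : ¬ 0 < d x y * d x i) (b c : X) :
      signAct (d x i) b (signAct (d x y) b c) = c :=
    signAct_cancel (by rw [mul_comm]; exact lt_of_le_of_ne (not_lt.1 hs) hd) b c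
  by_cases hp : τ y x < τ y i <;> by_cases hq : τ i x < τ i y <;>
    simp only [hp, hq, if_true, if_false, not_true, not_false_iff]
  · rw [signAct_distrib (d x i), hcomm (hsign.2 (iff_of_true hp hq)) (a x) (a y)]
  · rw [signAct_distrib (d x i), hcancel fun hs => hq ((hsign.1 hs).1 hp)]
  · rw [signAct_distrib (d x i), hcancel fun hs => hp ((hsign.1 hs).2 hq)]
  · rw [signAct_distrib (d x i), hcomm (hsign.2 (iff_of_false hp hq)) (a x) (a y)]

theorem exists_sorted (height : Fin 3 → ℤ) (hh : Function.Injective height) :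
    ∃ x y z : Fin 3, height y < height x ∧ height z < height y ∧ ∀ i, i = x ∨ i = y ∨ i = z := by
  have h01 : height 0 ≠ height 1 := fun h => by simpa using hh h
  have h02 : height 0 ≠ height 2 := fun h => by simpa using hh h
  have h12 : height 1 ≠ height 2 := fun h => by simpa using hh h
  rcases h01.lt_or_gt with a | a <;> rcases h02.lt_or_gt with b | b <;>
    rcases h12.lt_or_gt with c | c
  · exact ⟨2, 1, 0, c, a, by decide⟩
  · exact ⟨1, 2, 0, c, b, by decide⟩
  · omega
  · exact ⟨1, 0, 2, a, b, by decide⟩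
  · exact ⟨2, 0, 1, b, a, by decide⟩
  · omega
  · exact ⟨0, 2, 1, b, c, by decide⟩
  · exact ⟨0, 1, 2, a, c, by decide⟩

/-- The order of the crossings on the strands: `e i j < e i k` if strand `i` first crosses `j` and
then `k`. The strands `0` and `1` have the directions `p` and `q`. -/
def crossingOrder (p q : ℝ) : Matrix (Fin 3) (Fin 3) ℝ := !![0, 0, p; 0, 0, q; 0, 1, 0]

/-- The signs of the crossings of three strands with the directions `p` and `q` of the strands `0`
and `1`. -/
def crossingSign (p q : ℝ) : Matrix (Fin 3) (Fin 3) ℝ :=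
  !![0, p * q, p; -(p * q), 0, q; -p, -q, 0]

theorem crossingSign_ne_zero {p q : ℝ} (hp : p = 1 ∨ p = -1) (hq : q = 1 ∨ q = -1) {i j : Fin 3}
    (h : i ≠ j) : crossingSign p q i j ≠ 0 := by
  rcases hp with rfl | rfl <;> rcases hq with rfl | rfl <;> fin_cases i <;> fin_cases j <;>
    first | exact absurd rfl h | norm_num [crossingSign]

theorem crossingOrder_ne {p q : ℝ} (hp : p = 1 ∨ p = -1) (hq : q = 1 ∨ q = -1) {i j k : Fin 3}
    (hij : i ≠ j) (hik : i ≠ k) (hjk : j ≠ k) : crossingOrder p q i j ≠ crossingOrder p q i k := by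
  rcases hp with rfl | rfl <;> rcases hq with rfl | rfl <;> fin_cases i <;> fin_cases j <;>
    fin_cases k <;>
    first | exact absurd rfl hij | exact absurd rfl hik | exact absurd rfl hjk |
      norm_num [crossingOrder]

/-- The orientation fact behind the third move: a strand meets the other two with equal signs
exactly when both or neither of them meet it before meeting each other. It is a finite check over
directions and labels. -/
theorem crossingSign_iff {p q : ℝ} (hp : p = 1 ∨ p = -1) (hq : q = 1 ∨ q = -1) {i j k : Fin 3}
    (hij : i ≠ j) (hik : i ≠ k) (hjk : j ≠ k) :
    0 < crossingSign p q i j * crossingSign p q i k ↔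
      (crossingOrder p q j i < crossingOrder p q j k ↔
        crossingOrder p q k i < crossingOrder p q k j) := by
  rcases hp with rfl | rfl <;> rcases hq with rfl | rfl <;> fin_cases i <;> fin_cases j <;>
    fin_cases k <;>
    first | exact absurd rfl hij | exact absurd rfl hik | exact absurd rfl hjk |
      norm_num [crossingOrder, crossingSign]

/-- The height order of the labels `0`, `1`, `2` is arbitrary, so they are sorted into `x`, `y`,
`z`; the order and sign tables are symmetric enough to serve every sorting. -/
theorem LocalChange.sameColorings_of_triangle (hL : T.LocalChange D D')
    (hh : Function.Injective height) {τ τ' : Matrix (Fin 3) (Fin 3) ℝ} {p q : ℝ}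
    (hp : p = 1 ∨ p = -1) (hq : q = 1 ∨ q = -1)
    (h : T.Triangle D height τ (crossingSign p q)) (h' : T.Triangle D' height τ' (crossingSign p q))
    (ho : ∀ i j k, i ≠ j → i ≠ k → j ≠ k →
      (τ i j < τ i k ↔ crossingOrder p q i j < crossingOrder p q i k))
    (ho' : ∀ i j k, i ≠ j → i ≠ k → j ≠ k →
      (τ' i j < τ' i k ↔ crossingOrder p q i k < crossingOrder p q i j)) :
    Diagram.SameColorings.{u} D D' := by
  obtain ⟨x, y, z, hxy, hyz, hall⟩ := exists_sorted height hh
  have nyx : y ≠ x := fun h => hxy.ne (congrArg height h)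
  have nzy : z ≠ y := fun h => hyz.ne (congrArg height h)
  have nzx : z ≠ x := fun h => (hyz.trans hxy).ne (congrArg height h)
  have hne {i j k : Fin 3} (hij : i ≠ j) (hik : i ≠ k) (hjk : j ≠ k) : τ i j ≠ τ i k := by
    intro he
    rcases (crossingOrder_ne hp hq hij hik hjk).lt_or_gt with hlt | hlt
    · exact he.not_lt ((ho i j k hij hik hjk).2 hlt)
    · exact he.not_gt ((ho i k j hik hij hjk.symm).2 hlt)
  have hne' {i j k : Fin 3} (hij : i ≠ j) (hik : i ≠ k) (hjk : j ≠ k) : τ' i j ≠ τ' i k := by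
    intro he
    rcases (crossingOrder_ne hp hq hij hik hjk).lt_or_gt with hlt | hlt
    · exact he.not_gt ((ho' i k j hik hij hjk.symm).2 hlt)
    · exact he.not_lt ((ho' i j k hij hik hjk).2 hlt)
  refine hL.sameColorings h.not_under_finish h'.not_under_finish fun X _ =>
    ⟨_, _, h.solves hxy hyz hall (hne nzx nzy nyx.symm),
      h'.solves hxy hyz hall (hne' nzx nzy nyx.symm),
      triangleColor_finish h h' nyx nzy nzx hall (hne nyx nzy.symm nzx.symm) ?_ ?_ ?_
        (mul_ne_zero (crossingSign_ne_zero hp hq nyx.symm) (crossingSign_ne_zero hp hq nzx.symm))⟩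
  · rw [ho' y z x nzy.symm nyx nzx, ho y x z nyx nzy.symm nzx.symm]
  · rw [ho' z x y nzx nzy nyx.symm, ho z x y nzx nzy nyx.symm, not_lt, le_iff_lt_or_eq,
      or_iff_left (crossingOrder_ne hp hq nzy nzx nyx)]
  · rw [ho y x z nyx nzy.symm nzx.symm, ho z x y nzx nzy nyx.symm]
    exact crossingSign_iff hp hq nyx.symm nzx.symm nzy.symm

end Strands

end Linkoid

/-! ### Geometry of the third Reidemeister move -/

namespace Linkoid

open Filter Topology

namespace Strands

variable {n m : ℕ} {T : Strands n m 3} {D D' : Diagram n m} {height : Fin 3 → ℤ}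

theorem hasDerivAt_re (T : Strands n m 3) (D : Diagram n m) (i : Fin 3) (t : ℝ) :
    HasDerivAt (fun t => (T.path D i t).re) (deriv (D.curve (T.comp i)) t).re t :=
  Complex.reCLM.hasFDerivAt.comp_hasDerivAt t (hasDerivAt_path T D i t)

theorem hasDerivAt_im (T : Strands n m 3) (D : Diagram n m) (i : Fin 3) (t : ℝ) :
    HasDerivAt (fun t => (T.path D i t).im) (deriv (D.curve (T.comp i)) t).im t :=
  Complex.imCLM.hasFDerivAt.comp_hasDerivAt t (hasDerivAt_path T D i t)

/-- Strand `0` is the real and strand `1` the imaginary diameter; strand `2` crosses the real axis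
only at time `a`, upwards, and the imaginary axis only at time `b`, to the left. It passes through
the first quadrant between these times if `ε = 1` and through the third one if `ε = -1`. -/
structure CrossesAxes (T : Strands n m 3) (D : Diagram n m) (height : Fin 3 → ℤ) (ε t₀ a b : ℝ) :
    Prop where
  fill : T.FillDisc D
  real : ∀ t ∈ T.interval 0, (T.path D 0 t).im = 0
  imag : ∀ t ∈ T.interval 1, (T.path D 1 t).re = 0
  inj : InjOn (T.path D 2) (T.interval 2)
  sign_eq : ε = 1 ∨ ε = -1
  mem_center : t₀ ∈ T.interval 0
  center : T.path D 0 t₀ = 0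
  under_center : T.Under D 0 t₀ ↔ height 0 < height 1
  mem_a : a ∈ Ioo (T.start 2) (T.finish 2)
  mem_b : b ∈ Ioo (T.start 2) (T.finish 2)
  im_a : (T.path D 2 a).im = 0
  re_b : (T.path D 2 b).re = 0
  ne_zero : ∀ t ∈ T.interval 2, t ≠ a → t ≠ b → (T.path D 2 t).re ≠ 0 ∧ (T.path D 2 t).im ≠ 0
  re_a : 0 ≤ ε * (T.path D 2 a).re
  im_b : 0 ≤ ε * (T.path D 2 b).im
  order : 0 < ε * (b - a)
  deriv_a : 0 ≤ (deriv (D.curve (T.comp 2)) a).im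
  deriv_b : (deriv (D.curve (T.comp 2)) b).re ≤ 0
  under_a : T.Under D 2 a ↔ height 2 < height 0
  under_b : T.Under D 2 b ↔ height 2 < height 1

/-- The differences with `0` are the differences of entries of `crossingOrder`. -/
theorem mul_pos_iff_of_sign {ε p r : ℝ} (hε : ε = 1 ∨ ε = -1) (hr : 0 < ε * r) :
    (0 < p * r ↔ 0 < ε * (p - 0)) ∧ (p * r < 0 ↔ 0 < ε * (0 - p)) := by
  have key (p : ℝ) : 0 < p * r ↔ 0 < ε * p := by
    rcases hε with rfl | rfl
    · rw [one_mul] at hr ⊢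
      exact mul_pos_iff_of_pos_right hr
    · rw [neg_one_mul, neg_pos] at hr ⊢
      exact ⟨fun h => neg_of_mul_pos_left h hr.le, fun h => mul_pos_of_neg_of_neg h hr⟩
  rw [sub_zero, zero_sub, ← key, ← key, neg_mul, neg_pos]
  exact ⟨Iff.rfl, Iff.rfl⟩

/-- On a diameter, time order is position order up to the direction `p` or `q`, and `ε` is the side
of the centre on which strand `2` crosses. So `ε = -1` reverses all orders, while the directions of
crossing, and with them the signs, do not involve `ε`. -/
theorem CrossesAxes.exists_triangle (hh : Function.Injective height) {ε t₀ a b : ℝ}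
    (h : T.CrossesAxes D height ε t₀ a b) :
    ∃ (p q : ℝ) (τ : Matrix (Fin 3) (Fin 3) ℝ), (p = 1 ∨ p = -1) ∧ (q = 1 ∨ q = -1) ∧
      StrictMonoOn (fun t => p * (T.path D 0 t).re) (T.interval 0) ∧
      StrictMonoOn (fun t => q * (T.path D 1 t).im) (T.interval 1) ∧
      T.Triangle D height τ (crossingSign p q) ∧ ∀ i j k, i ≠ j → i ≠ k → j ≠ k →
        (τ i j < τ i k ↔ 0 < ε * (crossingOrder p q i k - crossingOrder p q i j)) := by
  obtain ⟨p, hp, hpd, hpm, hpi, hps⟩ := h.fill.exists_diameter Complex.reCLM Complex.imCLM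
    reCLM_sq_add_imCLM_sq (i := 0) h.real
  obtain ⟨q, hq, hqd, hqm, hqi, hqs⟩ := h.fill.exists_diameter Complex.imCLM Complex.reCLM
    imCLM_sq_add_reCLM_sq (i := 1) h.imag
  simp only [Complex.reCLM_apply, Complex.imCLM_apply] at hpd hpm hps hqd hqm hqs
  have ha' := Ioo_subset_Icc_self h.mem_a
  have hb' := Ioo_subset_Icc_self h.mem_b
  obtain ⟨s₀, hs₀, hs₀z⟩ := hqs 0 rfl (by simp)
  obtain ⟨u, hu, hua⟩ := hps _ h.im_a (h.fill.norm_lt h.mem_a)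
  obtain ⟨v, hv, hvb⟩ := hqs _ h.re_b (h.fill.norm_lt h.mem_b)
  have hs₀' : s₀ ∈ T.interval 1 := Ioo_subset_Icc_self hs₀
  have hu' : u ∈ T.interval 0 := Ioo_subset_Icc_self hu
  have hv' : v ∈ T.interval 1 := Ioo_subset_Icc_self hv
  have ht₀ : t₀ ∈ Ioo (T.start 0) (T.finish 0) := by
    refine ⟨lt_of_le_of_ne h.mem_center.1 ?_, lt_of_le_of_ne h.mem_center.2 ?_⟩
    · intro he
      have := h.fill.norm_start 0
      rw [he, h.center, norm_zero] at this
      exact zero_ne_one this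
    · intro he
      have := h.fill.norm_finish 0
      rw [← he, h.center, norm_zero] at this
      exact zero_ne_one this
  -- The other two strands cross at the centre, so a third one there would be a triple point. This
  -- makes the sign conditions at `a` and `b` strict.
  have hne (t : ℝ) (ht : t ∈ T.interval 2) : T.path D 2 t ≠ 0 := by
    intro hz
    have h1 : IsDouble D.curve (T.comp 2, t) (T.comp 0, t₀) :=
      (isDouble_iff ht h.mem_center).2 ⟨fun h => by simp at h, hz.trans h.center.symm⟩
    have h2 : IsDouble D.curve (T.comp 2, t) (T.comp 1, s₀) :=
      (isDouble_iff ht hs₀').2 ⟨fun h => by simp at h, hz.trans hs₀z.symm⟩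
    have h3 := (T.eq_of_samePoint h.mem_center hs₀' (D.no_triple _ _ _ h1 h2)).1
    simp at h3
  have hε : ε ≠ 0 := by rcases h.sign_eq with h | h <;> rw [h] <;> norm_num
  have hra : (T.path D 2 a).re ≠ 0 := fun h0 => hne a ha' (Complex.ext h0 h.im_a)
  have hib : (T.path D 2 b).im ≠ 0 := fun h0 => hne b hb' (Complex.ext h.re_b h0)
  have hra' : 0 < ε * (T.path D 2 a).re := lt_of_le_of_ne h.re_a (mul_ne_zero hε hra).symm
  have hib' : 0 < ε * (T.path D 2 b).im := lt_of_le_of_ne h.im_b (mul_ne_zero hε hib).symm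
  have c01 : T.Crossing D height 0 1 t₀ s₀ (p * q) := by
    refine ⟨ht₀, hs₀, h.center.trans hs₀z.symm, fun s hs t ht he => ?_, h.under_center, ?_⟩
    · have hz : T.path D 0 s = 0 := Complex.ext (by rw [he]; exact h.imag t ht) (h.real s hs)
      exact ⟨hpi hs h.mem_center (hz.trans h.center.symm),
        hqi ht hs₀' ((he.symm.trans hz).trans hs₀z.symm)⟩
    · have h1 := mul_pos (hpd t₀ ht₀).1 (hqd s₀ hs₀).1
      rw [Diagram.crossDet, planeDet]
      simp only [(hpd t₀ ht₀).2, zero_mul, sub_zero]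
      linarith
  have c20 : T.Crossing D height 2 0 a u (-p) := by
    have hd : IsDouble D.curve (T.comp 2, a) (T.comp 0, u) :=
      (isDouble_iff ha' hu').2 ⟨fun h => by simp at h, hua.symm⟩
    refine ⟨h.mem_a, hu, hua.symm, fun s hs t ht he => ?_, h.under_a, ?_⟩
    · have hz : (T.path D 2 s).im = 0 := by
        rw [he]
        exact h.real t ht
      obtain rfl : s = a := by
        by_contra hsa
        rcases eq_or_ne s b with rfl | hsb
        · exact hib hz
        · exact (h.ne_zero s hs hsa hsb).2 hz
      exact ⟨rfl, hpi ht hu' (he.symm.trans hua.symm)⟩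
    · have h1 := D.transverse _ _ hd
      rw [Diagram.crossDet]
      simp only [planeDet, (hpd u hu).2, mul_zero, zero_sub] at h1 ⊢
      have h2 : 0 < (deriv (D.curve (T.comp 2)) a).im :=
        lt_of_le_of_ne h.deriv_a fun h0 => h1 (by rw [← h0, zero_mul, neg_zero])
      linarith [mul_pos h2 (hpd u hu).1]
  have c21 : T.Crossing D height 2 1 b v (-q) := by
    have hd : IsDouble D.curve (T.comp 2, b) (T.comp 1, v) :=
      (isDouble_iff hb' hv').2 ⟨fun h => by simp at h, hvb.symm⟩
    refine ⟨h.mem_b, hv, hvb.symm, fun s hs t ht he => ?_, h.under_b, ?_⟩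
    · have hz : (T.path D 2 s).re = 0 := by
        rw [he]
        exact h.imag t ht
      obtain rfl : s = b := by
        by_contra hsb
        rcases eq_or_ne s a with rfl | hsa
        · exact hra hz
        · exact (h.ne_zero s hs hsa hsb).1 hz
      exact ⟨rfl, hqi ht hv' (he.symm.trans hvb.symm)⟩
    · have h1 := D.transverse _ _ hd
      rw [Diagram.crossDet]
      simp only [planeDet, (hqd v hv).2, mul_zero, sub_zero] at h1 ⊢
      have h2 : (deriv (D.curve (T.comp 2)) b).re < 0 :=
        lt_of_le_of_ne h.deriv_b fun h0 => h1 (by rw [h0, zero_mul])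
      linarith [mul_pos (neg_pos.2 h2) (hqd v hv).1]
  have c10 := c01.symm (by simp) (hh.ne (by simp))
  have c02 := c20.symm (by simp) (hh.ne (by simp))
  have c12 := c21.symm (by simp) (hh.ne (by simp))
  rw [neg_neg] at c02 c12
  have o0 (s t : ℝ) (hs : s ∈ T.interval 0) (ht : t ∈ T.interval 0) :
      s < t ↔ p * (T.path D 0 s).re < p * (T.path D 0 t).re := (hpm.lt_iff_lt hs ht).symm
  have o1 (s t : ℝ) (hs : s ∈ T.interval 1) (ht : t ∈ T.interval 1) :
      s < t ↔ q * (T.path D 1 s).im < q * (T.path D 1 t).im := (hqm.lt_iff_lt hs ht).symm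
  have o012 : t₀ < u ↔ 0 < ε * (p - 0) := by
    rw [o0 _ _ h.mem_center hu', h.center, hua, Complex.zero_re, mul_zero]
    exact (mul_pos_iff_of_sign h.sign_eq hra').1
  have o021 : u < t₀ ↔ 0 < ε * (0 - p) := by
    rw [o0 _ _ hu' h.mem_center, h.center, hua, Complex.zero_re, mul_zero]
    exact (mul_pos_iff_of_sign h.sign_eq hra').2
  have o102 : s₀ < v ↔ 0 < ε * (q - 0) := by
    rw [o1 _ _ hs₀' hv', hs₀z, hvb, Complex.zero_im, mul_zero]
    exact (mul_pos_iff_of_sign h.sign_eq hib').1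
  have o120 : v < s₀ ↔ 0 < ε * (0 - q) := by
    rw [o1 _ _ hv' hs₀', hs₀z, hvb, Complex.zero_im, mul_zero]
    exact (mul_pos_iff_of_sign h.sign_eq hib').2
  have o201 : a < b ↔ 0 < ε * (1 - 0) := by
    have := (mul_pos_iff_of_sign (p := 1) h.sign_eq h.order).1
    rwa [one_mul, sub_pos] at this
  have o210 : b < a ↔ 0 < ε * (0 - 1) := by
    have := (mul_pos_iff_of_sign (p := 1) h.sign_eq h.order).2
    rwa [one_mul, sub_neg] at this
  -- Row `i` lists the times on strand `i`; the diagonal entries are placeholders.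
  refine ⟨p, q, !![0, t₀, u; s₀, 0, v; a, b, 0], hp, hq, hpm, hqm, ⟨h.fill, ?_, ?_⟩, ?_⟩
  · intro i
    fin_cases i
    exacts [hpi, hqi, h.inj]
  · intro i j hij
    fin_cases i <;> fin_cases j
    exacts [absurd rfl hij, c01, c02, c10, absurd rfl hij, c12, c20, c21, absurd rfl hij]
  · intro i j k hij hik hjk
    fin_cases i <;> fin_cases j <;> fin_cases k <;>
      first | exact absurd rfl hij | exact absurd rfl hik | exact absurd rfl hjk | skip
    exacts [o012, o021, o102, o120, o201, o210]

/-- The diameters are the same curves in `D` and `D'`; this identifies the directions obtained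
separately from the two diagrams. -/
theorem sign_unique {r : ℝ → ℝ} {a b p p' : ℝ} (hab : a < b) (hp : p = 1 ∨ p = -1)
    (hp' : p' = 1 ∨ p' = -1) (h : StrictMonoOn (fun t => p * r t) (Icc a b))
    (h' : StrictMonoOn (fun t => p' * r t) (Icc a b)) : p = p' := by
  have h1 := h (left_mem_Icc.2 hab.le) (right_mem_Icc.2 hab.le) hab
  have h2 := h' (left_mem_Icc.2 hab.le) (right_mem_Icc.2 hab.le) hab
  simp only at h1 h2
  rcases hp with rfl | rfl <;> rcases hp' with rfl | rfl <;> first | rfl | linarith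

end Strands

namespace Diagram

variable {n m : ℕ} {D D' : Diagram n m}

theorem ReidemeisterThree.sameColorings (h : ReidemeisterThree D D') :
    SameColorings.{u} D D' := by
  obtain ⟨T, hL, hreal, himag, hinj, hinj', height, t₀, t₁, t₂, t₁', t₂', hh, ht₀, hcenter,
    hu₀, hu₀', h1, h12, h2, hq4, hq1, hq2, hu₁, hu₂, h1', h12', h2', hq4', hq3', hq2',
    hu₁', hu₂'⟩ := h
  have cre (E : Diagram n m) : Continuous fun t => (T.path E 2 t).re :=
    Complex.continuous_re.comp (Strands.continuous_path T E 2)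
  have cim (E : Diagram n m) : Continuous fun t => (T.path E 2 t).im :=
    Complex.continuous_im.comp (Strands.continuous_path T E 2)
  have hA : T.CrossesAxes D height 1 t₀ t₁ t₂ := by
    have him : (T.path D 2 t₁).im = 0 := le_antisymm
      (nonpos_on_Icc (cim D) h1 (fun s hs => (hq4 s ⟨hs.1.le, hs.2⟩).2) (right_mem_Icc.2 h1.le))
      (nonneg_on_Icc (cim D) h12 (fun s hs => (hq1 s hs).2) (left_mem_Icc.2 h12.le))
    have hre : (T.path D 2 t₂).re = 0 := le_antisymm
      (nonpos_on_Icc (cre D) h2 (fun s hs => (hq2 s ⟨hs.1, hs.2.le⟩).1) (left_mem_Icc.2 h2.le))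
      (nonneg_on_Icc (cre D) h12 (fun s hs => (hq1 s hs).1) (right_mem_Icc.2 h12.le))
    refine ⟨hL.1, fun t ht => (hreal t ht).1, fun t ht => (himag t ht).1, hinj, Or.inl rfl, ht₀,
      hcenter, hu₀, ⟨h1, h12.trans h2⟩, ⟨h1.trans h12, h2⟩, him, hre, fun t ht hta htb => ?_,
      ?_, ?_, ?_, ?_, ?_, hu₁, hu₂⟩
    · rcases hta.lt_or_gt with h | h
      · exact ⟨(hq4 t ⟨ht.1, h⟩).1.ne', (hq4 t ⟨ht.1, h⟩).2.ne⟩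
      rcases htb.lt_or_gt with h' | h'
      · exact ⟨(hq1 t ⟨h, h'⟩).1.ne', (hq1 t ⟨h, h'⟩).2.ne'⟩
      · exact ⟨(hq2 t ⟨h', ht.2⟩).1.ne, (hq2 t ⟨h', ht.2⟩).2.ne'⟩
    · rw [one_mul]
      exact nonneg_on_Icc (cre D) h12 (fun s hs => (hq1 s hs).1) (left_mem_Icc.2 h12.le)
    · rw [one_mul]
      exact nonneg_on_Icc (cim D) h12 (fun s hs => (hq1 s hs).2) (right_mem_Icc.2 h12.le)
    · linarith
    · exact deriv_nonneg_of_right (T.hasDerivAt_im D 2 t₁) h12 him fun s hs => (hq1 s hs).2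
    · exact deriv_nonpos_of_right (T.hasDerivAt_re D 2 t₂) h2 hre
        fun s hs => (hq2 s ⟨hs.1, hs.2.le⟩).1
  -- In `D'` the imaginary axis is crossed first, so the time on the real axis is the later one,
  -- `t₂'`.
  have hA' : T.CrossesAxes D' height (-1) t₀ t₂' t₁' := by
    have hre : (T.path D' 2 t₁').re = 0 := le_antisymm
      (nonpos_on_Icc (cre D') h12' (fun s hs => (hq3' s hs).1) (left_mem_Icc.2 h12'.le))
      (nonneg_on_Icc (cre D') h1' (fun s hs => (hq4' s ⟨hs.1.le, hs.2⟩).1)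
        (right_mem_Icc.2 h1'.le))
    have him : (T.path D' 2 t₂').im = 0 := le_antisymm
      (nonpos_on_Icc (cim D') h12' (fun s hs => (hq3' s hs).2) (right_mem_Icc.2 h12'.le))
      (nonneg_on_Icc (cim D') h2' (fun s hs => (hq2' s ⟨hs.1, hs.2.le⟩).2)
        (left_mem_Icc.2 h2'.le))
    refine ⟨hL.2.1, fun t ht => ?_, fun t ht => ?_, hinj', Or.inr rfl, ht₀,
      (hreal t₀ ht₀).2.trans hcenter, hu₀', ⟨h1'.trans h12', h2'⟩, ⟨h1', h12'.trans h2'⟩, him, hre,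
      fun t ht hta htb => ?_, ?_, ?_, ?_, ?_, ?_, hu₂', hu₁'⟩
    · rw [(hreal t ht).2]
      exact (hreal t ht).1
    · rw [(himag t ht).2]
      exact (himag t ht).1
    · rcases htb.lt_or_gt with h | h
      · exact ⟨(hq4' t ⟨ht.1, h⟩).1.ne', (hq4' t ⟨ht.1, h⟩).2.ne⟩
      rcases hta.lt_or_gt with h' | h'
      · exact ⟨(hq3' t ⟨h, h'⟩).1.ne, (hq3' t ⟨h, h'⟩).2.ne⟩
      · exact ⟨(hq2' t ⟨h', ht.2⟩).1.ne, (hq2' t ⟨h', ht.2⟩).2.ne'⟩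
    · have := nonpos_on_Icc (cre D') h12' (fun s hs => (hq3' s hs).1) (right_mem_Icc.2 h12'.le)
      linarith
    · have := nonpos_on_Icc (cim D') h12' (fun s hs => (hq3' s hs).2) (left_mem_Icc.2 h12'.le)
      linarith
    · linarith
    · exact deriv_nonneg_of_right (T.hasDerivAt_im D' 2 t₂') h2' him
        fun s hs => (hq2' s ⟨hs.1, hs.2.le⟩).2
    · exact deriv_nonpos_of_right (T.hasDerivAt_re D' 2 t₁') h12' hre fun s hs => (hq3' s hs).1
  obtain ⟨p, q, τ, hp, hq, hpm, hqm, hτ, hord⟩ := hA.exists_triangle hh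
  obtain ⟨p', q', τ', hp', hq', hpm', hqm', hτ', hord'⟩ := hA'.exists_triangle hh
  obtain rfl : p = p' := Strands.sign_unique (T.start_lt_finish 0) hp hp' hpm
    (hpm'.congr fun t ht => by simp only [(hreal t ht).2])
  obtain rfl : q = q' := Strands.sign_unique (T.start_lt_finish 1) hq hq' hqm
    (hqm'.congr fun t ht => by simp only [(himag t ht).2])
  refine hL.sameColorings_of_triangle hh hp hq hτ hτ' (fun i j k hij hik hjk => ?_)
    fun i j k hij hik hjk => ?_
  · rw [hord i j k hij hik hjk, one_mul, sub_pos]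
  · rw [hord' i j k hij hik hjk, neg_one_mul, neg_sub, sub_pos]

/-! ### Invariance -/

theorem SameLinkoid.nonempty_equiv {D D' : Diagram n m} (h : D.SameLinkoid D')
    (X : PointedQuandle.{u} (2 * n)) :
    Nonempty (D.PointedColoring X ≃ D'.PointedColoring X) := by
  induction h with
  | rel D D' h =>
    have key : SameColorings.{u} D D' := by
      rcases h with h | h | h | h | h | h
      exacts [h.sameColorings, h.sameColorings, h.sameColorings, h.sameColorings, h.sameColorings,
        h.sameColorings]
    exact ⟨((D.nonempty_pointedColoring_equiv X).some.trans (key X).some).trans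
      (D'.nonempty_pointedColoring_equiv X).some.symm⟩
  | refl D => exact ⟨Equiv.refl _⟩
  | symm D D' _ ih => exact ⟨ih.some.symm⟩
  | trans D D' D'' _ _ ih ih' => exact ⟨ih.some.trans ih'.some⟩

end Diagram

end Linkoid

theorem mainTheorem10 :
    (∀ (n m : ℕ) (X : PointedQuandle.{u} (2 * n)) (D D' : Linkoid.Diagram n m),
      D.SameLinkoid D' → D.pointedCount X = D'.pointedCount X) ∧
    (∀ (m : ℕ) (X : Type u) [Quandle X] [Finite X] (D D' : Linkoid.Diagram 1 m),
      (∀ i j : X, Finite (D.PointedColoring (Linkoid.Diagram.twoPointed X i j))) ∧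
      (D.SameLinkoid D' → D.countingMatrix X = D'.countingMatrix X)) := by
  refine ⟨fun n m X D D' h => Cardinal.mk_congr (h.nonempty_equiv X).some,
    fun m X _ hX D D' => ⟨fun i j => ?_, fun h => ?_⟩⟩
  · have : Finite (Linkoid.Diagram.twoPointed X i j).carrier := hX
    exact D.finite_pointedColoring _
  · ext i j
    exact Nat.card_congr (h.nonempty_equiv (Linkoid.Diagram.twoPointed X i j)).some
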